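/- **Setting.** Let $\mathcal H$ be a separable complex Hilbert space, $\mathcal B(\mathcal H)$ its bounded operators, $\mathcal T(\mathcal H)$ the trace-class operators with the trace norm; for a map $\Phi$ on $\mathcal T(\mathcal H)$, $\Phi^*[a]\in\mathcal B(\mathcal H)$ is defined by $\mathrm{Tr}\{\Phi^*[a]\rho\}=\mathrm{Tr}\{a\,\Phi[\rho]\}$ for all $\rho\in\mathcal T(\mathcal H)$. Let $(\Omega,\mathcal F,(\mathcal F_t)_{t\ge0},\mathbb Q)$ be a filtered probability space with independent $(\mathcal F_t)$-Poisson processes $N_u$, $u\in\mathcal U$ ($\mathcal U$ finite or countable), of intensities $\nu_u>0$ with $\nu:=\sum_u\nu_u<\infty$. Let $V=\{x(1),x(2),\dots\}\subset\mathbb R^s$ be a finite or countable set of vertices, $F_u\subset V$ and $y^u:F_u\to V$. For $x\in V$ let $H(x)=H(x)^\dagger$, $L_k(x)$, $J_j(x,u)$ be bounded operators ($j$ and $k$ in finite or countable index sets), such that the sums $$R_0(x)=\sum_k L_k(x)^\dagger L_k(x),\qquad R(x)=\sum_u\nu_u 1_{F_u}(x)\sum_j J_j(x,u)^\dagger J_j(x,u)$$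 (the inner sum for $x\in F_u$) converge strongly to bounded operators, and put $$\mathcal J(x,u)[\rho]=1_{F_u}(x)\sum_jJ_j(x,u)\rho J_j(x,u)^\dagger,\qquad \mathcal L_0(x)[\rho]=-i[H(x),\rho]-\tfrac12\{R_0(x),\rho\}+\sum_kL_k(x)\rho L_k(x)^\dagger .$$ The walker $X$ is an adapted càdlàg process with $X(0)\in V$ a.s. and $$dX(t)=\sum_u\big(y^u(X(t_-))-X(t_-)\big)1_{F_u}(X(t_-))\,dN_u(t).$$ Assume $\operatorname{ess\,sup}_\omega\int_0^t\|A(X(s_-))\|\,ds<\infty$ for all $t\ge 0$ and for $A=H,R,R_0$. Let $\rho_0(x)$, $x\in V$, be statistical operators (positive, trace one), and let $\sigma$ be an adapted $\mathcal T(\mathcal H)$-valued process, càdlàg in trace norm, with $\sigma(0)=\rho_0(X(0))$ and $$d\sigma(t)=\mathcal L_0(X(t_-))[\sigma(t_-)]\,dt-\tfrac12\{R(X(t_-))-\nu\mathbf 1,\sigma(t_-)\}\,dt+\sum_u\big(\mathcal J(X(t_-),u)[\sigma(t_-)]-\sigma(t_-)\big)dN_u(t).$$ **Proposition (Lindblad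 rate equation).** For each vertex $x(k)$ and $t\ge0$ the operator $\sigma(t)\delta_{X(t),x(k)}$ is $\mathbb Q$-integrable in $\mathcal T(\mathcal H)$. The reduced operators $\eta_k(t)=\mathbb E_{\mathbb Q}[\sigma(t)\delta_{X(t),x(k)}]$ are positive, with $\sum_k\mathrm{Tr}\,\eta_k(t)=1$. They satisfy, in trace norm and for all $t\ge 0$ (one-sided derivative at $t=0$), with a series over $l$ that converges unconditionally in $\mathcal T(\mathcal H)$, the closed system $$\frac{d}{dt}\eta_k(t)=\mathcal L_0(x(k))[\eta_k(t)]+\sum_{l}\Big(\mathcal T(k,l)[\eta_l(t)]-\tfrac12\big\{\mathcal T(l,k)^*[\mathbf 1],\eta_k(t)\big\}\Big),$$ $$\mathcal T(k,l)[\rho]=\sum_u\nu_u\,\delta_{y^u(x(l)),x(k)}\,\mathcal J(x(l),u)[\rho].$$ -/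

import Mathlib

open MeasureTheory ProbabilityTheory Filter Topology Set
open scoped NNReal ENNReal InnerProductSpace

noncomputable section

/-! ## Trace-class operators -/

section TraceClassOperators

variable {𝓗 : Type*} [NormedAddCommGroup 𝓗] [InnerProductSpace ℂ 𝓗]

/-- The trace norm (possibly infinite) of a bounded operator `T`, as the dual of the operator norm:
the supremum of `|Tr (T F)|` over all finite-rank operators `F = ∑ i, |a i⟩⟨b i|` with `‖F‖ ≤ 1`,
where `Tr (T F) = ∑ i, ⟨b i, T (a i)⟩`. -/
def traceENorm (T : 𝓗 →L[ℂ] 𝓗) : ℝ≥0∞ :=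
  ⨆ (n : ℕ) (a : Fin n → 𝓗) (b : Fin n → 𝓗)
    (_ : ‖∑ i, InnerProductSpace.rankOne ℂ (a i) (b i)‖ ≤ 1), ‖∑ i, ⟪b i, T (a i)⟫_ℂ‖ₑ

lemma le_traceENorm (T : 𝓗 →L[ℂ] 𝓗) {n : ℕ} (a b : Fin n → 𝓗)
    (h : ‖∑ i, InnerProductSpace.rankOne ℂ (a i) (b i)‖ ≤ 1) :
    ‖∑ i, ⟪b i, T (a i)⟫_ℂ‖ₑ ≤ traceENorm T :=
  le_iSup_of_le n <| le_iSup_of_le a <| le_iSup_of_le b <| le_iSup_of_le h le_rfl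

lemma traceENorm_le {T : 𝓗 →L[ℂ] 𝓗} {c : ℝ≥0∞}
    (h : ∀ (n : ℕ) (a b : Fin n → 𝓗), ‖∑ i, InnerProductSpace.rankOne ℂ (a i) (b i)‖ ≤ 1 →
      ‖∑ i, ⟪b i, T (a i)⟫_ℂ‖ₑ ≤ c) : traceENorm T ≤ c :=
  iSup_le fun n => iSup_le fun a => iSup_le fun b => iSup_le fun hab => h n a b hab

lemma traceENorm_add_le (S T : 𝓗 →L[ℂ] 𝓗) :
    traceENorm (S + T) ≤ traceENorm S + traceENorm T := by
  refine traceENorm_le fun n a b h => ?_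
  simp only [add_apply, inner_add_right, Finset.sum_add_distrib]
  exact (enorm_add_le _ _).trans (add_le_add (le_traceENorm S a b h) (le_traceENorm T a b h))

lemma traceENorm_smul_le (c : ℂ) (T : 𝓗 →L[ℂ] 𝓗) :
    traceENorm (c • T) ≤ ‖c‖ₑ * traceENorm T := by
  refine traceENorm_le fun n a b h => ?_
  simp only [smul_apply, inner_smul_right, ← Finset.mul_sum, enorm_mul]
  gcongr
  exact le_traceENorm T a b h

lemma traceENorm_zero : traceENorm (0 : 𝓗 →L[ℂ] 𝓗) = 0 :=
  le_antisymm (traceENorm_le fun n a b _ => by simp) bot_le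

/-- The operator norm is dominated by the trace norm. -/
lemma enorm_le_traceENorm (T : 𝓗 →L[ℂ] 𝓗) : ‖T‖ₑ ≤ traceENorm T := by
  by_cases htop : traceENorm T = ⊤
  · simp [htop]
  have key : ‖T‖ ≤ (traceENorm T).toReal := by
    refine ContinuousLinearMap.opNorm_le_bound _ ENNReal.toReal_nonneg fun x => ?_
    by_cases hTx : T x = 0
    · rw [hTx, norm_zero]; positivity
    by_cases hx : x = 0
    · simp [hx] at hTx
    have h1 : ‖∑ _i : Fin 1, InnerProductSpace.rankOne ℂ ((‖x‖⁻¹ : ℂ) • x)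
        ((‖T x‖⁻¹ : ℂ) • T x)‖ ≤ 1 := by
      have hx' : ‖x‖ ≠ 0 := norm_ne_zero_iff.2 hx
      have hTx' : ‖T x‖ ≠ 0 := norm_ne_zero_iff.2 hTx
      refine le_of_eq ?_
      simp [norm_smul]
      field_simp
    have h2 := le_traceENorm T (n := 1) (fun _ => (‖x‖⁻¹ : ℂ) • x)
      (fun _ => (‖T x‖⁻¹ : ℂ) • T x) h1
    rw [← ofReal_norm, ENNReal.ofReal_le_iff_le_toReal htop] at h2
    have hx' : 0 < ‖x‖ := norm_pos_iff.2 hx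
    have hTx' : 0 < ‖T x‖ := norm_pos_iff.2 hTx
    have h3 : ‖∑ _i : Fin 1, ⟪(‖T x‖⁻¹ : ℂ) • T x, T ((‖x‖⁻¹ : ℂ) • x)⟫_ℂ‖ = ‖T x‖ / ‖x‖ := by
      simp only [Finset.univ_unique, Finset.sum_singleton, map_smul, inner_smul_left,
        inner_smul_right, inner_self_eq_norm_sq_to_K, norm_mul, norm_pow]
      simp
      field_simp
    rw [h3, div_le_iff₀ hx'] at h2
    exact h2
  rw [← ofReal_norm]
  exact ENNReal.ofReal_le_of_le_toReal key

variable (𝓗) in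
/-- The linear subspace of trace-class operators among the bounded operators. -/
def traceClassSubmodule : Submodule ℂ (𝓗 →L[ℂ] 𝓗) where
  carrier := {T | traceENorm T < ⊤}
  add_mem' {S T} hS hT := (traceENorm_add_le S T).trans_lt (ENNReal.add_lt_top.2 ⟨hS, hT⟩)
  zero_mem' := by simp [traceENorm_zero]
  smul_mem' c T hT := (traceENorm_smul_le c T).trans_lt (ENNReal.mul_lt_top (by simp) hT)

variable (𝓗) in
/-- The space of trace-class operators on `𝓗`; it carries the trace norm. -/
def TraceClass : Type _ := ↥(traceClassSubmodule 𝓗)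

namespace TraceClass

instance : AddCommGroup (TraceClass 𝓗) := inferInstanceAs (AddCommGroup ↥(traceClassSubmodule 𝓗))

instance : Module ℂ (TraceClass 𝓗) := inferInstanceAs (Module ℂ ↥(traceClassSubmodule 𝓗))

/-- The bounded operator underlying a trace-class operator. -/
def toOp : TraceClass 𝓗 →ₗ[ℂ] (𝓗 →L[ℂ] 𝓗) := (traceClassSubmodule 𝓗).subtype

lemma toOp_injective : Function.Injective (toOp : TraceClass 𝓗 → 𝓗 →L[ℂ] 𝓗) :=
  Subtype.val_injective

lemma traceENorm_lt_top (T : TraceClass 𝓗) : traceENorm (toOp T) < ⊤ := T.2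

instance : Norm (TraceClass 𝓗) := ⟨fun T => (traceENorm (toOp T)).toReal⟩

lemma norm_def (T : TraceClass 𝓗) : ‖T‖ = (traceENorm (toOp T)).toReal := rfl

lemma norm_toOp_le (T : TraceClass 𝓗) : ‖toOp T‖ ≤ ‖T‖ := by
  have h := enorm_le_traceENorm (toOp T)
  rw [← ofReal_norm] at h
  exact (ENNReal.ofReal_le_iff_le_toReal (traceENorm_lt_top T).ne).1 h

lemma norm_smul_le_aux (c : ℂ) (T : TraceClass 𝓗) : ‖c • T‖ ≤ ‖c‖ * ‖T‖ := by
  rw [norm_def, norm_def, map_smul]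
  have h := ENNReal.toReal_mono
    (ENNReal.mul_lt_top (by simp) (traceENorm_lt_top T)).ne (traceENorm_smul_le c (toOp T))
  simpa [ENNReal.toReal_mul] using h

lemma normedSpaceCore : NormedSpace.Core ℂ (TraceClass 𝓗) where
  norm_nonneg _ := ENNReal.toReal_nonneg
  norm_smul c T := by
    refine le_antisymm (norm_smul_le_aux c T) ?_
    by_cases hc : c = 0
    · simp [hc, norm_def]
    have h := norm_smul_le_aux c⁻¹ (c • T)
    rw [smul_smul, inv_mul_cancel₀ hc, one_smul, norm_inv] at h
    have hc' : 0 < ‖c‖ := norm_pos_iff.2 hc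
    calc ‖c‖ * ‖T‖ ≤ ‖c‖ * (‖c‖⁻¹ * ‖c • T‖) := by gcongr
      _ = ‖c • T‖ := by field_simp
  norm_triangle S T := by
    rw [norm_def, norm_def, norm_def, map_add,
      ← ENNReal.toReal_add (traceENorm_lt_top S).ne (traceENorm_lt_top T).ne]
    exact ENNReal.toReal_mono
      (ENNReal.add_lt_top.2 ⟨traceENorm_lt_top S, traceENorm_lt_top T⟩).ne
      (traceENorm_add_le _ _)
  norm_eq_zero_iff T := by
    constructor
    · intro h
      have h1 : ‖toOp T‖ ≤ 0 := h ▸ norm_toOp_le T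
      exact toOp_injective (by simpa using h1)
    · rintro rfl
      simp [norm_def, traceENorm_zero]

instance : NormedAddCommGroup (TraceClass 𝓗) := NormedAddCommGroup.ofCore normedSpaceCore

instance : NormedSpace ℂ (TraceClass 𝓗) := NormedSpace.ofCore normedSpaceCore

lemma enorm_eq (T : TraceClass 𝓗) : ‖T‖ₑ = traceENorm (toOp T) := by
  rw [← ofReal_norm, norm_def, ENNReal.ofReal_toReal (traceENorm_lt_top T).ne]

instance [CompleteSpace 𝓗] : CompleteSpace (TraceClass 𝓗) := by
  refine Metric.complete_of_cauchySeq_tendsto fun T hT => ?_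
  have hop : CauchySeq fun n => toOp (T n) := by
    rw [Metric.cauchySeq_iff] at hT ⊢
    intro ε hε
    obtain ⟨M, hM⟩ := hT ε hε
    refine ⟨M, fun m hm n hn => ?_⟩
    have h := hM m hm n hn
    rw [dist_eq_norm] at h ⊢
    rw [← map_sub]
    exact (norm_toOp_le _).trans_lt h
  obtain ⟨S, hS⟩ := cauchySeq_tendsto_of_complete hop
  have key : ∀ ε > 0, ∃ M, ∀ n ≥ M, traceENorm (toOp (T n) - S) ≤ ENNReal.ofReal ε := by
    intro ε hε
    obtain ⟨M, hM⟩ := Metric.cauchySeq_iff.1 hT ε hε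
    refine ⟨M, fun n hn => traceENorm_le fun d a b hab => ?_⟩
    have hlim : Tendsto (fun m => ‖∑ i, ⟪b i, (toOp (T n) - toOp (T m)) (a i)⟫_ℂ‖ₑ) atTop
        (𝓝 ‖∑ i, ⟪b i, (toOp (T n) - S) (a i)⟫_ℂ‖ₑ) := by
      refine (continuous_enorm.tendsto _).comp (tendsto_finsetSum _ fun i _ => ?_)
      refine Tendsto.inner tendsto_const_nhds ?_
      have h1 : Tendsto (fun m => toOp (T n) - toOp (T m)) atTop (𝓝 (toOp (T n) - S)) :=
        tendsto_const_nhds.sub hS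
      exact ((ContinuousLinearMap.apply ℂ 𝓗 (a i)).continuous.tendsto _).comp h1
    refine le_of_tendsto hlim (eventually_atTop.2 ⟨M, fun m hm => ?_⟩)
    refine (le_traceENorm _ a b hab).trans ?_
    rw [← map_sub, ← enorm_eq, ← ofReal_norm, ← dist_eq_norm]
    exact ENNReal.ofReal_le_ofReal (hM n hn m hm).le
  have hSmem : traceENorm S < ⊤ := by
    obtain ⟨M, hM⟩ := key 1 one_pos
    have h1 : traceENorm (S - toOp (T M)) ≤ ENNReal.ofReal 1 := by
      have h2 := traceENorm_smul_le (-1) (toOp (T M) - S)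
      have h3 : (-1 : ℂ) • (toOp (T M) - S) = S - toOp (T M) := by simp
      rw [h3] at h2
      simpa using h2.trans (by simpa using hM M le_rfl)
    have h4 := traceENorm_add_le (S - toOp (T M)) (toOp (T M))
    rw [sub_add_cancel] at h4
    exact h4.trans_lt (ENNReal.add_lt_top.2 ⟨h1.trans_lt ENNReal.ofReal_lt_top,
      traceENorm_lt_top _⟩)
  let S' : TraceClass 𝓗 := ⟨S, hSmem⟩
  have hS' : toOp S' = S := rfl
  refine ⟨S', Metric.tendsto_atTop.2 fun ε hε => ?_⟩
  obtain ⟨M, hM⟩ := key (ε / 2) (by positivity)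
  refine ⟨M, fun n hn => ?_⟩
  rw [dist_eq_norm, norm_def, map_sub, hS']
  have h := ENNReal.toReal_mono ENNReal.ofReal_ne_top (hM n hn)
  rw [ENNReal.toReal_ofReal (by positivity)] at h
  exact lt_of_le_of_lt h (by linarith)

variable [CompleteSpace 𝓗]

lemma traceENorm_mul_mul_le (A T B : 𝓗 →L[ℂ] 𝓗) :
    traceENorm (A * T * B) ≤ ‖B‖ₑ * ‖A‖ₑ * traceENorm T := by
  refine traceENorm_le fun n a b h => ?_
  by_cases hA : A = 0
  · simp [hA]
  by_cases hB : B = 0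
  · simp [hB]
  set c : ℂ := ((‖B‖ * ‖A‖ : ℝ) : ℂ) with hc
  have hA' : 0 < ‖A‖ := norm_pos_iff.2 hA
  have hB' : 0 < ‖B‖ := norm_pos_iff.2 hB
  have hc0 : c ≠ 0 := by
    rw [hc]; exact_mod_cast (mul_pos hB' hA').ne'
  have hcn : ‖c‖ = ‖B‖ * ‖A‖ := by
    rw [hc, Complex.norm_real, Real.norm_of_nonneg (by positivity)]
  have hF : ∑ i, InnerProductSpace.rankOne ℂ (c⁻¹ • B (a i)) (A.adjoint (b i)) =
      c⁻¹ • (B * (∑ i, InnerProductSpace.rankOne ℂ (a i) (b i)) * A) := by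
    ext x
    simp [ContinuousLinearMap.adjoint_inner_left, map_sum, Finset.smul_sum, smul_smul]
  have hle : ‖∑ i, InnerProductSpace.rankOne ℂ (c⁻¹ • B (a i)) (A.adjoint (b i))‖ ≤ 1 := by
    rw [hF, norm_smul, norm_inv, hcn, inv_mul_le_iff₀ (by positivity), mul_one]
    calc _ ≤ ‖B‖ * ‖∑ i, InnerProductSpace.rankOne ℂ (a i) (b i)‖ * ‖A‖ :=
          (norm_mul_le _ _).trans (by gcongr; exact norm_mul_le _ _)
      _ ≤ ‖B‖ * 1 * ‖A‖ := by gcongr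
      _ = _ := by ring
  have h2 := le_traceENorm T _ _ hle
  have h3 : ∑ i, ⟪b i, (A * T * B) (a i)⟫_ℂ =
      c * ∑ i, ⟪A.adjoint (b i), T (c⁻¹ • B (a i))⟫_ℂ := by
    rw [Finset.mul_sum]
    refine Finset.sum_congr rfl fun i _ => ?_
    simp only [ContinuousLinearMap.adjoint_inner_left, map_smul, inner_smul_right]
    rw [← mul_assoc, mul_inv_cancel₀ hc0, one_mul]
    rfl
  have hce : ‖c‖ₑ = ‖B‖ₑ * ‖A‖ₑ := by
    rw [← ofReal_norm, hcn, ENNReal.ofReal_mul (norm_nonneg _), ofReal_norm,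
      ofReal_norm]
  rw [h3, enorm_mul, hce]
  gcongr

/-- The trace-class operator `A ρ B`, for bounded `A`, `B` and trace-class `ρ`. -/
def sandwich (A : 𝓗 →L[ℂ] 𝓗) (ρ : TraceClass 𝓗) (B : 𝓗 →L[ℂ] 𝓗) : TraceClass 𝓗 :=
  ⟨A * toOp ρ * B, (traceENorm_mul_mul_le A (toOp ρ) B).trans_lt
    (ENNReal.mul_lt_top (ENNReal.mul_lt_top (by simp) (by simp)) (traceENorm_lt_top ρ))⟩

/-- The commutator `[A, ρ]`. -/
def commutator (A : 𝓗 →L[ℂ] 𝓗) (ρ : TraceClass 𝓗) : TraceClass 𝓗 :=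
  sandwich A ρ 1 - sandwich 1 ρ A

/-- The anticommutator `{A, ρ}`. -/
def anticommutator (A : 𝓗 →L[ℂ] 𝓗) (ρ : TraceClass 𝓗) : TraceClass 𝓗 :=
  sandwich A ρ 1 + sandwich 1 ρ A

/-- The trace of a trace-class operator, computed in a Hilbert basis. -/
def trace (ρ : TraceClass 𝓗) : ℂ :=
  let b := (exists_hilbertBasis ℂ 𝓗).choose_spec.choose
  ∑' i, ⟪b i, toOp ρ (b i)⟫_ℂ

/-- `Φ^*[a]`, for a map `Φ` on trace-class operators and a bounded operator `a`: the (unique)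
bounded operator `B` with `Tr (B ρ) = Tr (a Φ[ρ])` for all trace-class `ρ`. -/
def dualMap (Φ : TraceClass 𝓗 → TraceClass 𝓗) (a : 𝓗 →L[ℂ] 𝓗) : 𝓗 →L[ℂ] 𝓗 := by
  classical
  exact if h : ∃ B : 𝓗 →L[ℂ] 𝓗, ∀ ρ, trace (sandwich B ρ 1) = trace (sandwich a (Φ ρ) 1)
    then h.choose else 0

/-- Statistical operators: positive trace-class operators of trace one. -/
def IsStatisticalOperator (ρ : TraceClass 𝓗) : Prop :=
  (toOp ρ).IsPositive ∧ trace ρ = 1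

end TraceClass

/-- The series of bounded operators `∑ i, f i` converges in the strong operator topology to a
bounded operator. -/
def StronglySummable {ι : Type*} (f : ι → 𝓗 →L[ℂ] 𝓗) : Prop :=
  ∃ A : 𝓗 →L[ℂ] 𝓗, ∀ ψ, HasSum (fun i => f i ψ) (A ψ)

/-- The sum of a series of bounded operators in the strong operator topology. -/
def strongSum {ι : Type*} (f : ι → 𝓗 →L[ℂ] 𝓗) : 𝓗 →L[ℂ] 𝓗 := by
  classical
  exact if h : StronglySummable f then h.choose else 0

end TraceClassOperators

open TraceClass ContinuousLinearMap

/-! ## The data of the hybrid walk -/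

/-- The data of a hybrid quantum/classical walk: a countable set `V` of vertices in `ℝ^s`, the
regions `F u ⊆ V` where a count of type `u` moves the walker from `x` to `y u x`, the rates `ν u` of
the counts, and the operators of the quantum component as functions of the position. -/
structure HybridWalk (s : ℕ) (U D₁ D₂ 𝓗 : Type*) [NormedAddCommGroup 𝓗] [InnerProductSpace ℂ 𝓗]
    [CompleteSpace 𝓗] where
  V : Set (EuclideanSpace ℝ (Fin s))
  V_countable : V.Countable
  F : U → Set (EuclideanSpace ℝ (Fin s))
  F_subset : ∀ u, F u ⊆ V
  y : U → EuclideanSpace ℝ (Fin s) → EuclideanSpace ℝ (Fin s)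
  y_mem : ∀ u, ∀ x ∈ F u, y u x ∈ V
  ν : U → ℝ≥0
  ν_pos : ∀ u, 0 < ν u
  ν_summable : Summable ν
  H : EuclideanSpace ℝ (Fin s) → 𝓗 →L[ℂ] 𝓗
  H_selfAdjoint : ∀ x ∈ V, IsSelfAdjoint (H x)
  L : D₂ → EuclideanSpace ℝ (Fin s) → 𝓗 →L[ℂ] 𝓗
  L_summable : ∀ x ∈ V, StronglySummable fun k => adjoint (L k x) * L k x
  J : D₁ → EuclideanSpace ℝ (Fin s) → U → 𝓗 →L[ℂ] 𝓗
  J_summable : ∀ u, ∀ x ∈ F u, StronglySummable fun j => adjoint (J j x u) * J j x u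
  R_summable : ∀ x ∈ V, StronglySummable fun u =>
    (F u).indicator (fun x => (ν u : ℂ) • strongSum fun j => adjoint (J j x u) * J j x u) x

namespace HybridWalk

variable {s : ℕ} {U D₁ D₂ 𝓗 : Type*} [NormedAddCommGroup 𝓗] [InnerProductSpace ℂ 𝓗]
  [CompleteSpace 𝓗] (W : HybridWalk s U D₁ D₂ 𝓗)

/-- The total rate `ν = ∑ u, ν u`. -/
def totalRate : ℝ≥0 := ∑' u, W.ν u

/-- The jump map `𝒥(x,u)[ρ] = 1_{F u}(x) ∑ j, J j ρ (J j)†`. -/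
def jumpMap (x : EuclideanSpace ℝ (Fin s)) (u : U) (ρ : TraceClass 𝓗) : TraceClass 𝓗 :=
  (W.F u).indicator (fun x => ∑' j, sandwich (W.J j x u) ρ (adjoint (W.J j x u))) x

/-- `R(x) = ∑ u, ν u 1_{F u}(x) ∑ j, (J j)† J j`. -/
def R (x : EuclideanSpace ℝ (Fin s)) : 𝓗 →L[ℂ] 𝓗 :=
  strongSum fun u => (W.F u).indicator
    (fun x => (W.ν u : ℂ) • strongSum fun j => adjoint (W.J j x u) * W.J j x u) x

/-- `R₀(x) = ∑ k, (L k)† L k`. -/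
def R₀ (x : EuclideanSpace ℝ (Fin s)) : 𝓗 →L[ℂ] 𝓗 :=
  strongSum fun k => adjoint (W.L k x) * W.L k x

/-- `ℒ₀(x)[ρ] = -i [H, ρ] - ½ {R₀, ρ} + ∑ k, L k ρ (L k)†`. -/
def L₀ (x : EuclideanSpace ℝ (Fin s)) (ρ : TraceClass 𝓗) : TraceClass 𝓗 :=
  (-Complex.I) • commutator (W.H x) ρ - (1 / 2 : ℂ) • anticommutator (W.R₀ x) ρ
    + ∑' k, sandwich (W.L k x) ρ (adjoint (W.L k x))

open Classical in
/-- `𝒯(k,l)[ρ] = ∑ u, ν u δ_{y u l, k} 𝒥(l,u)[ρ]`. -/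
def transfer (k l : W.V) (ρ : TraceClass 𝓗) : TraceClass 𝓗 :=
  ∑' u, (W.ν u : ℂ) • (if W.y u l = (k : EuclideanSpace ℝ (Fin s)) then W.jumpMap l u ρ else 0)

end HybridWalk

/-! ## The driving noise and the stochastic equations -/

/-- Right continuous paths with left limits. -/
def IsCadlagPath {E : Type*} [TopologicalSpace E] (f : ℝ≥0 → E) : Prop :=
  ∀ t, ContinuousWithinAt f (Ici t) t ∧ ∃ l, Tendsto f (𝓝[<] t) (𝓝 l)

/-- `N u`, `u : U`, are independent Poisson processes of rates `ν u` with respect to the filtration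
`ℱ`: counting processes whose increments over `(s, t]` are mutually independent, jointly independent
of `ℱ s`, and Poisson distributed of parameters `ν u (t - s)`. -/
structure IsPoissonFamily {Ω U : Type*} {mΩ : MeasurableSpace Ω} (ℱ : Filtration ℝ≥0 mΩ)
    (Q : Measure Ω) (ν : U → ℝ≥0) (N : U → ℝ≥0 → Ω → ℕ) : Prop where
  adapted : ∀ u, Adapted ℱ (N u)
  zero : ∀ᵐ ω ∂Q, ∀ u, N u 0 ω = 0
  monotone : ∀ᵐ ω ∂Q, ∀ u, Monotone fun t => N u t ω
  cadlag : ∀ᵐ ω ∂Q, ∀ u, IsCadlagPath fun t => N u t ω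
  law : ∀ u, ∀ s t, s ≤ t →
    Q.map (fun ω => N u t ω - N u s ω) = poissonMeasure (ν u * (t - s))
  iIndepFun : ∀ s t, s ≤ t → iIndepFun (fun u ω => N u t ω - N u s ω) Q
  indep_past : ∀ s t, s ≤ t →
    Indep (MeasurableSpace.comap (fun ω u => N u t ω - N u s ω) MeasurableSpace.pi) (ℱ s) Q

/-- The pathwise integral `∑ u, ∫_{(0,t]} f u r dn_u(r)` against counting paths `n u`: the sum over
all `u` and all jump times `r ∈ (0, t]` of the jump of `n u` at `r` times `f u r`. (For the paths of
Poisson processes of finite total rate only finitely many terms are nonzero, almost surely.) -/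
def jumpIntegral {U M : Type*} [AddCommMonoid M] (n : U → ℝ≥0 → ℕ) (f : U → ℝ≥0 → M) (t : ℝ≥0) :
    M :=
  ∑ᶠ p ∈ {p : U × ℝ≥0 | p.2 ∈ Ioc 0 t},
    (n p.1 p.2 - Function.leftLim (n p.1) p.2) • f p.1 p.2

section Equations

variable {s : ℕ} {U D₁ D₂ 𝓗 : Type*} [NormedAddCommGroup 𝓗] [InnerProductSpace ℂ 𝓗]
  [CompleteSpace 𝓗] {Ω : Type*} {mΩ : MeasurableSpace Ω}

/-- `X` solves the equation of the walker,
`dX(t) = ∑ u, (y u (X(t-)) - X(t-)) 1_{F u}(X(t-)) dN_u(t)`, `X(0) ∈ V`. -/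
structure IsClassicalWalk (W : HybridWalk s U D₁ D₂ 𝓗) (ℱ : Filtration ℝ≥0 mΩ) (Q : Measure Ω)
    (N : U → ℝ≥0 → Ω → ℕ) (X : ℝ≥0 → Ω → EuclideanSpace ℝ (Fin s)) : Prop where
  adapted : StronglyAdapted ℱ X
  cadlag : ∀ᵐ ω ∂Q, IsCadlagPath fun t => X t ω
  init : ∀ᵐ ω ∂Q, X 0 ω ∈ W.V
  equation : ∀ᵐ ω ∂Q, ∀ t, X t ω = X 0 ω +
    jumpIntegral (fun u r => N u r ω)
      (fun u r => (W.F u).indicator (fun x => W.y u x - x)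
        (Function.leftLim (fun r' => X r' ω) r)) t

/-- The operators met along the walk have time integrals bounded uniformly in `ω`:
`ess sup_ω ∫_0^t ‖A(X(r-))‖ dr < ∞` for every `t`, where `A` is one of `H`, `R`, `R₀`. -/
structure HasBoundedCoefficients (W : HybridWalk s U D₁ D₂ 𝓗) (Q : Measure Ω)
    (X : ℝ≥0 → Ω → EuclideanSpace ℝ (Fin s)) : Prop where
  H : ∀ t : ℝ≥0, essSup (fun ω => ∫⁻ r in Ioc (0 : ℝ) t,
    ‖W.H (Function.leftLim (fun r' => X r' ω) r.toNNReal)‖ₑ) Q < ⊤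
  R : ∀ t : ℝ≥0, essSup (fun ω => ∫⁻ r in Ioc (0 : ℝ) t,
    ‖W.R (Function.leftLim (fun r' => X r' ω) r.toNNReal)‖ₑ) Q < ⊤
  R₀ : ∀ t : ℝ≥0, essSup (fun ω => ∫⁻ r in Ioc (0 : ℝ) t,
    ‖W.R₀ (Function.leftLim (fun r' => X r' ω) r.toNNReal)‖ₑ) Q < ⊤

/-- `σ` solves the linear jump stochastic master equation with initial condition `ρ₀(X(0))`:
`dσ(t) = ℒ₀(X(t-))[σ(t-)] dt - ½ {R(X(t-)) - ν, σ(t-)} dt`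
`+ ∑ u, (𝒥(X(t-),u)[σ(t-)] - σ(t-)) dN_u(t)`. -/
structure IsLinearSMESolution (W : HybridWalk s U D₁ D₂ 𝓗) (ℱ : Filtration ℝ≥0 mΩ) (Q : Measure Ω)
    (N : U → ℝ≥0 → Ω → ℕ) (X : ℝ≥0 → Ω → EuclideanSpace ℝ (Fin s))
    (ρ₀ : EuclideanSpace ℝ (Fin s) → TraceClass 𝓗) (σ : ℝ≥0 → Ω → TraceClass 𝓗) : Prop where
  adapted : StronglyAdapted ℱ σ
  cadlag : ∀ᵐ ω ∂Q, IsCadlagPath fun t => σ t ω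
  init : ∀ᵐ ω ∂Q, σ 0 ω = ρ₀ (X 0 ω)
  equation : ∀ᵐ ω ∂Q, ∀ t : ℝ≥0,
    let Xm : ℝ≥0 → EuclideanSpace ℝ (Fin s) := Function.leftLim fun r => X r ω
    let σm : ℝ≥0 → TraceClass 𝓗 := Function.leftLim fun r => σ r ω
    σ t ω = σ 0 ω
      + (∫ r in (0 : ℝ)..t, (W.L₀ (Xm r.toNNReal) (σm r.toNNReal)
          - (1 / 2 : ℂ) • anticommutator (W.R (Xm r.toNNReal) - (W.totalRate : ℂ) • 1)
              (σm r.toNNReal)))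
      + jumpIntegral (fun u r => N u r ω)
          (fun u r => W.jumpMap (Xm r) u (σm r) - σm r) t

/-- The reduced operators `η_k(t) = E_Q[σ(t) δ_{X(t),k}]`. -/
def reducedState (Q : Measure Ω) (X : ℝ≥0 → Ω → EuclideanSpace ℝ (Fin s))
    (σ : ℝ≥0 → Ω → TraceClass 𝓗) (k : EuclideanSpace ℝ (Fin s)) (t : ℝ≥0) : TraceClass 𝓗 :=
  ∫ ω, {ω | X t ω = k}.indicator (σ t) ω ∂Q

end Equations

end

universe v

noncomputable section

namespace TraceClass

open ContinuousLinearMap InnerProductSpace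

/-! ## Nuclear expansions of trace-class operators -/

section Nuclear

variable {𝓗 : Type v} [NormedAddCommGroup 𝓗] [InnerProductSpace ℂ 𝓗]

/-! Formally the result is Itô's formula for σ(t)δ_{X(t),k}, followed by an expectation. Here
stochastic calculus is replaced by a pathwise description with finitely many jumps and a short-time
expansion of expectations.

Almost surely there are finitely many counts up to a time T, no two of them simultaneous
(`ae_exists_grid`). Between counts the master equation is a linear ODE with a bounded generator, so
the state follows an exponential flow; at a count a jump map is applied (`isEvolution`). Flows and
jumps preserve positivity (`flow_lindbladGen_isPos`). The essential bound on the time integrals of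
the coefficients becomes a pointwise bound on the vertices reached with positive probability: from
such a vertex the walker rests for unit time with positive probability, so the bound sees the
coefficient there (`enorm_le_essSup_of_reachable`).

For a bounded family Ψ(x) of linear maps, E[Ψ(X)σ] is expanded according to the counts in an
interval of length h: none, one of type u, or more, with probabilities e^{-νh}, ν_u h e^{-νh} and
O(h²). The compensator ν in the drift cancels the first-order loss of e^{-νh}, and the coefficient
of h is the generator applied to Ψ (`norm_integral_sub_le`).

The obstacle is that the state is not bounded: the available bound for a jump of type u is of order
1/ν_u, and the number of jumps is unbounded. The expectations are therefore truncated to fewer than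
m counts, all of types in a finite set F; the state is then bounded and an integral equation holds
(`truncExp_eq_add_integral`). For Ψ the trace, the truncated derivative is nonpositive, because the
generator loses exactly the trace that all jumps restore and truncation discards some of these
jumps. On positive operators the trace is the norm, so E‖σ(t)‖ ≤ 1 (`lintegral_enorm_state_le`).
This moment dominates the passage to the limit in F and m (`testExp_eq_add_integral`). The generator
maps test families to test families, so the integrand is itself continuous and the integral equation
can be differentiated (`hasDerivWithinAt_testExp`).

Taking Ψ to be the trace gives conservation of the total trace; taking the identity at k gives the
derivative of η_k, and splitting by position produces the transfer terms
(`hasSum_transfer_reducedState`). The loss term is R(k) split by target vertex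
(`hasSum_rateOn_target`). That series converges only strongly; convergence in trace norm follows
from expanding trace-class operators into absolutely convergent series of rank-one operators
(`isNuclear`). -/

lemma sum_equivFin_symm {ι M : Type*} [AddCommMonoid M] (s : Finset ι) (f : ι → M) :
    ∑ j : Fin s.card, f (s.equivFin.symm j) = ∑ i ∈ s, f i := by
  rw [← Finset.sum_coe_sort s]
  exact Equiv.sum_comp s.equivFin.symm (fun i : s => f i)

lemma sum_inner_le_traceENorm (T : 𝓗 →L[ℂ] 𝓗) {ι : Type*} (s : Finset ι) (a b : ι → 𝓗)
    (h : ‖∑ i ∈ s, rankOne ℂ (a i) (b i)‖ ≤ 1) :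
    ‖∑ i ∈ s, ⟪b i, T (a i)⟫_ℂ‖ₑ ≤ traceENorm T := by
  have h2 := le_traceENorm T (n := s.card) (fun j => a (s.equivFin.symm j))
    (fun j => b (s.equivFin.symm j)) (by rw [sum_equivFin_symm s (fun i => rankOne ℂ (a i) (b i))]; exact h)
  rwa [sum_equivFin_symm s (fun i => ⟪b i, T (a i)⟫_ℂ)] at h2

lemma traceENorm_rankOne_le (a b : 𝓗) : traceENorm (rankOne ℂ a b) ≤ ‖a‖ₑ * ‖b‖ₑ := by
  refine traceENorm_le fun n c d h => ?_
  have h1 : ∑ i, ⟪d i, rankOne ℂ a b (c i)⟫_ℂ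
      = ⟪b, (∑ i, rankOne ℂ (c i) (d i)) a⟫_ℂ := by
    simp [sum_apply, mul_comm]
  rw [h1]
  have h2 : ‖⟪b, (∑ i, rankOne ℂ (c i) (d i)) a⟫_ℂ‖ ≤ ‖a‖ * ‖b‖ := by
    refine (norm_inner_le_norm _ _).trans ?_
    have := (∑ i, rankOne ℂ (c i) (d i)).le_of_opNorm_le h a
    nlinarith [norm_nonneg b]
  rw [← ofReal_norm, ← ofReal_norm a, ← ofReal_norm b, ← ENNReal.ofReal_mul (norm_nonneg _)]
  exact ENNReal.ofReal_le_ofReal h2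

/-- The rank-one operator `|a⟩⟨b|` as a trace-class operator. -/
def ketbra (a b : 𝓗) : TraceClass 𝓗 :=
  ⟨rankOne ℂ a b, (traceENorm_rankOne_le a b).trans_lt (ENNReal.mul_lt_top (by simp) (by simp))⟩

@[simp] lemma toOp_ketbra (a b : 𝓗) : toOp (ketbra a b) = rankOne ℂ a b := rfl

lemma norm_ketbra_le (a b : 𝓗) : ‖ketbra a b‖ ≤ ‖a‖ * ‖b‖ := by
  rw [norm_def]
  refine ENNReal.toReal_le_of_le_ofReal (by positivity) ?_
  rw [ENNReal.ofReal_mul (norm_nonneg _), ofReal_norm, ofReal_norm]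
  exact traceENorm_rankOne_le a b

/-- The operator underlying a trace-class operator, as a continuous linear map. -/
def toOpL : TraceClass 𝓗 →L[ℂ] (𝓗 →L[ℂ] 𝓗) :=
  toOp.mkContinuous 1 fun T => by simpa using norm_toOp_le T

@[simp] lemma toOpL_apply (T : TraceClass 𝓗) : toOpL T = toOp T := rfl

/-- `ρ` is the sum of a series of rank-one operators `|a i⟩⟨b i|` with `∑ ‖a i‖ ‖b i‖ ≤ c`. -/
def IsNuclear (ρ : TraceClass 𝓗) (c : ℝ) : Prop :=
  ∃ (ι : Type v) (a b : ι → 𝓗), Summable (fun i => ‖a i‖ * ‖b i‖) ∧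
    ∑' i, ‖a i‖ * ‖b i‖ ≤ c ∧ HasSum (fun i => ketbra (a i) (b i)) ρ

lemma IsNuclear.norm_le {ρ : TraceClass 𝓗} {c : ℝ} (h : IsNuclear ρ c) : ‖ρ‖ ≤ c := by
  obtain ⟨ι, a, b, h1, h2, h3⟩ := h
  rw [← h3.tsum_eq]
  have h4 : Summable fun i => ‖ketbra (a i) (b i)‖ :=
    h1.of_nonneg_of_le (fun _ => norm_nonneg _) fun i => norm_ketbra_le _ _
  exact (norm_tsum_le_tsum_norm h4).trans ((h4.tsum_le_tsum (fun i => norm_ketbra_le _ _) h1).trans h2)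

lemma IsNuclear.add {ρ τ : TraceClass 𝓗} {c d : ℝ} (h : IsNuclear ρ c) (h' : IsNuclear τ d) :
    IsNuclear (ρ + τ) (c + d) := by
  obtain ⟨ι, a, b, h1, h2, h3⟩ := h
  obtain ⟨κ, a', b', h1', h2', h3'⟩ := h'
  have e1 : HasSum (fun i : ι ⊕ κ => ‖Sum.elim a a' i‖ * ‖Sum.elim b b' i‖)
      (∑' i, ‖a i‖ * ‖b i‖ + ∑' i, ‖a' i‖ * ‖b' i‖) :=
    HasSum.sum h1.hasSum h1'.hasSum
  refine ⟨ι ⊕ κ, Sum.elim a a', Sum.elim b b', e1.summable, ?_, HasSum.sum h3 h3'⟩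
  rw [e1.tsum_eq]
  exact add_le_add h2 h2'

lemma ketbra_smul_left (c : ℂ) (a b : 𝓗) : ketbra (c • a) b = c • ketbra a b :=
  toOp_injective (by simp)

lemma IsNuclear.smul {ρ : TraceClass 𝓗} {c : ℝ} (h : IsNuclear ρ c) (z : ℂ) :
    IsNuclear (z • ρ) (‖z‖ * c) := by
  obtain ⟨ι, a, b, h1, h2, h3⟩ := h
  refine ⟨ι, fun i => z • a i, b, ?_, ?_, ?_⟩
  · simpa [norm_smul, mul_assoc] using h1.mul_left ‖z‖
  · simp only [norm_smul, mul_assoc, tsum_mul_left]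
    gcongr
  · simpa [ketbra_smul_left] using h3.const_smul z

lemma IsNuclear.mono {ρ : TraceClass 𝓗} {c d : ℝ} (h : IsNuclear ρ c) (hcd : c ≤ d) :
    IsNuclear ρ d := by
  obtain ⟨ι, a, b, h1, h2, h3⟩ := h
  exact ⟨ι, a, b, h1, h2.trans hcd, h3⟩

/-- Pythagoras followed by Bessel's inequality. These diagonal contractions are test operators for
the dual definition of the trace norm. -/
lemma norm_sum_rankOne_le {ι : Type*} {e : ι → 𝓗} (he : Orthonormal ℂ e) (s : Finset ι)
    (c : ι → ℂ) (hc : ∀ i, ‖c i‖ ≤ 1) : ‖∑ i ∈ s, rankOne ℂ (c i • e i) (e i)‖ ≤ 1 := by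
  refine opNorm_le_bound _ zero_le_one fun x => ?_
  rw [one_mul]
  refine le_of_sq_le_sq ?_ (norm_nonneg x)
  have h1 : (∑ i ∈ s, rankOne ℂ (c i • e i) (e i)) x = ∑ i ∈ s, (⟪e i, x⟫_ℂ * c i) • e i := by
    simp [sum_apply, smul_smul, mul_comm]
  have h2 : ‖∑ i ∈ s, (⟪e i, x⟫_ℂ * c i) • e i‖ ^ 2 = ∑ i ∈ s, ‖⟪e i, x⟫_ℂ * c i‖ ^ 2 := by
    have := he.inner_sum (fun i => ⟪e i, x⟫_ℂ * c i) (fun i => ⟪e i, x⟫_ℂ * c i) s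
    rw [inner_self_eq_norm_sq_to_K] at this
    have h3 : ((‖∑ i ∈ s, (⟪e i, x⟫_ℂ * c i) • e i‖ ^ 2 : ℝ) : ℂ)
        = ((∑ i ∈ s, ‖⟪e i, x⟫_ℂ * c i‖ ^ 2 : ℝ) : ℂ) := by
      push_cast
      exact this.trans (Finset.sum_congr rfl fun i _ => Complex.conj_mul' _)
    exact_mod_cast h3
  rw [h1, h2]
  calc ∑ i ∈ s, ‖⟪e i, x⟫_ℂ * c i‖ ^ 2 ≤ ∑ i ∈ s, ‖⟪e i, x⟫_ℂ‖ ^ 2 := by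
        refine Finset.sum_le_sum fun i _ => ?_
        rw [norm_mul]
        gcongr
        exact mul_le_of_le_one_right (norm_nonneg _) (hc i)
    _ ≤ ‖x‖ ^ 2 := he.sum_inner_products_le x

variable [CompleteSpace 𝓗]

lemma norm_cfc_div_abs_add_le (T : 𝓗 →L[ℂ] 𝓗) {ε : ℝ} (hε : 0 < ε) :
    ‖cfc (fun t : ℝ => t / (|t| + ε)) T‖ ≤ 1 := by
  refine norm_cfc_le zero_le_one fun t _ => ?_
  have : 0 < |t| + ε := by positivity
  rw [Real.norm_eq_abs, abs_div, abs_of_pos this, div_le_one this]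
  linarith

/-- The function t/(|t| + ε) is a continuous substitute for the sign of t, and (|t| - ε)(|t| + ε) ≤
t². -/
lemma abs_sub_le_cfc_mul {T : 𝓗 →L[ℂ] 𝓗} (hT : IsSelfAdjoint T) {ε : ℝ} (hε : 0 < ε) :
    CFC.abs T - algebraMap ℝ (𝓗 →L[ℂ] 𝓗) ε ≤ cfc (fun t : ℝ => t / (|t| + ε)) T * T := by
  have hc : Continuous fun t : ℝ => t / (|t| + ε) :=
    continuous_id.div (by fun_prop) fun t => by positivity
  have h1 : cfc (fun t : ℝ => t / (|t| + ε)) T * T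
      = cfc (fun t : ℝ => t / (|t| + ε) * t) T := by
    rw [cfc_mul (fun t : ℝ => t / (|t| + ε)) (fun t => t) T hc.continuousOn continuousOn_id,
      cfc_id' ℝ T]
  have h2 : CFC.abs T - algebraMap ℝ (𝓗 →L[ℂ] 𝓗) ε = cfc (fun t : ℝ => |t| - ε) T := by
    rw [cfc_sub (fun t : ℝ => |t|) (fun _ => ε) T continuous_abs.continuousOn continuousOn_const,
      cfc_const ε T, CFC.abs_eq_cfc_norm T]
    rfl
  rw [h1, h2]
  refine cfc_mono (fun t _ => ?_) (by fun_prop) (hc.mul continuous_id).continuousOn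
  have : 0 < |t| + ε := by positivity
  rw [div_mul_eq_mul_div, le_div_iff₀ this, ← sq, ← sq_abs]
  nlinarith [abs_nonneg t]

/-- The Hilbert basis used to compute traces. -/
def traceBasis (𝓗 : Type v) [NormedAddCommGroup 𝓗] [InnerProductSpace ℂ 𝓗] [CompleteSpace 𝓗] :
    HilbertBasis (exists_hilbertBasis ℂ 𝓗).choose ℂ 𝓗 :=
  (exists_hilbertBasis ℂ 𝓗).choose_spec.choose

/-- With S the square root of A, one has A = ∑ |S e_i⟩⟨S e_i| and ‖S e_i‖² = ⟨e_i, A e_i⟩, so the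
nuclear cost of a positive operator is its trace. -/
lemma exists_isNuclear_of_sum_le {A : 𝓗 →L[ℂ] 𝓗} (hA : A.IsPositive) {c : ℝ}
    (h : ∀ s, ∑ i ∈ s, (⟪traceBasis 𝓗 i, A (traceBasis 𝓗 i)⟫_ℂ).re ≤ c) :
    ∃ ρ : TraceClass 𝓗, toOp ρ = A ∧ IsNuclear ρ c := by
  have hA0 : 0 ≤ A := (nonneg_iff_isPositive A).2 hA
  set S : 𝓗 →L[ℂ] 𝓗 := CFC.sqrt A with hS
  have hSS : S * S = A := CFC.sqrt_mul_sqrt_self A hA0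
  have hSa : IsSelfAdjoint S := (CFC.sqrt_nonneg A).isSelfAdjoint
  have hSi : ∀ x y, ⟪S x, y⟫_ℂ = ⟪x, S y⟫_ℂ := fun x y => by
    conv_lhs => rw [← hSa.adjoint_eq, adjoint_inner_left]
  have hn : ∀ x, ‖S x‖ * ‖S x‖ = (⟪x, A x⟫_ℂ).re := fun x => by
    rw [← hSS, show (S * S) x = S (S x) from rfl, ← hSi, ← inner_self_eq_norm_mul_norm (𝕜 := ℂ)]
    rfl
  set e := traceBasis 𝓗
  have hsum : Summable fun i => ‖S (e i)‖ * ‖S (e i)‖ :=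
    summable_of_sum_le (fun i => by positivity) fun s => by simpa only [hn] using h s
  have hk : Summable fun i => ketbra (S (e i)) (S (e i)) :=
    Summable.of_norm_bounded hsum fun i => norm_ketbra_le _ _
  refine ⟨∑' i, ketbra (S (e i)) (S (e i)), ?_, ?_⟩
  · ext x
    have h1 : HasSum (fun i => toOp (ketbra (S (e i)) (S (e i))) x)
        (toOp (∑' i, ketbra (S (e i)) (S (e i))) x) :=
      (hk.hasSum.mapL toOpL).mapL (ContinuousLinearMap.apply ℂ 𝓗 x)
    have h2 : HasSum (fun i => ⟪e i, S x⟫_ℂ • S (e i)) (S (S x)) := by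
      simpa [HilbertBasis.repr_apply_apply] using (e.hasSum_repr (S x)).mapL S
    rw [← hSS]
    refine h1.unique ?_
    simpa [hSi] using h2
  · exact ⟨_, _, _, hsum, hsum.tsum_le_of_sum_le fun s => by simpa only [hn] using h s, hk.hasSum⟩

/-- Pairing T with ∑ |e_i⟩⟨W e_i|, where W is nearly the sign of T, bounds the partial traces of |T|
by c. Both T⁺ and T⁻ lie below |T| and cost at most c each, hence the factor 2. -/
lemma exists_isNuclear_of_isSelfAdjoint {T : 𝓗 →L[ℂ] 𝓗} (hT : IsSelfAdjoint T) {c : ℝ}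
    (h : traceENorm T ≤ ENNReal.ofReal c) (hc0 : 0 ≤ c) :
    ∃ ρ : TraceClass 𝓗, toOp ρ = T ∧ IsNuclear ρ (2 * c) := by
  set e := traceBasis 𝓗
  have habs : ∀ s, ∑ i ∈ s, (⟪e i, CFC.abs T (e i)⟫_ℂ).re ≤ c := by
    intro s
    refine le_of_forall_pos_le_add fun δ hδ => ?_
    -- The `s.card` errors of size ε add up to at most δ; the added 1 covers the empty set.
    set ε : ℝ := δ / (s.card + 1)
    have hε : 0 < ε := by positivity
    set W := cfc (fun t : ℝ => t / (|t| + ε)) T with hW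
    have hWa : IsSelfAdjoint W := cfc_predicate _ _
    have h1 : ∀ i, (⟪e i, CFC.abs T (e i)⟫_ℂ).re ≤ (⟪W (e i), T (e i)⟫_ℂ).re + ε := by
      intro i
      have h2 := ((nonneg_iff_isPositive _).1
        (sub_nonneg.2 (abs_sub_le_cfc_mul hT hε))).re_inner_nonneg_right (e i)
      have h3 : ⟪e i, (e i)⟫_ℂ = 1 := by simp [e.orthonormal.1 i]
      rw [← hW] at h2
      simp only [sub_apply, inner_sub_right, Algebra.algebraMap_eq_smul_one, smul_apply,
        one_apply_eq_self, map_sub] at h2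
      rw [← hWa.adjoint_eq, adjoint_inner_left]
      have h4 : RCLike.re ⟪e i, ε • e i⟫_ℂ = ε := by
        rw [← Complex.coe_smul, inner_smul_right, h3]; simp
      rw [h4] at h2
      have h5 : (⟪e i, (W * T) (e i)⟫_ℂ).re = (⟪e i, W (T (e i))⟫_ℂ).re := rfl
      simp only [RCLike.re_eq_complex_re] at h2
      linarith
    have h5 : ‖∑ i ∈ s, rankOne ℂ (e i) (W (e i))‖ ≤ 1 := by
      have h6 : ∑ i ∈ s, rankOne ℂ (e i) (W (e i))
          = (∑ i ∈ s, rankOne ℂ ((1 : ℂ) • e i) (e i)) * W := by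
        ext x
        conv_rhs => rw [← hWa.adjoint_eq]
        simp [sum_apply, adjoint_inner_right]
      rw [h6]
      refine (norm_mul_le _ _).trans (mul_le_one₀ ?_ (norm_nonneg _)
        (norm_cfc_div_abs_add_le T hε))
      exact norm_sum_rankOne_le e.orthonormal s (fun _ => 1) (by simp)
    have h7 := (sum_inner_le_traceENorm T s _ _ h5).trans h
    rw [← ofReal_norm, ENNReal.ofReal_le_ofReal_iff hc0] at h7
    calc ∑ i ∈ s, (⟪e i, CFC.abs T (e i)⟫_ℂ).re
        ≤ ∑ i ∈ s, ((⟪W (e i), T (e i)⟫_ℂ).re + ε) := Finset.sum_le_sum fun i _ => h1 i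
      _ = (∑ i ∈ s, ⟪W (e i), T (e i)⟫_ℂ).re + s.card * ε := by
        rw [Finset.sum_add_distrib, Complex.re_sum]; simp
      _ ≤ c + δ := by
        refine add_le_add ((Complex.re_le_norm _).trans h7) ?_
        simp only [ε]
        rw [mul_div_assoc', div_le_iff₀ (by positivity)]
        nlinarith
  have hpos : ∀ A : 𝓗 →L[ℂ] 𝓗, 0 ≤ A → A ≤ CFC.abs T →
      ∃ ρ : TraceClass 𝓗, toOp ρ = A ∧ IsNuclear ρ c := fun A hA hA' => by
    refine exists_isNuclear_of_sum_le ((nonneg_iff_isPositive A).1 hA) fun s =>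
      le_trans (Finset.sum_le_sum fun i _ => ?_) (habs s)
    have := ((nonneg_iff_isPositive _).1 (sub_nonneg.2 hA')).re_inner_nonneg_right (e i)
    simp only [sub_apply, inner_sub_right, map_sub] at this
    exact sub_nonneg.1 this
  have hpn := CFC.posPart_add_negPart T hT
  obtain ⟨ρ, hρ, hρc⟩ := hpos T⁺ (CFC.posPart_nonneg T)
    (by rw [← hpn]; exact le_add_of_nonneg_right (CFC.negPart_nonneg T))
  obtain ⟨τ, hτ, hτc⟩ := hpos T⁻ (CFC.negPart_nonneg T)
    (by rw [← hpn]; exact le_add_of_nonneg_left (CFC.posPart_nonneg T))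
  refine ⟨ρ + (-1 : ℂ) • τ, ?_, (hρc.add (hτc.smul (-1))).mono (by simp; linarith)⟩
  rw [map_add, map_smul, hρ, hτ]
  simpa [sub_eq_add_neg] using CFC.posPart_sub_negPart T hT

lemma traceENorm_adjoint_le (T : 𝓗 →L[ℂ] 𝓗) : traceENorm (adjoint T) ≤ traceENorm T := by
  refine traceENorm_le fun n a b h => ?_
  have h1 : ‖∑ i, rankOne ℂ (b i) (a i)‖ ≤ 1 := by
    rw [← LinearIsometryEquiv.norm_map adjoint, map_sum]
    simpa using h
  have h2 := le_traceENorm T b a h1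
  have h3 : ∑ i, ⟪b i, adjoint T (a i)⟫_ℂ = starRingEnd ℂ (∑ i, ⟪a i, T (b i)⟫_ℂ) := by
    simp [adjoint_inner_right]
  rw [h3, ← ofReal_norm, RCLike.norm_conj, ofReal_norm]
  exact h2

/-- Real and imaginary parts have trace norm at most ‖ρ‖ and cost a factor 2 each, which gives the
4. The trace norm is defined by duality, and this expansion is what allows series and limits in that
norm to be treated term by term. -/
theorem isNuclear (ρ : TraceClass 𝓗) : IsNuclear ρ (4 * ‖ρ‖) := by
  have hρ : traceENorm (toOp ρ) = ENNReal.ofReal ‖ρ‖ := by rw [← enorm_eq, ofReal_norm]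
  have hstar : traceENorm (star (toOp ρ)) ≤ ENNReal.ofReal ‖ρ‖ :=
    (traceENorm_adjoint_le _).trans hρ.le
  have half : ∀ z : ℂ, ‖z‖ = 1 / 2 → ∀ S : 𝓗 →L[ℂ] 𝓗, traceENorm S ≤ ENNReal.ofReal (‖ρ‖ + ‖ρ‖) →
      traceENorm (z • S) ≤ ENNReal.ofReal ‖ρ‖ := fun z hz S hS => by
    refine (traceENorm_smul_le _ _).trans ((mul_le_mul_right hS _).trans ?_)
    rw [← ofReal_norm, hz, ← ENNReal.ofReal_mul (by norm_num)]
    exact ENNReal.ofReal_le_ofReal (by linarith)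
  obtain ⟨r, hr, hrn⟩ := exists_isNuclear_of_isSelfAdjoint
    (T := (1 / 2 : ℂ) • (toOp ρ + star (toOp ρ))) (c := ‖ρ‖)
    (by simp [IsSelfAdjoint, add_comm])
    (half _ (by simp) _ <| (traceENorm_add_le _ _).trans <| by
      rw [ENNReal.ofReal_add (norm_nonneg _) (norm_nonneg _)]
      exact add_le_add hρ.le hstar) (norm_nonneg _)
  -- The imaginary part, normalised so that ρ = r + i q.
  obtain ⟨q, hq, hqn⟩ := exists_isNuclear_of_isSelfAdjoint
    (T := (Complex.I / 2 : ℂ) • (star (toOp ρ) + (-1 : ℂ) • toOp ρ)) (c := ‖ρ‖)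
    (by
      simp only [IsSelfAdjoint, star_smul, star_add, star_star]
      simp
      module)
    (half _ (by simp) _ <| (traceENorm_add_le _ _).trans <| by
      rw [ENNReal.ofReal_add (norm_nonneg _) (norm_nonneg _)]
      refine add_le_add hstar ((traceENorm_smul_le _ _).trans ?_)
      simp [hρ]) (norm_nonneg _)
  have h := (hrn.add (hqn.smul Complex.I)).mono (d := 4 * ‖ρ‖) (by simp; linarith)
  convert h using 1
  apply toOp_injective
  rw [map_add, map_smul, hr, hq, smul_smul, mul_div_assoc', Complex.I_mul_I]
  module

end Nuclear

end TraceClass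
end

noncomputable section

namespace TraceClass

open ContinuousLinearMap InnerProductSpace

section Maps

variable {𝓗 : Type v} [NormedAddCommGroup 𝓗] [InnerProductSpace ℂ 𝓗] [CompleteSpace 𝓗]

/-! ## Trace, cyclicity and Kraus maps -/

/-- The diagonal contraction with entries conj(z_i)/|z_i| removes the phases of the diagonal
elements z_i; division by zero gives entry 0 where z_i = 0. -/
lemma sum_norm_inner_traceBasis_le (ρ : TraceClass 𝓗) (s) :
    ∑ i ∈ s, ‖⟪traceBasis 𝓗 i, toOp ρ (traceBasis 𝓗 i)⟫_ℂ‖ ≤ ‖ρ‖ := by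
  set e := traceBasis 𝓗
  set z : _ → ℂ := fun i => ⟪e i, toOp ρ (e i)⟫_ℂ
  have h1 := sum_inner_le_traceENorm (toOp ρ) s (fun i => (starRingEnd ℂ (z i) / ‖z i‖) • e i) e
    (norm_sum_rankOne_le e.orthonormal s _ fun i => by
      rw [norm_div, RCLike.norm_conj, Complex.norm_real, norm_norm]
      exact div_self_le_one _)
  have h2 : ∑ i ∈ s, ⟪e i, toOp ρ ((starRingEnd ℂ (z i) / ‖z i‖) • e i)⟫_ℂ
      = ((∑ i ∈ s, ‖z i‖ : ℝ) : ℂ) := by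
    push_cast
    refine Finset.sum_congr rfl fun i _ => ?_
    rw [map_smul, inner_smul_right, div_mul_eq_mul_div, Complex.conj_mul']
    by_cases hz : z i = 0
    · simp [hz]
    · have : (‖z i‖ : ℂ) ≠ 0 := by simpa using hz
      field_simp
  rw [h2, ← enorm_eq, ← ofReal_norm, ← ofReal_norm, Complex.norm_real,
    ENNReal.ofReal_le_ofReal_iff (norm_nonneg _)] at h1
  exact (le_abs_self _).trans h1

lemma summable_norm_inner_traceBasis (ρ : TraceClass 𝓗) :
    Summable fun i => ‖⟪traceBasis 𝓗 i, toOp ρ (traceBasis 𝓗 i)⟫_ℂ‖ :=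
  summable_of_sum_le (fun _ => norm_nonneg _) (sum_norm_inner_traceBasis_le ρ)

lemma hasSum_trace (ρ : TraceClass 𝓗) :
    HasSum (fun i => ⟪traceBasis 𝓗 i, toOp ρ (traceBasis 𝓗 i)⟫_ℂ) (trace ρ) :=
  (summable_norm_inner_traceBasis ρ).of_norm.hasSum

lemma norm_trace_le (ρ : TraceClass 𝓗) : ‖trace ρ‖ ≤ ‖ρ‖ :=
  (norm_tsum_le_tsum_norm (summable_norm_inner_traceBasis ρ)).trans
    ((summable_norm_inner_traceBasis ρ).tsum_le_of_sum_le (sum_norm_inner_traceBasis_le ρ))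

/-- The trace as a continuous linear functional on trace-class operators. -/
def traceL : TraceClass 𝓗 →L[ℂ] ℂ :=
  LinearMap.mkContinuous
    { toFun := trace
      map_add' := fun ρ τ => HasSum.unique (hasSum_trace _) <| by
        simpa [inner_add_right] using (hasSum_trace ρ).add (hasSum_trace τ)
      map_smul' := fun c ρ => HasSum.unique (hasSum_trace _) <| by
        simpa [inner_smul_right] using (hasSum_trace ρ).mul_left c } 1
    fun ρ => by simpa using norm_trace_le ρ

@[simp] lemma traceL_apply (ρ : TraceClass 𝓗) : traceL ρ = trace ρ := rfl

lemma norm_traceL_le : ‖(traceL : TraceClass 𝓗 →L[ℂ] ℂ)‖ ≤ 1 :=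
  LinearMap.mkContinuous_norm_le _ zero_le_one _

lemma trace_ketbra (a b : 𝓗) : trace (ketbra a b) = ⟪b, a⟫_ℂ := by
  refine (hasSum_trace (ketbra a b)).unique ?_
  simpa [inner_smul_right] using (traceBasis 𝓗).hasSum_inner_mul_inner b a

/-- Nuclear expansions make the span of rank-one operators dense in trace norm. Identities between
traces thereby reduce to identities between inner products. -/
lemma clm_ext_ketbra {E : Type*} [NormedAddCommGroup E] [NormedSpace ℂ E]
    {f g : TraceClass 𝓗 →L[ℂ] E} (h : ∀ a b, f (ketbra a b) = g (ketbra a b)) : f = g := by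
  ext ρ
  obtain ⟨ι, a, b, -, -, h3⟩ := isNuclear ρ
  exact (h3.mapL f).unique (by simpa [h] using h3.mapL g)

/-- Positivity of trace-class operators. -/
def IsPos (ρ : TraceClass 𝓗) : Prop := (toOp ρ).IsPositive

/-- For positive operators the nuclear cost is the trace, which bounds the norm from above; the
other inequality is |Tr ρ| ≤ ‖ρ‖. -/
lemma IsPos.trace_eq_norm {ρ : TraceClass 𝓗} (h : IsPos ρ) : trace ρ = (‖ρ‖ : ℂ) := by
  have hre : ∀ i, (⟪traceBasis 𝓗 i, toOp ρ (traceBasis 𝓗 i)⟫_ℂ : ℂ)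
      = ((⟪traceBasis 𝓗 i, toOp ρ (traceBasis 𝓗 i)⟫_ℂ).re : ℂ) := fun i => by
    have := h.inner_nonneg_right (traceBasis 𝓗 i)
    rw [Complex.le_def] at this
    exact Complex.ext rfl (by simpa using this.2.symm)
  have h1 := hasSum_trace ρ
  have h2 := Complex.hasSum_re h1
  have h3 : trace ρ = ((trace ρ).re : ℂ) :=
    h1.unique <| by
      rw [funext hre]
      exact Complex.hasSum_ofReal.2 h2
  obtain ⟨τ, hτ, hn⟩ := exists_isNuclear_of_sum_le h (c := (trace ρ).re) fun s =>
    sum_le_hasSum s (fun i _ => h.re_inner_nonneg_right _) h2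
  obtain rfl := toOp_injective hτ
  have h4 : (trace τ).re = ‖τ‖ :=
    le_antisymm ((Complex.re_le_norm _).trans (norm_trace_le τ)) hn.norm_le
  rw [h3, h4]

lemma isPos_zero : IsPos (0 : TraceClass 𝓗) := by simp [IsPos]

lemma IsPos.add {ρ τ : TraceClass 𝓗} (h : IsPos ρ) (h' : IsPos τ) : IsPos (ρ + τ) := by
  rw [IsPos, map_add]; exact ContinuousLinearMap.IsPositive.add h h'

lemma IsPos.smul {ρ : TraceClass 𝓗} (h : IsPos ρ) {c : ℝ} (hc : 0 ≤ c) :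
    IsPos ((c : ℂ) • ρ) := by
  rw [IsPos, map_smul]
  open ComplexOrder in
  exact ContinuousLinearMap.IsPositive.smul_of_nonneg h (Complex.zero_le_real.2 hc)

lemma isClosed_isPos : IsClosed {ρ : TraceClass 𝓗 | IsPos ρ} := by
  have : {ρ : TraceClass 𝓗 | IsPos ρ} = toOpL ⁻¹' {A : 𝓗 →L[ℂ] 𝓗 | 0 ≤ A} := by
    ext ρ; simp [IsPos, nonneg_iff_isPositive]
  rw [this]
  exact CStarAlgebra.isClosed_nonneg.preimage toOpL.continuous

lemma isPos_of_hasSum {ι : Type*} {f : ι → TraceClass 𝓗} {ρ : TraceClass 𝓗} (h : HasSum f ρ)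
    (hf : ∀ i, IsPos (f i)) : IsPos ρ :=
  isClosed_isPos.mem_of_tendsto h <| Eventually.of_forall fun s => by
    classical
    induction s using Finset.induction_on with
    | empty => simpa using isPos_zero
    | insert a s ha ih =>
      simp only [Set.mem_ofPred_eq, Finset.sum_insert ha] at ih ⊢
      exact (hf a).add ih

/-- `ρ ↦ A ρ B` as a continuous linear map. -/
def sandwichL (A B : 𝓗 →L[ℂ] 𝓗) : TraceClass 𝓗 →L[ℂ] TraceClass 𝓗 :=
  LinearMap.mkContinuous
    { toFun := fun ρ => sandwich A ρ B
      map_add' := fun ρ τ => toOp_injective <| by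
        change A * (toOp ρ + toOp τ) * B = A * toOp ρ * B + A * toOp τ * B
        rw [mul_add, add_mul]
      map_smul' := fun c ρ => toOp_injective <| by
        change A * (c • toOp ρ) * B = c • (A * toOp ρ * B)
        rw [mul_smul_comm, smul_mul_assoc] } (‖A‖ * ‖B‖)
    fun ρ => by
      have h := traceENorm_mul_mul_le A (toOp ρ) B
      change ‖sandwich A ρ B‖ ≤ _
      rw [norm_def, norm_def]
      refine ENNReal.toReal_le_of_le_ofReal (by positivity) (h.trans (le_of_eq ?_))
      rw [ENNReal.ofReal_mul (by positivity), ENNReal.ofReal_mul (by positivity), ofReal_norm,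
        ofReal_norm, ENNReal.ofReal_toReal (traceENorm_lt_top ρ).ne, mul_comm ‖A‖ₑ]

@[simp] lemma sandwichL_apply (A B : 𝓗 →L[ℂ] 𝓗) (ρ : TraceClass 𝓗) :
    sandwichL A B ρ = sandwich A ρ B := rfl

lemma norm_sandwichL_le (A B : 𝓗 →L[ℂ] 𝓗) : ‖sandwichL A B‖ ≤ ‖A‖ * ‖B‖ :=
  LinearMap.mkContinuous_norm_le _ (by positivity) _

@[simp] lemma toOp_sandwich (A B : 𝓗 →L[ℂ] 𝓗) (ρ : TraceClass 𝓗) :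
    toOp (sandwich A ρ B) = A * toOp ρ * B := rfl

lemma sandwich_ketbra (A B : 𝓗 →L[ℂ] 𝓗) (a b : 𝓗) :
    sandwich A (ketbra a b) B = ketbra (A a) (adjoint B b) := by
  apply toOp_injective
  ext x
  simp [adjoint_inner_left]

lemma sandwich_one_one (ρ : TraceClass 𝓗) : sandwich 1 ρ 1 = ρ := toOp_injective (by simp)

lemma IsPos.sandwich {ρ : TraceClass 𝓗} (h : IsPos ρ) (A : 𝓗 →L[ℂ] 𝓗) :
    IsPos (sandwich A ρ (adjoint A)) :=
  ContinuousLinearMap.IsPositive.conj_adjoint h A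

lemma trace_sandwich_comm (A : 𝓗 →L[ℂ] 𝓗) (ρ : TraceClass 𝓗) :
    trace (sandwich 1 ρ A) = trace (sandwich A ρ 1) := by
  have : traceL.comp (sandwichL 1 A) = traceL.comp (sandwichL A 1) :=
    clm_ext_ketbra fun a b => by
      simp [sandwich_ketbra, trace_ketbra, adjoint_inner_left]
  exact DFunLike.congr_fun this ρ

lemma eq_of_trace_sandwich_eq {A B : 𝓗 →L[ℂ] 𝓗}
    (h : ∀ ρ : TraceClass 𝓗, trace (sandwich A ρ 1) = trace (sandwich B ρ 1)) : A = B := by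
  ext a
  refine ext_inner_left ℂ fun b => ?_
  simpa [sandwich_ketbra, trace_ketbra, adjoint_one] using h (ketbra a b)

/-- `dualMap` is a choice, but an operator is determined by its pairings with rank-one operators, so
any candidate that satisfies the duality relation is the chosen one. -/
lemma dualMap_one_eq {Φ : TraceClass 𝓗 → TraceClass 𝓗} {B : 𝓗 →L[ℂ] 𝓗}
    (h : ∀ ρ, trace (sandwich B ρ 1) = trace (Φ ρ)) : dualMap Φ 1 = B := by
  have hex : ∃ B : 𝓗 →L[ℂ] 𝓗, ∀ ρ, trace (sandwich B ρ 1) = trace (sandwich 1 (Φ ρ) 1) :=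
    ⟨B, fun ρ => by rw [h, sandwich_one_one]⟩
  rw [dualMap, dif_pos hex]
  exact eq_of_trace_sandwich_eq fun ρ => by rw [hex.choose_spec, h, sandwich_one_one]

/-- The Kraus operators `K k` satisfy `∑ k, ‖K k a‖² ≤ C ‖a‖²`. -/
def KrausBound {κ : Type*} (K : κ → 𝓗 →L[ℂ] 𝓗) (C : ℝ≥0) : Prop :=
  ∀ (a : 𝓗) (s : Finset κ), ∑ k ∈ s, ‖K k a‖ ^ 2 ≤ C * ‖a‖ ^ 2

variable {κ : Type*} {K : κ → 𝓗 →L[ℂ] 𝓗} {C : ℝ≥0}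

lemma KrausBound.sum_mul_le (h : KrausBound K C) (a b : 𝓗) (s : Finset κ) :
    ∑ k ∈ s, ‖K k a‖ * ‖K k b‖ ≤ C * (‖a‖ * ‖b‖) := by
  refine le_of_sq_le_sq ?_ (by positivity)
  calc (∑ k ∈ s, ‖K k a‖ * ‖K k b‖) ^ 2
      ≤ (∑ k ∈ s, ‖K k a‖ ^ 2) * ∑ k ∈ s, ‖K k b‖ ^ 2 := Finset.sum_mul_sq_le_sq_mul_sq _ _ _
    _ ≤ (C * ‖a‖ ^ 2) * (C * ‖b‖ ^ 2) := by
      gcongr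
      exacts [h a s, h b s]
    _ = _ := by ring

/-- A rank-one |a⟩⟨b| is sent to |K a⟩⟨K b|, and Cauchy–Schwarz over k bounds the sum of the costs
by C‖a‖‖b‖. The 4 is the nuclear constant. -/
lemma KrausBound.sum_norm_le (h : KrausBound K C) (ρ : TraceClass 𝓗) (s : Finset κ) :
    ∑ k ∈ s, ‖sandwich (K k) ρ (adjoint (K k))‖ ≤ 4 * C * ‖ρ‖ := by
  obtain ⟨ι, a, b, h1, h2, h3⟩ := isNuclear ρ
  have hb : ∀ k i, ‖K k (a i)‖ * ‖K k (b i)‖ ≤ ‖K k‖ ^ 2 * (‖a i‖ * ‖b i‖) := fun k i => by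
    calc ‖K k (a i)‖ * ‖K k (b i)‖ ≤ (‖K k‖ * ‖a i‖) * (‖K k‖ * ‖b i‖) := by
          gcongr <;> exact le_opNorm _ _
      _ = _ := by ring
  have hs : ∀ k, Summable fun i => ‖K k (a i)‖ * ‖K k (b i)‖ := fun k =>
    (h1.mul_left (‖K k‖ ^ 2)).of_nonneg_of_le (fun _ => by positivity) (hb k)
  have h4 : ∀ k, ‖sandwich (K k) ρ (adjoint (K k))‖ ≤ ∑' i, ‖K k (a i)‖ * ‖K k (b i)‖ := by
    intro k
    have h5 := h3.mapL (sandwichL (K k) (adjoint (K k)))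
    simp only [sandwichL_apply, sandwich_ketbra, adjoint_adjoint] at h5
    rw [← h5.tsum_eq]
    have h6 : Summable fun i => ‖ketbra (K k (a i)) (K k (b i))‖ :=
      (hs k).of_nonneg_of_le (fun _ => norm_nonneg _) fun i => norm_ketbra_le _ _
    exact (norm_tsum_le_tsum_norm h6).trans (h6.tsum_le_tsum (fun i => norm_ketbra_le _ _) (hs k))
  calc _ ≤ ∑ k ∈ s, ∑' i, ‖K k (a i)‖ * ‖K k (b i)‖ := Finset.sum_le_sum fun k _ => h4 k
    _ = ∑' i, ∑ k ∈ s, ‖K k (a i)‖ * ‖K k (b i)‖ :=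
      (Summable.tsum_finsetSum fun k _ => hs k).symm
    _ ≤ ∑' i, C * (‖a i‖ * ‖b i‖) :=
      (summable_sum fun k _ => hs k).tsum_le_tsum (fun i => h.sum_mul_le _ _ s) (h1.mul_left _)
    _ ≤ C * (4 * ‖ρ‖) := by rw [tsum_mul_left]; gcongr
    _ = _ := by ring

/-- The maps `Φ k` satisfy `∑ k, ‖Φ k ρ‖ ≤ c ‖ρ‖`. -/
def SumBound {E F : Type*} [NormedAddCommGroup E] [NormedSpace ℂ E] [NormedAddCommGroup F]
    [NormedSpace ℂ F] (Φ : κ → E →L[ℂ] F) (c : ℝ≥0) : Prop :=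
  ∀ (ρ : E) (s : Finset κ), ∑ k ∈ s, ‖Φ k ρ‖ ≤ c * ‖ρ‖

section SumMap

variable {E F : Type*} [NormedAddCommGroup E] [NormedSpace ℂ E] [NormedAddCommGroup F]
  [NormedSpace ℂ F] [CompleteSpace F] {Φ : κ → E →L[ℂ] F} {c : ℝ≥0}

lemma SumBound.summable_norm (h : SumBound Φ c) (ρ : E) : Summable fun k => ‖Φ k ρ‖ :=
  summable_of_sum_le (fun _ => norm_nonneg _) (h ρ)

lemma SumBound.tsum_norm_le (h : SumBound Φ c) (ρ : E) : ∑' k, ‖Φ k ρ‖ ≤ c * ‖ρ‖ :=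
  (h.summable_norm ρ).tsum_le_of_sum_le (h ρ)

open Classical in
/-- The sum of a family of bounded linear maps. -/
def sumMap (Φ : κ → E →L[ℂ] F) : E →L[ℂ] F :=
  if h : ∃ c, SumBound Φ c then
    LinearMap.mkContinuous
      { toFun := fun ρ => ∑' k, Φ k ρ
        map_add' := fun ρ τ => by
          rw [← ((h.choose_spec.summable_norm ρ).of_norm).tsum_add
            ((h.choose_spec.summable_norm τ).of_norm)]
          exact tsum_congr fun k => map_add (Φ k) ρ τ
        map_smul' := fun c ρ => by
          rw [RingHom.id_apply, ← ((h.choose_spec.summable_norm ρ).of_norm).tsum_const_smul]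
          exact tsum_congr fun k => map_smul (Φ k) c ρ }
      h.choose
      fun ρ => (norm_tsum_le_tsum_norm (h.choose_spec.summable_norm ρ)).trans
        (h.choose_spec.tsum_norm_le ρ)
  else 0

lemma SumBound.sumMap_apply (h : SumBound Φ c) (ρ : E) : sumMap Φ ρ = ∑' k, Φ k ρ := by
  rw [sumMap, dif_pos ⟨c, h⟩]; rfl

lemma SumBound.hasSum (h : SumBound Φ c) (ρ : E) : HasSum (fun k => Φ k ρ) (sumMap Φ ρ) := by
  rw [h.sumMap_apply]
  exact (h.summable_norm ρ).of_norm.hasSum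

lemma SumBound.norm_sumMap_le (h : SumBound Φ c) : ‖sumMap Φ‖ ≤ c :=
  opNorm_le_bound _ (by positivity) fun ρ => by
    rw [h.sumMap_apply]
    exact (norm_tsum_le_tsum_norm (h.summable_norm ρ)).trans (h.tsum_norm_le ρ)

end SumMap

/-- The completely positive map `ρ ↦ ∑ k, K k ρ (K k)†`. -/
def krausMap (K : κ → 𝓗 →L[ℂ] 𝓗) : TraceClass 𝓗 →L[ℂ] TraceClass 𝓗 :=
  sumMap fun k => sandwichL (K k) (adjoint (K k))

lemma KrausBound.sumBound (h : KrausBound K C) :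
    SumBound (fun k => sandwichL (K k) (adjoint (K k))) (4 * C) := fun ρ s => by
  simpa using h.sum_norm_le ρ s

lemma KrausBound.krausMap_apply (h : KrausBound K C) (ρ : TraceClass 𝓗) :
    krausMap K ρ = ∑' k, sandwich (K k) ρ (adjoint (K k)) := h.sumBound.sumMap_apply ρ

lemma KrausBound.hasSum (h : KrausBound K C) (ρ : TraceClass 𝓗) :
    HasSum (fun k => sandwich (K k) ρ (adjoint (K k))) (krausMap K ρ) := h.sumBound.hasSum ρ

lemma KrausBound.norm_krausMap_le (h : KrausBound K C) : ‖krausMap K‖ ≤ 4 * C := by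
  simpa [krausMap] using h.sumBound.norm_sumMap_le

/-- No Kraus bound is required: without one, `sumMap` takes its default value zero, which is
positive. -/
lemma krausMap_isPos (K : κ → 𝓗 →L[ℂ] 𝓗) {ρ : TraceClass 𝓗} (hρ : IsPos ρ) :
    IsPos (krausMap K ρ) := by
  by_cases h : ∃ c, SumBound (fun k => sandwichL (K k) (adjoint (K k))) c
  · obtain ⟨c, h⟩ := h
    exact isPos_of_hasSum (h.hasSum ρ) fun k => hρ.sandwich (K k)
  · rw [krausMap, sumMap, dif_neg h]
    exact isPos_zero

lemma strongSum_spec {f : κ → 𝓗 →L[ℂ] 𝓗} (h : StronglySummable f) (a : 𝓗) :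
    HasSum (fun k => f k a) (strongSum f a) := by
  rw [strongSum, dif_pos h]
  exact h.choose_spec a

/-- On |a⟩⟨b| both sides are ⟨b, B a⟩, so strong convergence of ∑ K†K is enough. -/
lemma trace_krausMap (h : KrausBound K C) {B : 𝓗 →L[ℂ] 𝓗}
    (hB : ∀ a, HasSum (fun k => (adjoint (K k) * K k) a) (B a)) (ρ : TraceClass 𝓗) :
    trace (krausMap K ρ) = trace (sandwich B ρ 1) := by
  have : traceL.comp (krausMap K) = traceL.comp (sandwichL B 1) :=
    clm_ext_ketbra fun a b => by
      have h1 := (h.hasSum (ketbra a b)).mapL traceL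
      have h2 := (hB a).mapL (innerSL ℂ b)
      simp only [sandwich_ketbra, traceL_apply, trace_ketbra, adjoint_adjoint] at h1
      simp only [innerSL_apply_apply, mul_apply_eq_comp, adjoint_inner_right] at h2
      simpa [sandwich_ketbra, trace_ketbra, adjoint_one] using h1.unique h2
  exact DFunLike.congr_fun this ρ

/-- The sums of ‖K_k a‖² = ⟨a, K_k†K_k a⟩ increase to ⟨a, B a⟩. -/
lemma krausBound_of_hasSum {B : 𝓗 →L[ℂ] 𝓗}
    (hB : ∀ a, HasSum (fun k => (adjoint (K k) * K k) a) (B a)) : KrausBound K ‖B‖₊ := by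
  intro a s
  have h2 := Complex.hasSum_re ((hB a).mapL (innerSL ℂ a))
  have h3 : ∀ k, (innerSL ℂ a ((adjoint (K k) * K k) a)).re = ‖K k a‖ ^ 2 := fun k => by
    rw [innerSL_apply_apply, mul_apply_eq_comp, adjoint_inner_right,
      inner_self_eq_norm_sq_to_K]
    norm_cast
  simp only [h3] at h2
  calc ∑ k ∈ s, ‖K k a‖ ^ 2 ≤ (innerSL ℂ a (B a)).re := sum_le_hasSum s (fun _ _ => by positivity) h2
    _ ≤ ‖a‖ * (‖B‖ * ‖a‖) := (Complex.re_le_norm _).trans ((norm_inner_le_norm _ _).trans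
        (by gcongr; exact le_opNorm _ _))
    _ = _ := by simp; ring

/-- Strong convergence of a uniformly bounded family of operators `A i` implies convergence of
`A i ρ` in trace norm. -/
lemma tendsto_sandwich_left {ι : Type*} {l : Filter ι} {A : ι → 𝓗 →L[ℂ] 𝓗} {B : 𝓗 →L[ℂ] 𝓗} {c : ℝ}
    (hA : ∀ i, ‖A i‖ ≤ c) (h : ∀ a, Tendsto (fun i => A i a) l (𝓝 (B a))) (ρ : TraceClass 𝓗) :
    Tendsto (fun i => sandwich (A i) ρ 1) l (𝓝 (sandwich B ρ 1)) := by
  obtain ⟨ι, a, b, h1, h2, h3⟩ := isNuclear ρ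
  have h4 : ∀ T : 𝓗 →L[ℂ] 𝓗, sandwich T ρ 1 = ∑' i, ketbra (T (a i)) (b i) := fun T => by
    have := (h3.mapL (sandwichL T 1)).tsum_eq
    simpa [sandwich_ketbra, adjoint_one] using this.symm
  simp only [h4]
  -- Dominated convergence over the nuclear series, with majorant c ‖a_k‖ ‖b_k‖.
  refine tendsto_tsum_of_dominated_convergence (h1.mul_left c) (fun k => ?_)
    (Eventually.of_forall fun i k => ?_)
  · rw [tendsto_iff_norm_sub_tendsto_zero]
    have h5 := (tendsto_iff_norm_sub_tendsto_zero.1 (h (a k))).mul_const ‖b k‖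
    rw [zero_mul] at h5
    refine squeeze_zero (fun _ => norm_nonneg _) (fun i => ?_) h5
    have : ketbra (A i (a k)) (b k) - ketbra (B (a k)) (b k) = ketbra (A i (a k) - B (a k)) (b k) :=
      toOp_injective (by simp)
    rw [this]
    exact norm_ketbra_le _ _
  · calc _ ≤ ‖A i (a k)‖ * ‖b k‖ := norm_ketbra_le _ _
      _ ≤ (c * ‖a k‖) * ‖b k‖ := by gcongr; exact le_of_opNorm_le _ (hA i) _
      _ = _ := by ring

end Maps

end TraceClass
end

noncomputable section

namespace TraceClass

open ContinuousLinearMap InnerProductSpace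

/-! ## Exponentials of bounded maps -/

section Exp

variable {E : Type*} [NormedAddCommGroup E] [NormedSpace ℂ E] [CompleteSpace E]

/-- After an index shift, 1/(n+m)! ≤ 1/n! term by term. The cases m = 0, 1, 2 give the growth,
continuity and first-order estimates of the flow. -/
lemma norm_exp_sub_sum_le (X : E →L[ℂ] E) (m : ℕ) :
    ‖NormedSpace.exp X - ∑ i ∈ Finset.range m, ((i.factorial : ℂ)⁻¹) • X ^ i‖
      ≤ ‖X‖ ^ m * Real.exp ‖X‖ := by
  have h1 := (hasSum_nat_add_iff' m).2 (NormedSpace.exp_series_hasSum_exp' (𝕂 := ℂ) X)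
  -- The space may be trivial, so the identity has norm at most one, not exactly one; exponent 0 is
  -- separate.
  have hpow : ∀ n, ‖X ^ n‖ ≤ ‖X‖ ^ n := fun n => by
    rcases Nat.eq_zero_or_pos n with rfl | hn
    · rw [pow_zero, pow_zero]; exact ContinuousLinearMap.norm_id_le
    · exact norm_pow_le' X hn
  have h2 : HasSum (fun n : ℕ => ‖X‖ ^ m * (‖X‖ ^ n / n.factorial)) (‖X‖ ^ m * Real.exp ‖X‖) := by
    rw [Real.exp_eq_exp_ℝ]
    exact (NormedSpace.expSeries_div_hasSum_exp ‖X‖).mul_left _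
  rw [← h1.tsum_eq, ← h2.tsum_eq]
  refine tsum_of_norm_bounded h2.summable.hasSum fun n => ?_
  rw [norm_smul, norm_inv, Complex.norm_natCast]
  calc _ ≤ (n.factorial : ℝ)⁻¹ * ‖X‖ ^ (n + m) := by
        gcongr
        · omega
        · exact hpow _
    _ = _ := by rw [pow_add]; ring

lemma norm_exp_le (X : E →L[ℂ] E) : ‖NormedSpace.exp X‖ ≤ Real.exp ‖X‖ := by
  simpa using norm_exp_sub_sum_le X 0

lemma norm_exp_sub_one_le (X : E →L[ℂ] E) : ‖NormedSpace.exp X - 1‖ ≤ ‖X‖ * Real.exp ‖X‖ := by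
  simpa using norm_exp_sub_sum_le X 1

lemma norm_exp_sub_one_sub_le (X : E →L[ℂ] E) :
    ‖NormedSpace.exp X - 1 - X‖ ≤ ‖X‖ ^ 2 * Real.exp ‖X‖ := by
  simpa [Finset.sum_range_succ, sub_sub] using norm_exp_sub_sum_le X 2

/-- The flow `exp (t G)` generated by a bounded map `G`. -/
def flow (G : E →L[ℂ] E) (t : ℝ) : E →L[ℂ] E := NormedSpace.exp (t • G)

lemma flow_zero (G : E →L[ℂ] E) : flow G 0 = 1 := by simp [flow]

lemma flow_add (G : E →L[ℂ] E) (s t : ℝ) : flow G (s + t) = flow G s * flow G t := by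
  let _ : NormedAlgebra ℚ (E →L[ℂ] E) := .restrictScalars ℚ ℝ _
  rw [flow, add_smul, NormedSpace.exp_add_of_commute]
  · rfl
  · exact ((Commute.refl G).smul_left s).smul_right t

lemma hasDerivAt_flow (G : E →L[ℂ] E) (t : ℝ) : HasDerivAt (flow G) (G * flow G t) t :=
  hasDerivAt_exp_smul_const' (𝕂 := ℝ) G t

lemma continuous_flow (G : E →L[ℂ] E) : Continuous (flow G) :=
  continuous_iff_continuousAt.2 fun t => (hasDerivAt_flow G t).continuousAt

variable {G : E →L[ℂ] E} {c t : ℝ}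

lemma norm_smul_le_of_le (hG : ‖G‖ ≤ c) (ht : 0 ≤ t) : ‖t • G‖ ≤ t * c := by
  rw [norm_smul, Real.norm_of_nonneg ht]; gcongr

lemma norm_flow_apply_le (hG : ‖G‖ ≤ c) (ht : 0 ≤ t) (ρ : E) :
    ‖flow G t ρ‖ ≤ Real.exp (t * c) * ‖ρ‖ := by
  refine le_of_opNorm_le _ ((norm_exp_le _).trans ?_) ρ
  exact Real.exp_le_exp.2 (norm_smul_le_of_le hG ht)

lemma norm_flow_apply_sub_le (hG : ‖G‖ ≤ c) (ht : 0 ≤ t) (ρ : E) :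
    ‖flow G t ρ - ρ‖ ≤ t * c * Real.exp (t * c) * ‖ρ‖ := by
  have h := norm_smul_le_of_le hG ht
  refine le_of_opNorm_le (flow G t - 1) ((norm_exp_sub_one_le _).trans ?_) ρ
  exact mul_le_mul h (Real.exp_le_exp.2 h) (Real.exp_pos _).le ((norm_nonneg _).trans h)

lemma norm_flow_apply_sub_sub_le (hG : ‖G‖ ≤ c) (ht : 0 ≤ t) (ρ : E) :
    ‖flow G t ρ - ρ - t • G ρ‖ ≤ (t * c) ^ 2 * Real.exp (t * c) * ‖ρ‖ := by
  have h := norm_smul_le_of_le hG ht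
  refine le_of_opNorm_le (flow G t - 1 - t • G) ((norm_exp_sub_one_sub_le _).trans ?_) ρ
  exact mul_le_mul (pow_le_pow_left₀ (norm_nonneg _) h 2) (Real.exp_le_exp.2 h) (Real.exp_pos _).le
    (by positivity)

/-- A continuous solution of the integral equation of `G` is given by the flow. -/
lemma eq_flow_of_integral_eq {G : E →L[ℂ] E} {f : ℝ → E} {a b : ℝ} (hab : a ≤ b)
    (hf : ContinuousOn f (Icc a b))
    (h : ∀ r ∈ Icc a b, f r = f a + ∫ p in a..r, G (f p)) : f b = flow G (b - a) (f a) := by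
  -- Right derivatives suffice for uniqueness of solutions of a Lipschitz ODE.
  have hder : ∀ r ∈ Ico a b, HasDerivWithinAt f (G (f r)) (Ici r) r := by
    intro r hr
    have hG : ContinuousOn (fun p => G (f p)) (Icc a b) := G.continuous.comp_continuousOn hf
    have hr' : r ∈ Icc a b := Ico_subset_Icc_self hr
    have hint : IntervalIntegrable (fun p => G (f p)) volume a r :=
      (hG.mono (Icc_subset_Icc_right hr.2.le)).intervalIntegrable_of_Icc hr.1
    have hnhds : Icc a b ∈ 𝓝[>] r :=
      mem_of_superset (Ioc_mem_nhdsGT hr.2) fun x hx => ⟨hr.1.trans hx.1.le, hx.2⟩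
    have h1 : HasDerivWithinAt (fun u => ∫ p in a..u, G (f p)) (G (f r)) (Ici r) r :=
      intervalIntegral.integral_hasDerivWithinAt_right hint
        (hG.stronglyMeasurableAtFilter_nhdsWithin measurableSet_Icc r |>.filter_mono
          (nhdsWithin_le_of_mem hnhds))
        ((hG r hr').mono_of_mem_nhdsWithin hnhds)
    refine (h1.const_add (f a)).congr_of_eventuallyEq ?_ (h r hr')
    filter_upwards [mem_of_superset (Icc_mem_nhdsGE hr.2) fun x hx => (⟨hr.1.trans hx.1, hx.2⟩ :
      x ∈ Icc a b)] with x hx using h x hx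
  have hg : ∀ r, HasDerivAt (fun r => flow G (r - a) (f a)) (G (flow G (r - a) (f a))) r := fun r =>
    ((ContinuousLinearMap.apply ℂ E (f a)).restrictScalars ℝ).hasFDerivAt.comp_hasDerivAt r
      ((hasDerivAt_flow G (r - a)).comp_sub_const r a)
  exact ODE_solution_unique (v := fun _ => G) (K := ‖G‖₊) (fun _ => G.lipschitz) hf hder
    (fun r _ => (hg r).continuousAt.continuousWithinAt) (fun r _ => (hg r).hasDerivWithinAt)
    (by simp [flow_zero]) (right_mem_Icc.2 hab)

end Exp

/-! ### Positivity of semigroups with Lindblad-type generators. -/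

section Positivity

variable {𝓗 : Type v} [NormedAddCommGroup 𝓗] [InnerProductSpace ℂ 𝓗] [CompleteSpace 𝓗]

/-- Generators `ρ ↦ -K ρ - ρ K† + Φ ρ`. -/
def lindbladGen (K : 𝓗 →L[ℂ] 𝓗) (Φ : TraceClass 𝓗 →L[ℂ] TraceClass 𝓗) :
    TraceClass 𝓗 →L[ℂ] TraceClass 𝓗 :=
  Φ - sandwichL K 1 - sandwichL 1 (adjoint K)

/-- Completing the square: the second-order term turns the Euler step into (1 - hK) ρ (1 - hK)† + h
Φ ρ. -/
lemma isPos_lindblad_step {K : 𝓗 →L[ℂ] 𝓗} {Φ : TraceClass 𝓗 →L[ℂ] TraceClass 𝓗}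
    (hΦ : ∀ ρ, IsPos ρ → IsPos (Φ ρ)) {h : ℝ} (hh : 0 ≤ h) {ρ : TraceClass 𝓗} (hρ : IsPos ρ) :
    IsPos (ρ + (h : ℂ) • lindbladGen K Φ ρ + (h ^ 2 : ℂ) • sandwich K ρ (adjoint K)) := by
  have : ρ + (h : ℂ) • lindbladGen K Φ ρ + (h ^ 2 : ℂ) • sandwich K ρ (adjoint K)
      = sandwich (1 - (h : ℂ) • K) ρ (adjoint (1 - (h : ℂ) • K)) + (h : ℂ) • Φ ρ := by
    apply toOp_injective
    simp only [map_add, map_smul, map_sub, lindbladGen, sub_apply, sandwichL_apply,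
      toOp_sandwich, map_smulₛₗ, adjoint_one, Complex.conj_ofReal]
    simp only [mul_sub, sub_mul, mul_one, one_mul, smul_mul_assoc, mul_smul_comm]
    module
  rw [this]
  exact (hρ.sandwich _).add ((hΦ ρ hρ).smul hh)

/-- Let f be the distance of the trajectory to the closed cone of positive operators. Comparing the
flow with the corrected Euler step from an almost nearest positive operator gives f(x+h) ≤ (1 +
h‖G‖) f(x) + O(h²). Since f starts at 0, Grönwall's inequality keeps it at 0. -/
theorem flow_lindbladGen_isPos {K : 𝓗 →L[ℂ] 𝓗} {Φ : TraceClass 𝓗 →L[ℂ] TraceClass 𝓗}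
    (hΦ : ∀ ρ, IsPos ρ → IsPos (Φ ρ)) {t : ℝ} (ht : 0 ≤ t) {ρ : TraceClass 𝓗} (hρ : IsPos ρ) :
    IsPos (flow (lindbladGen K Φ) t ρ) := by
  set G := lindbladGen K Φ with hG
  set S := {ρ : TraceClass 𝓗 | IsPos ρ}
  have hne : S.Nonempty := ⟨0, isPos_zero⟩
  set B := sandwichL K (adjoint K) with hB
  set s : ℝ → TraceClass 𝓗 := fun u => flow G u ρ
  have hs : Continuous s := (continuous_flow G).clm_apply continuous_const
  set f : ℝ → ℝ := fun u => Metric.infDist (s u) S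
  have hf : Continuous f := (Metric.continuous_infDist_pt S).comp hs
  have hstep : ∀ x h : ℝ, 0 ≤ h → f (x + h) ≤ f x + h * (‖G‖ * f x)
      + h ^ 2 * (‖G‖ ^ 2 * Real.exp (h * ‖G‖) * ‖s x‖ + ‖B‖ * ‖s x‖ + ‖B‖ * f x) := by
    intro x h hh
    refine le_of_forall_pos_le_add fun δ hδ => ?_
    have hlim : Tendsto (fun ε : ℝ => ε * (1 + h * ‖G‖ + h ^ 2 * ‖B‖)) (𝓝[>] 0) (𝓝 0) := by
      have : Tendsto (fun ε : ℝ => ε * (1 + h * ‖G‖ + h ^ 2 * ‖B‖)) (𝓝 0) (𝓝 (0 * _)) :=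
        tendsto_id.mul_const _
      rw [zero_mul] at this
      exact this.mono_left nhdsWithin_le_nhds
    -- A nearest positive operator is not needed: one within ε of optimal will do, with ε so small
    -- that its total contribution stays below δ.
    obtain ⟨ε, hεδ, hε⟩ := ((hlim.eventually (gt_mem_nhds hδ)).and self_mem_nhdsWithin).exists
    obtain ⟨τ, hτ, hd⟩ := (Metric.infDist_lt_iff hne).1 (lt_add_of_pos_right (f x) hε)
    have hP : τ + (h : ℂ) • G τ + (h ^ 2 : ℂ) • B τ ∈ S := isPos_lindblad_step hΦ hh hτ
    refine (Metric.infDist_le_dist_of_mem hP).trans ?_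
    have h1 : s (x + h) = flow G h (s x) := by
      simp only [s]; rw [add_comm, flow_add]; rfl
    have h2 := norm_flow_apply_sub_sub_le (le_refl ‖G‖) hh (s x)
    rw [dist_eq_norm] at hd ⊢
    have h3 : s (x + h) - (τ + (h : ℂ) • G τ + (h ^ 2 : ℂ) • B τ)
        = (flow G h (s x) - s x - h • G (s x)) + ((s x - τ) + (h : ℂ) • G (s x - τ)
          + (h ^ 2 : ℂ) • B (s x - τ) - (h ^ 2 : ℂ) • B (s x)) := by
      rw [h1, map_sub, map_sub, ← Complex.coe_smul h (G (s x))]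
      module
    have h4 : ‖(h : ℂ)‖ = h := by simp [abs_of_nonneg hh]
    have h5 : ‖(h ^ 2 : ℂ)‖ = h ^ 2 := by simp
    have h6 := G.le_opNorm (s x - τ)
    have h7 := B.le_opNorm (s x - τ)
    have h8 := B.le_opNorm (s x)
    have hh2 : 0 ≤ h ^ 2 := by positivity
    rw [h3]
    calc _ ≤ ‖flow G h (s x) - s x - h • G (s x)‖ + (‖s x - τ‖ + h * (‖G‖ * ‖s x - τ‖)
          + h ^ 2 * (‖B‖ * ‖s x - τ‖) + h ^ 2 * (‖B‖ * ‖s x‖)) := by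
          refine (norm_add_le _ _).trans (add_le_add_right ?_ _)
          refine (norm_sub_le _ _).trans (add_le_add ((norm_add_le _ _).trans
            (add_le_add ((norm_add_le _ _).trans (add_le_add_right ?_ _)) ?_)) ?_)
          · rw [norm_smul, h4]; gcongr
          · rw [norm_smul, h5]; gcongr
          · rw [norm_smul, h5]; gcongr
      _ ≤ (h * ‖G‖) ^ 2 * Real.exp (h * ‖G‖) * ‖s x‖ + ((f x + ε) + h * (‖G‖ * (f x + ε))
          + h ^ 2 * (‖B‖ * (f x + ε)) + h ^ 2 * (‖B‖ * ‖s x‖)) := by gcongr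
      _ = f x + h * (‖G‖ * f x)
          + h ^ 2 * (‖G‖ ^ 2 * Real.exp (h * ‖G‖) * ‖s x‖ + ‖B‖ * ‖s x‖ + ‖B‖ * f x)
          + ε * (1 + h * ‖G‖ + h ^ 2 * ‖B‖) := by ring
      _ ≤ _ := by linarith
  have hgron := le_gronwallBound_of_liminf_deriv_right_le (f := f) (f' := fun x => ‖G‖ * f x)
    (δ := 0) (K := ‖G‖) (ε := 0) (a := 0) (b := t) hf.continuousOn
    (fun x _ r hr => by
      refine Eventually.frequently ?_
      have hlim : Tendsto (fun z => ‖G‖ * f x + (z - x) * (‖G‖ ^ 2 * Real.exp ((z - x) * ‖G‖) * ‖s x‖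
          + ‖B‖ * ‖s x‖ + ‖B‖ * f x)) (𝓝[>] x) (𝓝 (‖G‖ * f x)) := by
        have : Continuous (fun z => ‖G‖ * f x + (z - x) * (‖G‖ ^ 2 * Real.exp ((z - x) * ‖G‖) * ‖s x‖
          + ‖B‖ * ‖s x‖ + ‖B‖ * f x)) := by fun_prop
        simpa using (this.tendsto x).mono_left nhdsWithin_le_nhds
      filter_upwards [hlim.eventually (gt_mem_nhds hr), self_mem_nhdsWithin] with z hz hzx
      refine lt_of_le_of_lt ?_ hz
      have hzx' : 0 < z - x := sub_pos.2 hzx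
      rw [inv_mul_le_iff₀ hzx']
      have := hstep x (z - x) hzx'.le
      rw [add_sub_cancel] at this
      nlinarith)
    (by
      have : s 0 = ρ := by simp [s, flow_zero]
      simp only [f, this]
      exact (Metric.infDist_zero_of_mem (show ρ ∈ S from hρ)).le)
    (fun x _ => by simp) t (right_mem_Icc.2 ht)
  rw [gronwallBound_ε0, zero_mul] at hgron
  have h0 : Metric.infDist (s t) S = 0 := le_antisymm hgron Metric.infDist_nonneg
  have hcl : IsClosed S := isClosed_isPos
  have hmem : s t ∈ S := (hcl.mem_iff_infDist_zero hne).2 h0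
  exact hmem

end Positivity

end TraceClass
end

noncomputable section

open TraceClass ContinuousLinearMap InnerProductSpace

/-! ### Strongly convergent series of positive operators. -/

section PositiveSeries

variable {𝓗 : Type v} [NormedAddCommGroup 𝓗] [InnerProductSpace ℂ 𝓗] {κ : Type*}

lemma isPositive_of_hasSum {f : κ → 𝓗 →L[ℂ] 𝓗} (hf : ∀ u, (f u).IsPositive) {B : 𝓗 →L[ℂ] 𝓗}
    (hB : ∀ a, HasSum (fun u => f u a) (B a)) : B.IsPositive := by
  rw [isPositive_def]
  refine ⟨fun a b => ?_, fun a => ?_⟩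
  · have h1 := (hB b).mapL (innerSL ℂ a)
    have h2 := ((hB a).mapL (innerSL ℂ b)).star
    have h3 : (fun u => innerSL ℂ a (f u b)) = fun u => star (innerSL ℂ b (f u a)) := by
      ext u
      simpa using ((hf u).isSymmetric a b).symm
    rw [h3] at h1
    simpa using h2.unique h1
  · have h1 := RCLike.hasSum_re ℂ ((hB a).mapL (innerSL ℂ a))
    have h2 := h1.nonneg fun u => (hf u).re_inner_nonneg_right a
    rw [reApplyInnerSelf_apply, inner_re_symm]
    exact h2

variable [CompleteSpace 𝓗]

/-- The remainder of the series is itself a strong sum of positive operators, so each partial sum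
lies between 0 and B, and the norm is monotone on positive operators. -/
lemma norm_sum_le_of_hasSum {f : κ → 𝓗 →L[ℂ] 𝓗} (hf : ∀ u, (f u).IsPositive) {B : 𝓗 →L[ℂ] 𝓗}
    (hB : ∀ a, HasSum (fun u => f u a) (B a)) (s : Finset κ) : ‖∑ u ∈ s, f u‖ ≤ ‖B‖ := by
  have h1 : 0 ≤ ∑ u ∈ s, f u :=
    Finset.sum_nonneg fun u _ => (nonneg_iff_isPositive _).2 (hf u)
  refine CStarAlgebra.norm_le_norm_of_nonneg_of_le h1 ?_
  rw [← sub_nonneg, nonneg_iff_isPositive]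
  refine isPositive_of_hasSum (κ := {u // u ∉ s}) (f := fun u => f u) (fun u => hf u) fun a => ?_
  have h2 := (Finset.hasSum_compl_iff (f := fun u => f u a) s (a := (B - ∑ u ∈ s, f u) a)).2
  refine h2 ?_
  have h3 : (B - ∑ u ∈ s, f u) a + ∑ u ∈ s, f u a = B a := by simp [sum_apply]
  rw [h3]
  exact hB a

/-- A subfamily of a strongly summable family of positive operators is strongly summable. -/
lemma StronglySummable.indicator {f : κ → 𝓗 →L[ℂ] 𝓗} (hf : ∀ u, (f u).IsPositive)
    (h : StronglySummable f) (A : Set κ) : StronglySummable (A.indicator f) := by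
  obtain ⟨B, hB⟩ := h
  have h1 : ∀ a, Summable fun u => A.indicator f u a := fun a => by
    have : (fun u => A.indicator f u a) = A.indicator fun u => f u a := by
      ext u; by_cases hu : u ∈ A <;> simp [hu]
    rw [this]
    exact (hB a).summable.indicator A
  have hpos : ∀ u, (A.indicator f u).IsPositive := fun u => by
    by_cases hu : u ∈ A <;> simp [hu, hf]
  -- Partial sums of the subfamily are partial sums of the whole family; this uniform bound makes
  -- the pointwise limit a bounded operator.
  have hle : ∀ s : Finset κ, ‖∑ u ∈ s, A.indicator f u‖ ≤ ‖B‖ := fun s => by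
    classical
    have : ∑ u ∈ s, A.indicator f u = ∑ u ∈ s with u ∈ A, f u := by
      rw [Finset.sum_filter]; exact Finset.sum_congr rfl fun u _ => by simp [Set.indicator_apply]
    rw [this]
    exact norm_sum_le_of_hasSum hf hB _
  refine ⟨LinearMap.mkContinuous
    { toFun := fun a => ∑' u, A.indicator f u a
      map_add' := fun a b => by
        rw [← (h1 a).tsum_add (h1 b)]; simp only [map_add]
      map_smul' := fun c a => by
        rw [RingHom.id_apply, ← (h1 a).tsum_const_smul]; simp only [map_smul] } ‖B‖ fun a => ?_,
    fun a => (h1 a).hasSum⟩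
  refine le_of_tendsto (h1 a).hasSum.norm (Eventually.of_forall fun s => ?_)
  rw [← sum_apply]
  exact le_of_opNorm_le _ (hle s) a

end PositiveSeries

lemma adjoint_ofReal_smul {𝓗 : Type v} [NormedAddCommGroup 𝓗] [InnerProductSpace ℂ 𝓗]
    [CompleteSpace 𝓗] (r : ℝ) (A : 𝓗 →L[ℂ] 𝓗) : adjoint ((r : ℂ) • A) = (r : ℂ) • adjoint A := by
  rw [map_smulₛₗ, Complex.conj_ofReal]

lemma ofReal_sqrt_mul_self (r : ℝ≥0) : (Real.sqrt r : ℂ) * Real.sqrt r = r := by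
  rw [← Complex.ofReal_mul, Real.mul_self_sqrt (NNReal.coe_nonneg r)]

/-! ### Jump maps, rates and generators of the walk as bounded maps. -/

namespace HybridWalk

variable {s : ℕ} {U D₁ D₂ : Type*} {𝓗 : Type v} [NormedAddCommGroup 𝓗] [InnerProductSpace ℂ 𝓗]
  [CompleteSpace 𝓗] (W : HybridWalk s U D₁ D₂ 𝓗) {x : EuclideanSpace ℝ (Fin s)}

/-- The operator `ν u 1_{F u}(x) ∑ j, (J j)† J j`. -/
def rateOp (x : EuclideanSpace ℝ (Fin s)) (u : U) : 𝓗 →L[ℂ] 𝓗 :=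
  (W.F u).indicator
    (fun x => (W.ν u : ℂ) • strongSum fun j => adjoint (W.J j x u) * W.J j x u) x

variable {W}

lemma hasSum_rateOp (hx : x ∈ W.V) (a : 𝓗) : HasSum (fun u => W.rateOp x u a) (W.R x a) :=
  strongSum_spec (W.R_summable x hx) a

lemma rateOp_isPositive (u : U) : (W.rateOp x u).IsPositive := by
  by_cases hx : x ∈ W.F u
  · rw [rateOp, indicator_of_mem hx]
    open ComplexOrder in
    refine IsPositive.smul_of_nonneg ?_ (by exact_mod_cast (W.ν u).2)
    exact isPositive_of_hasSum (fun j => isPositive_adjoint_comp_self (W.J j x u))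
      (strongSum_spec (W.J_summable u x hx))
  · rw [rateOp, indicator_of_notMem hx]
    exact isPositive_zero

lemma R_isPositive (hx : x ∈ W.V) : (W.R x).IsPositive :=
  isPositive_of_hasSum rateOp_isPositive (hasSum_rateOp hx)

lemma R₀_isPositive (hx : x ∈ W.V) : (W.R₀ x).IsPositive :=
  isPositive_of_hasSum (fun k => isPositive_adjoint_comp_self (W.L k x))
    (strongSum_spec (W.L_summable x hx))

lemma krausBound_L (hx : x ∈ W.V) : KrausBound (fun k => W.L k x) ‖W.R₀ x‖₊ :=
  krausBound_of_hasSum (strongSum_spec (W.L_summable x hx))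

/-- The Kraus operators of all jumps at `x`, weighted with the rates. -/
def jumpKraus (W : HybridWalk s U D₁ D₂ 𝓗) (x : EuclideanSpace ℝ (Fin s)) (p : U × D₁) :
    𝓗 →L[ℂ] 𝓗 :=
  (W.F p.1).indicator (fun x => (Real.sqrt (W.ν p.1) : ℂ) • W.J p.2 x p.1) x

lemma hasSum_jumpKraus (u : U) (a : 𝓗) :
    HasSum (fun j => (adjoint (W.jumpKraus x (u, j)) * W.jumpKraus x (u, j)) a)
      (W.rateOp x u a) := by
  by_cases hx : x ∈ W.F u
  · have h1 := (strongSum_spec (W.J_summable u x hx) a).const_smul (W.ν u : ℂ)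
    simp only [jumpKraus, rateOp, indicator_of_mem hx]
    convert h1 using 2 with j
    · rw [adjoint_ofReal_smul, smul_mul_smul_comm, ofReal_sqrt_mul_self]
      rfl
    · rfl
  · simp [jumpKraus, rateOp, indicator_of_notMem hx, hasSum_zero]

/-- A finite set of pairs (u, j) lies in a rectangle. Summing over j first gives at most the rate
operator of u, and then summing over u at most R(x). -/
lemma krausBound_jumpKraus (hx : x ∈ W.V) : KrausBound (W.jumpKraus x) ‖W.R x‖₊ := by
  intro a t
  classical
  have hK : ∀ p, ‖W.jumpKraus x p a‖ ^ 2
      = (innerSL ℂ a ((adjoint (W.jumpKraus x p) * W.jumpKraus x p) a)).re := fun p => by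
    rw [innerSL_apply_apply, mul_apply_eq_comp, adjoint_inner_right, inner_self_eq_norm_sq_to_K]
    norm_cast
  have h1 : ∀ u, ∑ j ∈ t.image Prod.snd, ‖W.jumpKraus x (u, j) a‖ ^ 2
      ≤ (innerSL ℂ a (W.rateOp x u a)).re := fun u => by
    have := Complex.hasSum_re ((hasSum_jumpKraus (W := W) (x := x) u a).mapL (innerSL ℂ a))
    simp only [← hK] at this
    exact sum_le_hasSum _ (fun _ _ => by positivity) this
  have h2 := Complex.hasSum_re ((hasSum_rateOp hx a).mapL (innerSL ℂ a))
  calc ∑ p ∈ t, ‖W.jumpKraus x p a‖ ^ 2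
      ≤ ∑ p ∈ (t.image Prod.fst) ×ˢ (t.image Prod.snd), ‖W.jumpKraus x p a‖ ^ 2 :=
        Finset.sum_le_sum_of_subset_of_nonneg Finset.subset_product fun _ _ _ => by positivity
    _ = ∑ u ∈ t.image Prod.fst, ∑ j ∈ t.image Prod.snd, ‖W.jumpKraus x (u, j) a‖ ^ 2 :=
        Finset.sum_product _ _ _
    _ ≤ ∑ u ∈ t.image Prod.fst, (innerSL ℂ a (W.rateOp x u a)).re :=
        Finset.sum_le_sum fun u _ => h1 u
    _ ≤ (innerSL ℂ a (W.R x a)).re :=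
        sum_le_hasSum _ (fun u _ => (rateOp_isPositive u).re_inner_nonneg_right a) h2
    _ ≤ ‖a‖ * (‖W.R x‖ * ‖a‖) := (Complex.re_le_norm _).trans ((norm_inner_le_norm _ _).trans
        (by gcongr; exact le_opNorm _ _))
    _ = _ := by simp; ring

/-- The jump map `ν u 𝒥(x,u)` as a continuous linear map. -/
def jumpL (W : HybridWalk s U D₁ D₂ 𝓗) (x : EuclideanSpace ℝ (Fin s)) (u : U) :
    TraceClass 𝓗 →L[ℂ] TraceClass 𝓗 :=
  krausMap fun j => W.jumpKraus x (u, j)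

lemma jumpL_isPos (u : U) {ρ : TraceClass 𝓗} (hρ : IsPos ρ) : IsPos (W.jumpL x u ρ) :=
  krausMap_isPos _ hρ

lemma krausBound_jumpKraus_left (hx : x ∈ W.V) (u : U) :
    KrausBound (fun j => W.jumpKraus x (u, j)) ‖W.R x‖₊ := fun a t => by
  have h := krausBound_jumpKraus hx a ({u} ×ˢ t)
  rwa [Finset.sum_product, Finset.sum_singleton] at h

lemma jumpL_apply (hx : x ∈ W.V) (u : U) (ρ : TraceClass 𝓗) :
    W.jumpL x u ρ = (W.ν u : ℂ) • W.jumpMap x u ρ := by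
  rw [jumpL, (krausBound_jumpKraus_left hx u).krausMap_apply]
  by_cases hxu : x ∈ W.F u
  · simp only [jumpKraus, jumpMap, indicator_of_mem hxu]
    have hν : (W.ν u : ℂ) ≠ 0 := by exact_mod_cast (W.ν_pos u).ne'
    rw [← tsum_const_smul'' (W.ν u : ℂ)]
    refine tsum_congr fun j => toOp_injective ?_
    rw [adjoint_ofReal_smul, map_smul, toOp_sandwich, toOp_sandwich, smul_mul_assoc,
      smul_mul_smul_comm, ofReal_sqrt_mul_self]
  · simp only [jumpKraus, jumpMap, indicator_of_notMem hxu, smul_zero]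
    have : sandwich (0 : 𝓗 →L[ℂ] 𝓗) ρ (adjoint 0) = 0 := toOp_injective (by simp)
    rw [this, tsum_zero]

/-- The rates are kept inside `jumpL` because the bound by R(x) controls the weighted maps, summed
over u; the unweighted map acts only along paths, at the price 1/ν_u. -/
lemma jumpMap_eq (hx : x ∈ W.V) (u : U) (ρ : TraceClass 𝓗) :
    W.jumpMap x u ρ = ((W.ν u : ℂ)⁻¹ • W.jumpL x u) ρ := by
  have hν : (W.ν u : ℂ) ≠ 0 := by exact_mod_cast (W.ν_pos u).ne'
  rw [smul_apply, jumpL_apply hx, smul_smul, inv_mul_cancel₀ hν, one_smul]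

lemma sumBound_jumpL (hx : x ∈ W.V) : SumBound (W.jumpL x) (4 * ‖W.R x‖₊) := by
  intro ρ t
  have h := (krausBound_jumpKraus hx).sumBound
  have h1 := h.summable_norm ρ
  have h2 : ∀ u, ‖W.jumpL x u ρ‖ ≤ ∑' j, ‖sandwichL (W.jumpKraus x (u, j)) (adjoint (W.jumpKraus x (u, j))) ρ‖ := fun u => by
    rw [jumpL, (krausBound_jumpKraus_left hx u).krausMap_apply]
    exact norm_tsum_le_tsum_norm (h1.prod_factor u)
  calc ∑ u ∈ t, ‖W.jumpL x u ρ‖ ≤ ∑ u ∈ t, ∑' j, ‖sandwichL (W.jumpKraus x (u, j)) (adjoint (W.jumpKraus x (u, j))) ρ‖ := Finset.sum_le_sum fun u _ => h2 u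
    _ ≤ ∑' u, ∑' j, ‖sandwichL (W.jumpKraus x (u, j)) (adjoint (W.jumpKraus x (u, j))) ρ‖ :=
      h1.prod.sum_le_tsum _ fun u _ => tsum_nonneg fun j => norm_nonneg _
    _ = _ := (h1.tsum_prod).symm
    _ ≤ _ := h.tsum_norm_le ρ

lemma norm_jumpL_le (hx : x ∈ W.V) (u : U) : ‖W.jumpL x u‖ ≤ 4 * ‖W.R x‖ := by
  simpa [jumpL] using (krausBound_jumpKraus_left hx u).norm_krausMap_le

lemma trace_jumpL (hx : x ∈ W.V) (u : U) (ρ : TraceClass 𝓗) :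
    trace (W.jumpL x u ρ) = trace (sandwich (W.rateOp x u) ρ 1) :=
  trace_krausMap (krausBound_jumpKraus_left hx u) (hasSum_jumpKraus u) ρ

/-- The rate of jumps from `x` of a type in `A`. -/
def rateOn (W : HybridWalk s U D₁ D₂ 𝓗) (x : EuclideanSpace ℝ (Fin s)) (A : Set U) : 𝓗 →L[ℂ] 𝓗 :=
  strongSum (A.indicator (W.rateOp x))

lemma hasSum_rateOn (hx : x ∈ W.V) (A : Set U) (a : 𝓗) :
    HasSum (fun u => A.indicator (W.rateOp x) u a) (W.rateOn x A a) :=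
  strongSum_spec (StronglySummable.indicator rateOp_isPositive (W.R_summable x hx) A) a

lemma sumBound_indicator_jumpL (hx : x ∈ W.V) (A : Set U) :
    SumBound (A.indicator (W.jumpL x)) (4 * ‖W.R x‖₊) := fun ρ t =>
  (Finset.sum_le_sum fun u _ => by
    by_cases hu : u ∈ A <;> simp [hu]).trans (sumBound_jumpL hx ρ t)

lemma trace_sumMap_jumpL (hx : x ∈ W.V) (A : Set U) (ρ : TraceClass 𝓗) :
    trace (sumMap (A.indicator (W.jumpL x)) ρ) = trace (sandwich (W.rateOn x A) ρ 1) := by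
  have : traceL.comp (sumMap (A.indicator (W.jumpL x))) = traceL.comp (sandwichL (W.rateOn x A) 1) :=
    clm_ext_ketbra fun a b => by
      have h1 := ((sumBound_indicator_jumpL hx A).hasSum (ketbra a b)).mapL traceL
      have h2 := (hasSum_rateOn hx A a).mapL (innerSL ℂ b)
      have h3 : (fun u => traceL (A.indicator (W.jumpL x) u (ketbra a b)))
          = fun u => innerSL ℂ b (A.indicator (W.rateOp x) u a) := by
        ext u
        by_cases hu : u ∈ A
        · simp [hu, trace_jumpL hx, sandwich_ketbra, trace_ketbra, adjoint_one]
        · simp only [indicator_of_notMem hu, zero_apply, map_zero]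
      rw [h3] at h1
      simpa [sandwich_ketbra, trace_ketbra, adjoint_one] using h1.unique h2
  exact DFunLike.congr_fun this ρ

lemma transfer_eq (k l : W.V) (ρ : TraceClass 𝓗) :
    W.transfer k l ρ = sumMap ({u | W.y u l = (k : EuclideanSpace ℝ (Fin s))}.indicator
      (W.jumpL l)) ρ := by
  rw [transfer, (sumBound_indicator_jumpL l.2 _).sumMap_apply]
  refine tsum_congr fun u => ?_
  by_cases h : W.y u l = (k : EuclideanSpace ℝ (Fin s))
  · simp [h, jumpL_apply l.2]
  · simp [h]

/-- By trace duality, this is the part of R(k) that comes from the counts leading from k to l. -/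
lemma dualMap_transfer (l k : W.V) :
    dualMap (W.transfer l k) 1 = W.rateOn k {u | W.y u k = (l : EuclideanSpace ℝ (Fin s))} :=
  dualMap_one_eq fun ρ => by rw [transfer_eq, trace_sumMap_jumpL k.2]

/-- The generator of the evolution between jumps at `x`. -/
def gen (W : HybridWalk s U D₁ D₂ 𝓗) (x : EuclideanSpace ℝ (Fin s)) :
    TraceClass 𝓗 →L[ℂ] TraceClass 𝓗 :=
  lindbladGen (Complex.I • W.H x + (1 / 2 : ℂ) • (W.R₀ x + W.R x)) (krausMap fun k => W.L k x)

lemma adjoint_drift (hx : x ∈ W.V) :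
    adjoint (Complex.I • W.H x + (1 / 2 : ℂ) • (W.R₀ x + W.R x))
      = -(Complex.I • W.H x) + (1 / 2 : ℂ) • (W.R₀ x + W.R x) := by
  have h1 : adjoint (W.H x) = W.H x := (W.H_selfAdjoint x hx).adjoint_eq
  have h2 : adjoint (W.R x) = W.R x := (R_isPositive hx).isSelfAdjoint.adjoint_eq
  have h3 : adjoint (W.R₀ x) = W.R₀ x := (R₀_isPositive hx).isSelfAdjoint.adjoint_eq
  rw [map_add, map_smulₛₗ, map_smulₛₗ, map_add, h1, h2, h3, Complex.conj_I, neg_smul,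
    show starRingEnd ℂ (1 / 2) = 1 / 2 by simpa using Complex.conj_ofReal (1 / 2)]

lemma gen_apply (hx : x ∈ W.V) (ρ : TraceClass 𝓗) :
    W.gen x ρ = W.L₀ x ρ - (1 / 2 : ℂ) • anticommutator (W.R x) ρ := by
  rw [L₀, ← (krausBound_L hx).krausMap_apply, gen, lindbladGen, adjoint_drift hx]
  apply toOp_injective
  simp only [TraceClass.commutator, anticommutator, map_add, map_sub, map_smul, sub_apply, sandwichL_apply,
    toOp_sandwich, mul_one, one_mul, add_mul, mul_add, smul_mul_assoc, mul_smul_comm,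
    mul_neg]
  module

/-- Since -½{R - ν, ρ} = -½{R, ρ} + νρ, the compensator is a scalar shift of the generator. -/
lemma drift_eq (hx : x ∈ W.V) (ρ : TraceClass 𝓗) :
    W.L₀ x ρ - (1 / 2 : ℂ) • anticommutator (W.R x - (W.totalRate : ℂ) • 1) ρ
      = (W.gen x + (W.totalRate : ℂ) • 1) ρ := by
  rw [add_apply, gen_apply hx]
  apply toOp_injective
  simp only [anticommutator, map_add, map_sub, map_smul, smul_apply, one_apply_eq_self,
    toOp_sandwich, mul_one, one_mul, sub_mul, mul_sub, smul_mul_assoc, mul_smul_comm]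
  module

lemma norm_gen_le (hx : x ∈ W.V) {c : ℝ} (hH : ‖W.H x‖ ≤ c) (hR : ‖W.R x‖ ≤ c)
    (hR₀ : ‖W.R₀ x‖ ≤ c) : ‖W.gen x‖ ≤ 8 * c := by
  have hc : 0 ≤ c := (norm_nonneg _).trans hH
  set K := Complex.I • W.H x + (1 / 2 : ℂ) • (W.R₀ x + W.R x) with hK
  have h1 : ‖K‖ ≤ 2 * c := by
    calc ‖K‖ ≤ ‖Complex.I • W.H x‖ + ‖(1 / 2 : ℂ) • (W.R₀ x + W.R x)‖ := norm_add_le _ _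
      _ ≤ c + 1 / 2 * (c + c) := by
        rw [norm_smul, norm_smul]
        refine add_le_add (by simpa using hH) ?_
        refine mul_le_mul (by simp) ((norm_add_le _ _).trans (add_le_add hR₀ hR)) (norm_nonneg _)
          (by norm_num)
      _ = 2 * c := by ring
  have hone : ‖(1 : 𝓗 →L[ℂ] 𝓗)‖ ≤ 1 := norm_id_le
  have h2 : ‖sandwichL K 1‖ ≤ 2 * c :=
    (norm_sandwichL_le _ _).trans ((mul_le_mul h1 hone (norm_nonneg _) (by positivity)).trans
      (mul_one _).le)
  have h3 : ‖sandwichL 1 (adjoint K)‖ ≤ 2 * c := by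
    refine (norm_sandwichL_le _ _).trans ?_
    rw [LinearIsometryEquiv.norm_map]
    exact (mul_le_mul hone h1 (norm_nonneg _) zero_le_one).trans (one_mul _).le
  have h4 : ‖krausMap fun k => W.L k x‖ ≤ 4 * c :=
    (krausBound_L hx).norm_krausMap_le.trans (by simpa using hR₀)
  calc ‖W.gen x‖ ≤ ‖krausMap fun k => W.L k x‖ + ‖sandwichL K 1‖ + ‖sandwichL 1 (adjoint K)‖ :=
        (norm_sub_le _ _).trans (add_le_add_left (norm_sub_le _ _) _)
    _ ≤ 4 * c + 2 * c + 2 * c := by gcongr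
    _ = 8 * c := by ring

/-- By cyclicity only the sum R₀ + R of the drift operator and its adjoint matters; H drops out and
R₀ is restored by the Kraus terms L. What remains is the trace that the jumps give back. -/
lemma trace_gen (hx : x ∈ W.V) (ρ : TraceClass 𝓗) :
    trace (W.gen x ρ) = - trace (sandwich (W.R x) ρ 1) := by
  have h1 := trace_krausMap (krausBound_L hx) (strongSum_spec (W.L_summable x hx)) ρ
  have h2 : traceL (W.gen x ρ) = - traceL (sandwichL (W.R x) 1 ρ) := by
    rw [gen, lindbladGen, adjoint_drift hx]
    set K := Complex.I • W.H x + (1 / 2 : ℂ) • (W.R₀ x + W.R x) with hK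
    simp only [sub_apply, map_sub, traceL_apply, sandwichL_apply, trace_sandwich_comm, h1]
    have h3 : sandwich K ρ 1 + sandwich (-(Complex.I • W.H x) + (1 / 2 : ℂ) • (W.R₀ x + W.R x)) ρ 1
        = sandwich (W.R₀ x) ρ 1 + sandwich (W.R x) ρ 1 := by
      apply toOp_injective
      simp only [hK, map_add, toOp_sandwich, mul_one, add_mul, smul_mul_assoc, neg_mul]
      module
    have h4 := congrArg traceL h3
    simp only [map_add, traceL_apply] at h4
    change trace (sandwich (W.R₀ x) ρ 1) - _ - _ = _
    linear_combination -h4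
  exact h2

/-- The generator including the compensation of the total rate preserves positivity. -/
lemma flow_isPos {t : ℝ} (ht : 0 ≤ t) {ρ : TraceClass 𝓗} (hρ : IsPos ρ) :
    IsPos (flow (W.gen x + (W.totalRate : ℂ) • 1) t ρ) := by
  -- The shift νρ is absorbed into the positive part Φ of a Lindblad-type generator.
  have : W.gen x + (W.totalRate : ℂ) • 1
      = lindbladGen (Complex.I • W.H x + (1 / 2 : ℂ) • (W.R₀ x + W.R x))
        ((krausMap fun k => W.L k x) + (W.totalRate : ℂ) • 1) := by
    rw [gen, lindbladGen, lindbladGen]; abel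
  rw [this]
  refine flow_lindbladGen_isPos (fun τ hτ => ?_) ht hρ
  exact (krausMap_isPos _ hτ).add (hτ.smul W.totalRate.2)

end HybridWalk
end

noncomputable section

/-! ## Increments of a Poisson family -/

section Poisson

variable {Ω U : Type*} {mΩ : MeasurableSpace Ω}

/-- The event that the increments over `(s, t]` are given by `a`. -/
def incEvent (N : U → ℝ≥0 → Ω → ℕ) (s t : ℝ≥0) (a : U → ℕ) : Set Ω :=
  {ω | ∀ u, N u t ω - N u s ω = a u}

open Classical in
/-- The event of exactly one jump, of type `u`, in `(s, t]`. -/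
def oneJump (N : U → ℝ≥0 → Ω → ℕ) (s t : ℝ≥0) (u : U) : Set Ω :=
  incEvent N s t (Pi.single u 1)

/-- The event of no jump in `(s, t]`. -/
def noJump (N : U → ℝ≥0 → Ω → ℕ) (s t : ℝ≥0) : Set Ω := incEvent N s t 0

/-- The event of at least two jumps in `(s, t]`. -/
def manyJumps (N : U → ℝ≥0 → Ω → ℕ) (s t : ℝ≥0) : Set Ω :=
  (noJump N s t ∪ ⋃ u, oneJump N s t u)ᶜ

variable {N : U → ℝ≥0 → Ω → ℕ} {s t : ℝ≥0}

lemma incEvent_disjoint {a b : U → ℕ} (h : a ≠ b) :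
    Disjoint (incEvent N s t a) (incEvent N s t b) :=
  Set.disjoint_left.2 fun ω h1 h2 => h (funext fun u => (h1 u).symm.trans (h2 u))

lemma pairwise_disjoint_oneJump : Pairwise (Function.onFun Disjoint (oneJump N s t)) :=
  fun u v huv => incEvent_disjoint fun h => by
    classical
    have := congrFun h u
    simp [Pi.single_apply, huv] at this

lemma disjoint_noJump_oneJump (u : U) : Disjoint (noJump N s t) (oneJump N s t u) :=
  incEvent_disjoint fun h => by
    classical
    have := congrFun h u
    simp at this

variable [Countable U] {ℱ : Filtration ℝ≥0 mΩ} {Q : Measure Ω} [IsProbabilityMeasure Q]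
  {ν : U → ℝ≥0}

lemma measurableSet_comap_incEvent (a : U → ℕ) :
    MeasurableSet[MeasurableSpace.comap (fun ω u => N u t ω - N u s ω) MeasurableSpace.pi]
      (incEvent N s t a) :=
  ⟨{a}, measurableSet_singleton a, by ext ω; simp [incEvent, funext_iff]⟩

namespace IsPoissonFamily

variable (hN : IsPoissonFamily ℱ Q ν N)

include hN

lemma measurable_N (u : U) (t : ℝ≥0) : Measurable (N u t) :=
  (hN.adapted u t).mono (ℱ.le t) le_rfl

lemma measurable_inc (s t : ℝ≥0) (u : U) : Measurable fun ω => N u t ω - N u s ω :=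
  (hN.measurable_N u t).sub (hN.measurable_N u s)

lemma comap_inc_le (s t : ℝ≥0) :
    MeasurableSpace.comap (fun ω u => N u t ω - N u s ω) MeasurableSpace.pi ≤ mΩ :=
  (measurable_pi_lambda _ fun u => hN.measurable_inc s t u).comap_le

lemma measurableSet_incEvent (s t : ℝ≥0) (a : U → ℕ) : MeasurableSet (incEvent N s t a) :=
  hN.comap_inc_le s t _ (measurableSet_comap_incEvent a)

lemma measurableSet_manyJumps (s t : ℝ≥0) : MeasurableSet (manyJumps N s t) :=
  ((hN.measurableSet_incEvent s t _).union
    (MeasurableSet.iUnion fun _ => hN.measurableSet_incEvent s t _)).compl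

lemma measure_inc_eq (hst : s ≤ t) (u : U) (n : ℕ) :
    Q ((fun ω => N u t ω - N u s ω) ⁻¹' {n})
      = ENNReal.ofReal (Real.exp (-(ν u * (t - s) : ℝ≥0)) * (ν u * (t - s) : ℝ≥0) ^ n
        / n.factorial) := by
  rw [← Measure.map_apply (hN.measurable_inc s t u) (measurableSet_singleton n), hN.law u s t hst,
    poissonMeasure_singleton]

lemma measure_biInter_inc (hst : s ≤ t) (a : U → ℕ) (F : Finset U) :
    Q (⋂ u ∈ F, (fun ω => N u t ω - N u s ω) ⁻¹' {a u})
      = ENNReal.ofReal (Real.exp (-∑ u ∈ F, (ν u * (t - s) : ℝ)) *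
          ∏ u ∈ F, ((ν u * (t - s) : ℝ) ^ a u / (a u).factorial)) := by
  have h1 := (hN.iIndepFun s t hst).measure_inter_preimage_eq_mul F (sets := fun u => {a u})
    (fun u _ => measurableSet_singleton _)
  rw [h1]
  simp only [hN.measure_inc_eq hst]
  rw [← ENNReal.ofReal_prod_of_nonneg (fun u _ => by positivity)]
  congr 1
  rw [← Finset.sum_neg_distrib, Real.exp_sum, ← Finset.prod_mul_distrib]
  refine Finset.prod_congr rfl fun u _ => ?_
  rw [mul_div_assoc]
  push_cast [NNReal.coe_sub hst]
  rfl

/-- Independence gives product formulas for finitely many types. Exhausting U by finite sets, each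
type outside F₀ contributes e^{-ν_u(t-s)}, and summability of the rates gives the limiting
exponential. -/
lemma measureReal_incEvent (hν : Summable ν) (hst : s ≤ t) (a : U → ℕ) (F₀ : Finset U)
    (ha : ∀ u ∉ F₀, a u = 0) :
    Q.real (incEvent N s t a) = Real.exp (-((∑' u, ν u : ℝ≥0) * (t - s) : ℝ)) *
      ∏ u ∈ F₀, ((ν u * (t - s) : ℝ) ^ a u / (a u).factorial) := by
  have hE : incEvent N s t a
      = ⋂ F : Finset U, ⋂ u ∈ F, (fun ω => N u t ω - N u s ω) ⁻¹' {a u} := by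
    ext ω
    simp only [incEvent, Set.mem_ofPred_eq, mem_iInter, mem_preimage, mem_singleton_iff]
    exact ⟨fun h F u _ => h u, fun h u => h {u} u (Finset.mem_singleton_self u)⟩
  have h1 : Tendsto (fun F : Finset U => Q (⋂ u ∈ F, (fun ω => N u t ω - N u s ω) ⁻¹' {a u})) atTop
      (𝓝 (Q (incEvent N s t a))) := by
    rw [hE]
    refine tendsto_measure_iInter_atTop (fun F => ?_) (fun F G hFG => ?_) ⟨∅, measure_ne_top _ _⟩
    · exact (Finset.measurableSet_biInter _ fun u _ =>
        hN.measurable_inc s t u (measurableSet_singleton _)).nullMeasurableSet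
    · exact biInter_subset_biInter_left hFG
  simp only [hN.measure_biInter_inc hst] at h1
  have h2 : Tendsto (fun F : Finset U => ENNReal.ofReal (Real.exp (-∑ u ∈ F, (ν u * (t - s) : ℝ)) *
      ∏ u ∈ F, ((ν u * (t - s) : ℝ) ^ a u / (a u).factorial))) atTop
      (𝓝 (ENNReal.ofReal (Real.exp (-((∑' u, ν u : ℝ≥0) * (t - s) : ℝ)) *
      ∏ u ∈ F₀, ((ν u * (t - s) : ℝ) ^ a u / (a u).factorial)))) := by
    refine ENNReal.tendsto_ofReal ?_
    refine Tendsto.mul ?_ ?_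
    · refine (Real.continuous_exp.tendsto _).comp (Tendsto.neg ?_)
      have := (NNReal.hasSum_coe.2 hν.hasSum).mul_right (t - s : ℝ)
      exact this
    · refine tendsto_const_nhds.congr' ?_
      filter_upwards [eventually_ge_atTop F₀] with F hF
      exact Finset.prod_subset hF fun u _ hu => by simp [ha u hu]
  rw [measureReal_def, tendsto_nhds_unique h1 h2, ENNReal.toReal_ofReal]
  have : 0 ≤ (t - s : ℝ) := by rw [sub_nonneg]; exact_mod_cast hst
  exact mul_nonneg (Real.exp_pos _).le (Finset.prod_nonneg fun u _ => by positivity)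

lemma measureReal_noJump (hν : Summable ν) (hst : s ≤ t) :
    Q.real (noJump N s t) = Real.exp (-((∑' u, ν u : ℝ≥0) * (t - s) : ℝ)) := by
  simpa [noJump] using hN.measureReal_incEvent hν hst 0 ∅ fun _ _ => rfl

lemma measureReal_oneJump (hν : Summable ν) (hst : s ≤ t) (u : U) :
    Q.real (oneJump N s t u)
      = ν u * (t - s) * Real.exp (-((∑' u, ν u : ℝ≥0) * (t - s) : ℝ)) := by
  classical
  have := hN.measureReal_incEvent hν hst (Pi.single u 1) {u} fun v hv => by
    simp [Finset.notMem_singleton.1 hv]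
  simp only [Finset.prod_singleton, Pi.single_eq_same, pow_one, Nat.factorial_one, Nat.cast_one,
    div_one] at this
  rw [mul_comm, ← this, oneJump]

lemma hasSum_measureReal_oneJump (hν : Summable ν) (hst : s ≤ t) :
    HasSum (fun u => Q.real (oneJump N s t u))
      ((∑' u, ν u : ℝ≥0) * (t - s) * Real.exp (-((∑' u, ν u : ℝ≥0) * (t - s) : ℝ))) := by
  simp only [hN.measureReal_oneJump hν hst]
  exact ((NNReal.hasSum_coe.2 hν.hasSum).mul_right _).mul_right _

lemma measureReal_iUnion_oneJump (hν : Summable ν) (hst : s ≤ t) :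
    Q.real (⋃ u, oneJump N s t u)
      = (∑' u, ν u : ℝ≥0) * (t - s) * Real.exp (-((∑' u, ν u : ℝ≥0) * (t - s) : ℝ)) := by
  rw [← (hN.hasSum_measureReal_oneJump hν hst).tsum_eq, measureReal_def,
    measure_iUnion pairwise_disjoint_oneJump fun u => hN.measurableSet_incEvent s t _,
    ENNReal.tsum_toReal_eq fun _ => measure_ne_top _ _]
  rfl

/-- With x = ν(t-s), the probability is 1 - (1+x)e^{-x}, and e^{-x} ≥ 1 - x bounds it by x². -/
lemma measureReal_manyJumps_le (hν : Summable ν) (hst : s ≤ t) :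
    Q.real (manyJumps N s t) ≤ ((∑' u, ν u : ℝ≥0) * (t - s) : ℝ) ^ 2 := by
  have hm : MeasurableSet (⋃ u, oneJump N s t u) :=
    MeasurableSet.iUnion fun _ => hN.measurableSet_incEvent s t _
  have hd : Disjoint (noJump N s t) (⋃ u, oneJump N s t u) :=
    disjoint_iUnion_right.2 disjoint_noJump_oneJump
  have hu : MeasurableSet (noJump N s t ∪ ⋃ u, oneJump N s t u) :=
    (hN.measurableSet_incEvent s t _).union hm
  rw [manyJumps, probReal_compl_eq_one_sub hu, measureReal_union hd hm, hN.measureReal_noJump hν hst, hN.measureReal_iUnion_oneJump hν hst]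
  set x : ℝ := ((∑' u, ν u : ℝ≥0) : ℝ) * (t - s)
  have hx : 0 ≤ x := mul_nonneg (NNReal.coe_nonneg _) (by rw [sub_nonneg]; exact_mod_cast hst)
  have := Real.add_one_le_exp (-x)
  nlinarith

/-- Increments are independent of the past, so conditioning f on them gives the constant E f. This
factorisation is the only use of probability in the short-time expansion besides the jump
probabilities. -/
lemma setIntegral_incEvent {E : Type*} [NormedAddCommGroup E] [NormedSpace ℝ E] [CompleteSpace E]
    (hst : s ≤ t) {f : Ω → E} (hf : StronglyMeasurable[ℱ s] f) (hfi : Integrable f Q) (a : U → ℕ) :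
    ∫ ω in incEvent N s t a, f ω ∂Q = Q.real (incEvent N s t a) • ∫ ω, f ω ∂Q := by
  have hle := hN.comap_inc_le s t
  have h1 := condExp_indep_eq (μ := Q) (ℱ.le s) hle hf (hN.indep_past s t hst).symm
  rw [← setIntegral_condExp hle hfi (measurableSet_comap_incEvent a),
    setIntegral_congr_ae (hN.measurableSet_incEvent s t a)
      (h1.mono fun ω hω _ => hω), setIntegral_const]

/-- Almost surely `(0, T]` splits into finitely many intervals with at most one jump each. -/
lemma ae_exists_grid (hν : Summable ν) (T : ℝ≥0) :
    ∀ᵐ ω ∂Q, ∃ M : ℕ, 0 < M ∧ ∀ i < M, ω ∉ manyJumps N (i * T / M) ((i + 1) * T / M) := by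
  rw [ae_iff]
  set lam : ℝ := ((∑' u, ν u : ℝ≥0) : ℝ)
  -- Each of M cells has two or more jumps with probability at most (λT/M)², so the union bound is
  -- (λT)²/M, which tends to 0.
  have hbd : ∀ M : ℕ, 0 < M → Q.real {ω | ¬ ∃ M : ℕ, 0 < M ∧ ∀ i < M,
      ω ∉ manyJumps N (i * T / M) ((i + 1) * T / M)} ≤ (lam * T) ^ 2 / M := by
    intro M hM
    have hM' : (0 : ℝ) < M := by exact_mod_cast hM
    calc _ ≤ Q.real (⋃ i ∈ Finset.range M, manyJumps N (i * T / M) ((i + 1) * T / M)) := by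
          refine measureReal_mono (fun ω hω => ?_) (measure_ne_top _ _)
          simp only [Set.mem_ofPred_eq, not_exists, not_and, not_forall, not_not] at hω
          obtain ⟨i, hi, h⟩ := hω M hM
          simp only [mem_iUnion, Finset.mem_range]
          exact ⟨i, hi, h⟩
      _ ≤ ∑ i ∈ Finset.range M, Q.real (manyJumps N (i * T / M) ((i + 1) * T / M)) :=
          measureReal_biUnion_finset_le _ _
      _ ≤ ∑ i ∈ Finset.range M, (lam * (T / M)) ^ 2 := by
          refine Finset.sum_le_sum fun i _ => ?_
          refine (hN.measureReal_manyJumps_le hν (by gcongr; simp)).trans (le_of_eq ?_)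
          have : (((i + 1) * T / M : ℝ≥0) : ℝ) - (i * T / M : ℝ≥0) = T / M := by
            push_cast
            ring
          rw [this]
      _ = (lam * T) ^ 2 / M := by
          simp only [Finset.sum_const, Finset.card_range, nsmul_eq_mul]
          field_simp
  have hlim : Tendsto (fun M : ℕ => (lam * T) ^ 2 / M) atTop (𝓝 0) :=
    tendsto_const_div_atTop_nhds_zero_nat _
  have h0 : Q.real {ω | ¬ ∃ M : ℕ, 0 < M ∧ ∀ i < M,
      ω ∉ manyJumps N (i * T / M) ((i + 1) * T / M)} ≤ 0 :=
    ge_of_tendsto hlim ((eventually_gt_atTop 0).mono hbd)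
  rw [← measureReal_eq_zero_iff]
  exact le_antisymm h0 measureReal_nonneg

end IsPoissonFamily

end Poisson
end

noncomputable section

open TraceClass Function

/-! ## Left limits -/

section LeftLim

lemma nhdsLT_neBot_nnreal {t : ℝ≥0} (ht : 0 < t) : (𝓝[<] t).NeBot :=
  nhdsLT_neBot_of_exists_lt ⟨0, ht⟩

lemma leftLim_eq_of_eqOn {E : Type*} [TopologicalSpace E] [T2Space E] {f g : ℝ≥0 → E} {a b : ℝ≥0}
    (hab : a < b) (h : ∀ p ∈ Ico a b, f p = g p) {l : E} (hg : Tendsto g (𝓝[<] b) (𝓝 l)) :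
    leftLim f b = l := by
  have := nhdsLT_neBot_nnreal (bot_le.trans_lt hab)
  refine leftLim_eq_of_tendsto (hg.congr' ?_)
  filter_upwards [Ico_mem_nhdsLT hab] with p hp using (h p hp).symm

lemma leftLim_eq_of_const {E : Type*} [TopologicalSpace E] [T2Space E] {f : ℝ≥0 → E} {a b : ℝ≥0}
    (hab : a < b) (h : ∀ p ∈ Ico a b, f p = f a) : leftLim f b = f a :=
  leftLim_eq_of_eqOn hab h tendsto_const_nhds

variable {E : Type*} [NormedAddCommGroup E] {f : ℝ≥0 → E}

lemma IsCadlagPath.tendsto_leftLim (hf : IsCadlagPath f) {t : ℝ≥0} (ht : 0 < t) :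
    Tendsto f (𝓝[<] t) (𝓝 (leftLim f t)) := by
  have := nhdsLT_neBot_nnreal ht
  obtain ⟨l, hl⟩ := (hf t).2
  rwa [leftLim_eq_of_tendsto hl]

/-- One-sided limits bound the path near each time, and compactness of [0, T] does the rest. -/
lemma IsCadlagPath.exists_norm_le (hf : IsCadlagPath f) (T : ℝ≥0) :
    ∃ C, ∀ t ≤ T, ‖f t‖ ≤ C := by
  have h : ∃ C, ∀ t ∈ Icc 0 T, ‖f t‖ ≤ C := by
    refine isCompact_Icc.induction_on (p := fun s => ∃ C, ∀ t ∈ s, ‖f t‖ ≤ C) ?_ ?_ ?_ ?_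
    · exact ⟨0, fun t ht => ht.elim⟩
    · rintro s t hst ⟨C, hC⟩
      exact ⟨C, fun r hr => hC r (hst hr)⟩
    · rintro s t ⟨C, hC⟩ ⟨D, hD⟩
      exact ⟨max C D, fun r hr => hr.elim (fun h => (hC r h).trans (le_max_left _ _))
        fun h => (hD r h).trans (le_max_right _ _)⟩
    · intro t _
      obtain ⟨l, hl⟩ := (hf t).2
      have h1 : ∀ᶠ s in 𝓝[<] t, ‖f s‖ < ‖l‖ + 1 := hl.norm.eventually (gt_mem_nhds (lt_add_one _))
      have h2 : ∀ᶠ s in 𝓝[≥] t, ‖f s‖ < ‖f t‖ + 1 :=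
        (hf t).1.norm.eventually (gt_mem_nhds (lt_add_one _))
      refine ⟨{s | ‖f s‖ ≤ max (‖l‖ + 1) (‖f t‖ + 1)}, mem_nhdsWithin_of_mem_nhds ?_, _, fun s hs => hs⟩
      rw [← nhdsLT_sup_nhdsGE]
      exact ⟨h1.mono fun s hs => hs.le.trans (le_max_left _ _),
        h2.mono fun s hs => hs.le.trans (le_max_right _ _)⟩
  obtain ⟨C, hC⟩ := h
  exact ⟨C, fun t ht => hC t ⟨bot_le, ht⟩⟩

lemma IsCadlagPath.exists_norm_leftLim_le (hf : IsCadlagPath f) (T : ℝ≥0) :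
    ∃ C, ∀ t ≤ T, ‖leftLim f t‖ ≤ C := by
  obtain ⟨C, hC⟩ := hf.exists_norm_le T
  refine ⟨C, fun t ht => ?_⟩
  rcases eq_or_lt_of_le (bot_le : 0 ≤ t) with rfl | h0
  · rw [leftLim_eq_of_isBot fun b => bot_le]
    exact hC 0 ht
  · have := nhdsLT_neBot_nnreal h0
    refine le_of_tendsto (hf.tendsto_leftLim h0).norm ?_
    filter_upwards [self_mem_nhdsWithin] with s hs using hC s (le_of_lt (lt_of_lt_of_le hs ht))

lemma IsCadlagPath.stronglyMeasurable_leftLim (hf : IsCadlagPath f) :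
    StronglyMeasurable (leftLim f) := by
  -- For t > 0 this is the last point strictly before t of the grid of mesh 1/(k+1), so the values
  -- of f there approach the left limit. At t = 0 truncated subtraction gives 0, in agreement with
  -- the convention for the left limit.
  set q : ℕ → ℝ≥0 → ℝ≥0 := fun k t => ((⌈(k + 1) * t⌉₊ - 1 : ℕ) : ℝ≥0) / (k + 1) with hq
  have hmeas : ∀ k, StronglyMeasurable fun t => f (q k t) := fun k => by
    have h1 : StronglyMeasurable fun m : ℕ => f (((m - 1 : ℕ) : ℝ≥0) / (k + 1)) :=
      StronglyMeasurable.of_discrete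
    exact h1.comp_measurable (Nat.measurable_ceil.comp (measurable_const_mul ((k : ℝ≥0) + 1)))
  refine stronglyMeasurable_of_tendsto atTop hmeas (tendsto_pi_nhds.2 fun t => ?_)
  rcases eq_or_lt_of_le (bot_le : 0 ≤ t) with rfl | h0
  · rw [leftLim_eq_of_isBot fun b => bot_le]
    simp [hq]
  · refine (hf.tendsto_leftLim h0).comp (tendsto_nhdsWithin_iff.2 ⟨?_, Eventually.of_forall fun k => ?_⟩)
    · rw [← NNReal.tendsto_coe]
      have hlim : Tendsto (fun k : ℕ => (t : ℝ) - 1 / (k + 1)) atTop (𝓝 (t - 0)) :=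
        tendsto_const_nhds.sub tendsto_one_div_add_atTop_nhds_zero_nat
      rw [sub_zero] at hlim
      refine tendsto_of_tendsto_of_tendsto_of_le_of_le hlim tendsto_const_nhds (fun k => ?_)
        fun k => ?_
      all_goals
        have hk : (0 : ℝ) < (k : ℝ) + 1 := by positivity
        have hpos : 0 < ⌈((k : ℝ≥0) + 1) * t⌉₊ := Nat.ceil_pos.2 (mul_pos (by positivity) h0)
        have h1 : ((⌈((k : ℝ≥0) + 1) * t⌉₊ - 1 : ℕ) : ℝ) = (⌈((k : ℝ≥0) + 1) * t⌉₊ : ℝ) - 1 := by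
          rw [Nat.cast_sub hpos, Nat.cast_one]
        have h2 : ((k : ℝ) + 1) * t ≤ ⌈((k : ℝ≥0) + 1) * t⌉₊ := by
          have := Nat.le_ceil (((k : ℝ≥0) + 1) * t)
          exact_mod_cast this
        have h3 : (⌈((k : ℝ≥0) + 1) * t⌉₊ : ℝ) < ((k : ℝ) + 1) * t + 1 := by
          have := Nat.ceil_lt_add_one (bot_le : 0 ≤ ((k : ℝ≥0) + 1) * t)
          exact_mod_cast this
        simp only [hq, NNReal.coe_div, NNReal.coe_natCast, NNReal.coe_add, NNReal.coe_one, h1]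
      · rw [le_div_iff₀ hk, sub_mul, one_div, inv_mul_cancel₀ hk.ne']; linarith
      · rw [div_le_iff₀ hk]; linarith
    · have hpos : 0 < ⌈((k : ℝ≥0) + 1) * t⌉₊ := Nat.ceil_pos.2 (mul_pos (by positivity) h0)
      rw [mem_Iio, hq, div_lt_iff₀ (by positivity), mul_comm t, ← Nat.lt_ceil]
      exact Nat.sub_lt hpos one_pos

lemma IsCadlagPath.intervalIntegrable_leftLim (hf : IsCadlagPath f) {a b : ℝ} (hab : a ≤ b) :
    IntervalIntegrable (fun r : ℝ => leftLim f r.toNNReal) volume a b := by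
  obtain ⟨C, hC⟩ := hf.exists_norm_leftLim_le b.toNNReal
  rw [intervalIntegrable_iff_integrableOn_Ioc_of_le hab]
  refine Measure.integrableOn_of_bounded (M := C) (by simp)
    (hf.stronglyMeasurable_leftLim.comp_measurable measurable_real_toNNReal).aestronglyMeasurable ?_
  refine (ae_restrict_iff' measurableSet_Ioc).2 (Eventually.of_forall fun r hr => ?_)
  exact hC _ (Real.toNNReal_le_toNNReal hr.2)

end LeftLim

/-! ## Counting paths -/

section Counting

variable {U : Type*}

/-- Counting paths with, up to time `T`, finitely many jumps and no simultaneous ones. -/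
structure IsCountingPath (n : U → ℝ≥0 → ℕ) (T : ℝ≥0) : Prop where
  mono : ∀ u, Monotone (n u)
  cadlag : ∀ u, IsCadlagPath (n u)
  grid : ∃ M : ℕ, 0 < M ∧ ∀ i < M, (∀ u, n u ((i + 1) * T / M) = n u (i * T / M)) ∨
    ∃ u, n u ((i + 1) * T / M) = n u (i * T / M) + 1 ∧
      ∀ v ≠ u, n v ((i + 1) * T / M) = n v (i * T / M)

/-- There is exactly one jump in `(a, b]`; it is of type `u` and takes place at `b`. -/
structure JumpEnd (n : U → ℝ≥0 → ℕ) (a b : ℝ≥0) (u : U) : Prop where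
  lt : a < b
  before : ∀ p ∈ Ico a b, ∀ v, n v p = n v a
  jump : n u b = n u a + 1
  other : ∀ v ≠ u, n v b = n v a

variable {n : U → ℝ≥0 → ℕ} {T : ℝ≥0}

namespace IsCountingPath

lemma const_of_le (hn : IsCountingPath n T) {a b p q : ℝ≥0} (h : ∀ u, n u b = n u a) (hap : a ≤ p)
    (hpq : p ≤ q) (hqb : q ≤ b) (u : U) : n u q = n u p :=
  le_antisymm (by
    calc n u q ≤ n u b := hn.mono u hqb
      _ = n u a := h u
      _ ≤ n u p := hn.mono u hap) (hn.mono u hpq)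

/-- The time of a single jump. -/
lemma exists_jumpEnd (hn : IsCountingPath n T) {a b : ℝ≥0} {u : U} (hu : n u b = n u a + 1)
    (hv : ∀ v ≠ u, n v b = n v a) (hab : a ≤ b) :
    ∃ r, a < r ∧ r ≤ b ∧ JumpEnd n a r u ∧ ∀ v, n v b = n v r := by
  set S := {p | a ≤ p ∧ n u p = n u a + 1}
  have hbS : b ∈ S := ⟨hab, hu⟩
  set r := sInf S
  have har : a ≤ r := le_csInf ⟨b, hbS⟩ fun p hp => hp.1
  have hrb : r ≤ b := csInf_le (OrderBot.bddBelow _) hbS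
  have hle : ∀ p, a ≤ p → p ≤ b → n u p = n u a ∨ n u p = n u a + 1 := fun p hp hpb => by
    have h1 := hn.mono u hp
    have h2 := hn.mono u hpb
    omega
  -- The infimum is attained: by right continuity into a discrete space, the path is constant just
  -- after r.
  have hr1 : n u r = n u a + 1 := by
    have hc : Tendsto (n u) (𝓝[≥] r) (𝓝 (n u r)) := ((hn.cadlag u) r).1
    rw [nhds_discrete, tendsto_pure] at hc
    obtain ⟨c, hc1, hc2⟩ := mem_nhdsGE_iff_exists_Ico_subset.1 hc
    obtain ⟨p, hpS, hpc⟩ := exists_lt_of_csInf_lt ⟨b, hbS⟩ hc1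
    have hp : n u p = n u r := hc2 ⟨csInf_le (OrderBot.bddBelow _) hpS, hpc⟩
    rw [← hp]; exact hpS.2
  have har' : a < r := lt_of_le_of_ne har fun h => by rw [← h] at hr1; omega
  have hother : ∀ v ≠ u, ∀ p, a ≤ p → p ≤ b → n v p = n v a := fun v hvu p hp hpb => by
    have h1 := hn.mono v hp
    have h2 := hn.mono v hpb
    have := hv v hvu
    omega
  refine ⟨r, har', hrb, ⟨har', fun p hp v => ?_, hr1, fun v hvu => hother v hvu r har hrb⟩, fun v => ?_⟩
  · by_cases hvu : v = u
    · subst hvu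
      rcases hle p hp.1 (hp.2.le.trans hrb) with h | h
      · exact h
      · exact absurd (csInf_le (OrderBot.bddBelow _) (show p ∈ S from ⟨hp.1, h⟩)) (not_le.2 hp.2)
    · exact hother v hvu p hp.1 (hp.2.le.trans hrb)
  · by_cases hvu : v = u
    · subst hvu; rw [hu, hr1]
    · rw [hv v hvu, hother v hvu r har hrb]

/-- Induction over the jumps. -/
theorem chain (hn : IsCountingPath n T) {P : ℝ≥0 → ℝ≥0 → Prop}
    (trans : ∀ a b c, a ≤ b → b ≤ c → c ≤ T → P a b → P b c → P a c)
    (const : ∀ a b, a ≤ b → b ≤ T → (∀ u, n u b = n u a) → P a b)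
    (jump : ∀ a b u, b ≤ T → JumpEnd n a b u → P a b) {a b : ℝ≥0} (hab : a ≤ b) (hb : b ≤ T) :
    P a b := by
  obtain ⟨M, hM, hg⟩ := hn.grid
  have hM' : (0 : ℝ≥0) < M := by exact_mod_cast hM
  -- Inside a grid cell there is at most one jump; the interval is cut at its time into a jump piece
  -- and a constant piece. The cells are then joined by induction in `main`.
  have cell : ∀ i < M, ∀ a b, a ≤ b → b ≤ T → i * T / M ≤ a → b ≤ (i + 1) * T / M → P a b := by
    intro i hi a b hab hb ha hbi
    by_cases hc : ∀ u, n u b = n u a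
    · exact const a b hab hb hc
    push Not at hc
    obtain ⟨w, hw⟩ := hc
    have hle : ∀ v, n v (i * T / M) ≤ n v a ∧ n v a ≤ n v b ∧ n v b ≤ n v ((i + 1) * T / M) :=
      fun v => ⟨hn.mono v ha, hn.mono v hab, hn.mono v hbi⟩
    rcases hg i hi with h | ⟨u, h1, h2⟩
    · have := hle w
      have := h w
      omega
    · have hv : ∀ v ≠ u, n v b = n v a := fun v hv => by
        have := hle v
        have := h2 v hv
        omega
      have hwu : w = u := by
        by_contra hwu
        exact hw (hv w hwu)
      subst hwu
      have hu : n w b = n w a + 1 := by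
        have := hle w
        omega
      obtain ⟨r, har, hrb, hj, hr⟩ := hn.exists_jumpEnd hu hv hab
      exact trans a r b har.le hrb hb (jump a r w (hrb.trans hb) hj) (const r b hrb hb hr)
  have main : ∀ i ≤ M, ∀ b, a ≤ b → b ≤ T → b ≤ i * T / M → P a b := by
    intro i
    induction i with
    | zero =>
      intro _ b hab hb hbi
      have hb0 : b = 0 := by simpa using hbi
      subst hb0
      have : a = 0 := le_antisymm hab bot_le
      subst this
      exact const 0 0 le_rfl hb fun _ => rfl
    | succ i ih =>
      intro hi b hab hb hbi
      push_cast at hbi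
      by_cases h1 : b ≤ i * T / M
      · exact ih (by omega) b hab hb h1
      by_cases h2 : i * T / M ≤ a
      · exact cell i hi a b hab hb h2 hbi
      · push Not at h1 h2
        exact trans a _ b h2.le h1.le hb (ih (by omega) _ h2.le (h1.le.trans hb) le_rfl)
          (cell i hi _ b h1.le hb le_rfl hbi)
  refine main M le_rfl b hab hb (hb.trans (le_of_eq ?_))
  field_simp

/-- The jumps in `(a, b]`. -/
def jumps (n : U → ℝ≥0 → ℕ) (a b : ℝ≥0) : Set (U × ℝ≥0) :=
  {p | p.2 ∈ Ioc a b ∧ n p.1 p.2 - leftLim (n p.1) p.2 ≠ 0}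

lemma jumps_of_const (hn : IsCountingPath n T) {a b : ℝ≥0} (h : ∀ u, n u b = n u a) :
    jumps n a b = ∅ := by
  refine eq_empty_of_forall_notMem fun ⟨u, p⟩ ⟨hp, hj⟩ => hj ?_
  simp only at hp ⊢
  rw [leftLim_eq_of_const hp.1 fun q hq =>
    hn.const_of_le h le_rfl hq.1 (hq.2.le.trans hp.2) u,
    hn.const_of_le h le_rfl hp.1.le hp.2 u, Nat.sub_self]

lemma sub_leftLim_of_jumpEnd {a b : ℝ≥0} {u : U} (h : JumpEnd n a b u) :
    n u b - leftLim (n u) b = 1 := by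
  rw [leftLim_eq_of_const h.lt fun q hq => h.before q hq u, h.jump]; omega

lemma jumps_of_jumpEnd {a b : ℝ≥0} {u : U} (h : JumpEnd n a b u) : jumps n a b = {(u, b)} := by
  ext ⟨v, p⟩
  simp only [jumps, Set.mem_ofPred_eq, mem_singleton_iff, Prod.mk.injEq]
  constructor
  · rintro ⟨hp, hj⟩
    have hlim : leftLim (n v) p = n v a :=
      leftLim_eq_of_const hp.1 fun q hq => h.before q ⟨hq.1, hq.2.trans_le hp.2⟩ v
    rcases eq_or_lt_of_le hp.2 with rfl | hpb
    · refine ⟨by_contra fun hvu => hj ?_, rfl⟩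
      rw [hlim, h.other v hvu, Nat.sub_self]
    · rw [hlim, h.before p ⟨hp.1.le, hpb⟩ v, Nat.sub_self] at hj
      exact absurd rfl hj
  · rintro ⟨rfl, rfl⟩
    exact ⟨⟨h.lt, le_rfl⟩, by rw [sub_leftLim_of_jumpEnd h]; exact one_ne_zero⟩

lemma finite_jumps (hn : IsCountingPath n T) {a b : ℝ≥0} (hab : a ≤ b) (hb : b ≤ T) :
    (jumps n a b).Finite := by
  refine hn.chain (P := fun a b => (jumps n a b).Finite) (fun a b c _ _ _ h1 h2 => ?_)
    (fun a b _ _ h => ?_) (fun a b u _ h => ?_) hab hb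
  · refine (h1.union h2).subset fun p hp => ?_
    rcases le_or_gt p.2 b with h | h
    · exact Or.inl ⟨⟨hp.1.1, h⟩, hp.2⟩
    · exact Or.inr ⟨⟨h, hp.1.2⟩, hp.2⟩
  · rw [hn.jumps_of_const h]; exact finite_empty
  · rw [jumps_of_jumpEnd h]; exact finite_singleton _

/-- Only finitely many counts are positive. -/
lemma finite_ne (hn : IsCountingPath n T) {a b : ℝ≥0} (hab : a ≤ b) (hb : b ≤ T) :
    {u | n u b ≠ n u a}.Finite := by
  refine hn.chain (P := fun a b => {u | n u b ≠ n u a}.Finite) (fun a b c _ _ _ h1 h2 => ?_)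
    (fun a b _ _ h => ?_) (fun a b u _ h => ?_) hab hb
  · refine (h1.union h2).subset fun u hu => ?_
    by_contra hc
    simp only [mem_union, Set.mem_ofPred_eq, not_or, not_not] at hc
    exact hu (hc.2.trans hc.1)
  · simp [h]
  · refine (finite_singleton u).subset fun v hv => ?_
    by_contra hc
    exact hv (h.other v hc)

variable {M : Type*} [AddCommMonoid M]

/-- Finiteness of the jump set is essential: a `finsum` with infinite support is zero and does not
split. -/
lemma jumpIntegral_eq_add (hn : IsCountingPath n T) (f : U → ℝ≥0 → M) {a b : ℝ≥0} (hab : a ≤ b)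
    (hb : b ≤ T) : jumpIntegral n f b = jumpIntegral n f a +
      ∑ᶠ p ∈ jumps n a b, (n p.1 p.2 - leftLim (n p.1) p.2) • f p.1 p.2 := by
  set g : U × ℝ≥0 → M := fun p => (n p.1 p.2 - leftLim (n p.1) p.2) • f p.1 p.2
  have hsupp : ∀ c d, {p : U × ℝ≥0 | p.2 ∈ Ioc c d} ∩ support g ⊆ jumps n c d := fun c d p hp =>
    ⟨hp.1, fun h0 => hp.2 (by simp [g, h0])⟩
  have hunion : {p : U × ℝ≥0 | p.2 ∈ Ioc 0 b}
      = {p | p.2 ∈ Ioc 0 a} ∪ {p | p.2 ∈ Ioc a b} := by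
    ext p
    have := Ioc_union_Ioc_eq_Ioc (zero_le : 0 ≤ a) hab
    simp only [mem_union, Set.mem_ofPred_eq]
    rw [← this]
    rfl
  have hdis : Disjoint {p : U × ℝ≥0 | p.2 ∈ Ioc 0 a} {p | p.2 ∈ Ioc a b} :=
    Set.disjoint_left.2 fun p h1 h2 => not_lt.2 h1.2 h2.1
  unfold jumpIntegral
  rw [hunion, finsum_mem_union' hdis
    ((hn.finite_jumps bot_le (hab.trans hb)).subset (hsupp 0 a))
    ((hn.finite_jumps hab hb).subset (hsupp a b))]
  congr 1
  refine finsum_mem_inter_support_eq g _ _ (Subset.antisymm ?_ ?_)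
  · exact fun p hp => ⟨hsupp a b hp, hp.2⟩
  · exact fun p hp => ⟨hp.1.1, hp.2⟩

lemma jumpIntegral_of_const (hn : IsCountingPath n T) (f : U → ℝ≥0 → M) {a b : ℝ≥0} (hab : a ≤ b)
    (hb : b ≤ T) (h : ∀ u, n u b = n u a) : jumpIntegral n f b = jumpIntegral n f a := by
  rw [hn.jumpIntegral_eq_add f hab hb, hn.jumps_of_const h, finsum_mem_empty, add_zero]

lemma jumpIntegral_of_jumpEnd (hn : IsCountingPath n T) (f : U → ℝ≥0 → M) {a b : ℝ≥0} {u : U}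
    (hb : b ≤ T) (h : JumpEnd n a b u) :
    jumpIntegral n f b = jumpIntegral n f a + f u b := by
  rw [hn.jumpIntegral_eq_add f h.lt.le hb, jumps_of_jumpEnd h, finsum_mem_singleton,
    sub_leftLim_of_jumpEnd h, one_smul]

end IsCountingPath

end Counting
end

noncomputable section

open TraceClass Function

/-! ## Pathwise evolution -/

section Paths

variable {s : ℕ} {U D₁ D₂ : Type*} {𝓗 : Type v} [NormedAddCommGroup 𝓗] [InnerProductSpace ℂ 𝓗]
  [CompleteSpace 𝓗]

namespace HybridWalk

open Classical in
/-- The position after a count of type `u` at `x`. -/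
def move (W : HybridWalk s U D₁ D₂ 𝓗) (u : U) (x : EuclideanSpace ℝ (Fin s)) :
    EuclideanSpace ℝ (Fin s) :=
  if x ∈ W.F u then W.y u x else x

lemma move_mem {W : HybridWalk s U D₁ D₂ 𝓗} (u : U) {x : EuclideanSpace ℝ (Fin s)} (hx : x ∈ W.V) :
    W.move u x ∈ W.V := by
  rw [move]
  split_ifs with h
  · exact W.y_mem u x h
  · exact hx

lemma add_indicator_eq_move {W : HybridWalk s U D₁ D₂ 𝓗} (u : U) (x : EuclideanSpace ℝ (Fin s)) :
    x + (W.F u).indicator (fun x => W.y u x - x) x = W.move u x := by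
  by_cases h : x ∈ W.F u <;> simp [move, h]

/-- On `S`, the generators and the jump maps are bounded by `C`. -/
def BoundedOn (W : HybridWalk s U D₁ D₂ 𝓗) (S : Set (EuclideanSpace ℝ (Fin s))) (C : ℝ≥0) : Prop :=
  ∀ x ∈ S, x ∈ W.V ∧ ‖W.gen x + (W.totalRate : ℂ) • 1‖ ≤ C ∧ 4 * ‖W.R x‖ ≤ C

/-- The generator between jumps, including the compensation of the total rate. -/
def driftL (W : HybridWalk s U D₁ D₂ 𝓗) (x : EuclideanSpace ℝ (Fin s)) :
    TraceClass 𝓗 →L[ℂ] TraceClass 𝓗 :=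
  W.gen x + (W.totalRate : ℂ) • 1

end HybridWalk

variable {W : HybridWalk s U D₁ D₂ 𝓗} {n : U → ℝ≥0 → ℕ} {T : ℝ≥0}
  {x : ℝ≥0 → EuclideanSpace ℝ (Fin s)} {σ : ℝ≥0 → TraceClass 𝓗}

/-- The evolution of position and state along a counting path. -/
structure IsEvolution (W : HybridWalk s U D₁ D₂ 𝓗) (n : U → ℝ≥0 → ℕ) (T : ℝ≥0)
    (x : ℝ≥0 → EuclideanSpace ℝ (Fin s)) (σ : ℝ≥0 → TraceClass 𝓗) : Prop where
  counting : IsCountingPath n T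
  mem : ∀ t ≤ T, x t ∈ W.V
  const : ∀ a b, a ≤ b → b ≤ T → (∀ u, n u b = n u a) →
    x b = x a ∧ σ b = flow (W.driftL (x a)) (b - a) (σ a)
  jump : ∀ a b u, b ≤ T → JumpEnd n a b u → x b = W.move u (x a) ∧
    σ b = (W.ν u : ℂ)⁻¹ • W.jumpL (x a) u (flow (W.driftL (x a)) (b - a) (σ a))

section Walk

variable (hn : IsCountingPath n T)
  (hx : ∀ t, x t = x 0 + jumpIntegral n
      (fun u r => (W.F u).indicator (fun x => W.y u x - x) (leftLim x r)) t)

include hn hx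

lemma walk_const {a b : ℝ≥0} (hab : a ≤ b) (hb : b ≤ T) (h : ∀ u, n u b = n u a) : x b = x a := by
  rw [hx b, hx a, hn.jumpIntegral_of_const _ hab hb h]

lemma walk_eqOn_of_jumpEnd {a b : ℝ≥0} {u : U} (hb : b ≤ T) (h : JumpEnd n a b u) :
    ∀ p ∈ Ico a b, x p = x a := fun p hp =>
  walk_const hn hx hp.1 (hp.2.le.trans hb) (h.before p hp)

lemma walk_jump {a b : ℝ≥0} {u : U} (hb : b ≤ T) (h : JumpEnd n a b u) : x b = W.move u (x a) := by
  rw [hx b, hn.jumpIntegral_of_jumpEnd _ hb h, ← add_assoc, ← hx a,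
    leftLim_eq_of_const h.lt (walk_eqOn_of_jumpEnd hn hx hb h), HybridWalk.add_indicator_eq_move]

lemma walk_mem (h0 : x 0 ∈ W.V) {t : ℝ≥0} (ht : t ≤ T) : x t ∈ W.V :=
  hn.chain (P := fun a b => x a ∈ W.V → x b ∈ W.V) (fun _ _ _ _ _ _ h1 h2 h => h2 (h1 h))
    (fun a b hab hb h ha => by rwa [walk_const hn hx hab hb h])
    (fun a b u hb h ha => by
      rw [walk_jump hn hx hb h]
      exact HybridWalk.move_mem u ha) bot_le ht h0

end Walk

/-- The drift term of the stochastic master equation along a path. -/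
def pathDrift (W : HybridWalk s U D₁ D₂ 𝓗) (x : ℝ≥0 → EuclideanSpace ℝ (Fin s))
    (σ : ℝ≥0 → TraceClass 𝓗) (r : ℝ) : TraceClass 𝓗 :=
  W.L₀ (leftLim x r.toNNReal) (leftLim σ r.toNNReal)
    - (1 / 2 : ℂ) • anticommutator (W.R (leftLim x r.toNNReal) - (W.totalRate : ℂ) • 1)
      (leftLim σ r.toNNReal)

/-- Only left limits of the position enter, so the endpoint b is included even if the walker moves
there. -/
lemma pathDrift_eq {a b : ℝ≥0} (hxc : ∀ p ∈ Ico a b, x p = x a) (ha : x a ∈ W.V) {r : ℝ}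
    (hr : r ∈ Ioc (a : ℝ) b) :
    pathDrift W x σ r = W.driftL (x a) (leftLim σ r.toNNReal) := by
  have hr1 : a < r.toNNReal := Real.lt_toNNReal_iff_coe_lt.2 hr.1
  have hr2 : r.toNNReal ≤ b := Real.toNNReal_le_iff_le_coe.2 hr.2
  rw [pathDrift, leftLim_eq_of_const hr1 fun q hq => hxc q ⟨hq.1, hq.2.trans_le hr2⟩]
  exact HybridWalk.drift_eq ha _

lemma intervalIntegrable_pathDrift_of_const (hσ : IsCadlagPath σ) {a b : ℝ≥0} (hab : a ≤ b)
    (hxc : ∀ p ∈ Ico a b, x p = x a) (ha : x a ∈ W.V) :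
    IntervalIntegrable (pathDrift W x σ) volume a b := by
  have h1 := hσ.intervalIntegrable_leftLim (NNReal.coe_le_coe.2 hab)
  rw [intervalIntegrable_iff_integrableOn_Ioc_of_le (NNReal.coe_le_coe.2 hab)] at h1 ⊢
  have h2 : IntegrableOn (fun r : ℝ => W.driftL (x a) (leftLim σ r.toNNReal)) (Ioc a b) volume :=
    (W.driftL (x a)).integrable_comp h1
  exact h2.congr_fun (fun r hr => (pathDrift_eq hxc ha hr).symm) measurableSet_Ioc

section State

variable (hn : IsCountingPath n T) (h0 : x 0 ∈ W.V)
  (hx : ∀ t, x t = x 0 + jumpIntegral n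
      (fun u r => (W.F u).indicator (fun x => W.y u x - x) (leftLim x r)) t)
  (hσ : IsCadlagPath σ)
  (hσe : ∀ t : ℝ≥0, σ t = σ 0 + (∫ r in (0 : ℝ)..t, pathDrift W x σ r)
      + jumpIntegral n (fun u r => W.jumpMap (leftLim x r) u (leftLim σ r) - leftLim σ r) t)

include hn h0 hx hσ

/-- Integrability is not assumed in the equation. It follows piece by piece, because on each piece
the drift is a fixed bounded map applied to a bounded measurable left-limit path. -/
lemma intervalIntegrable_pathDrift {a b : ℝ≥0} (hab : a ≤ b) (hb : b ≤ T) :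
    IntervalIntegrable (pathDrift W x σ) volume a b := by
  refine hn.chain (P := fun a b => IntervalIntegrable (pathDrift W x σ) volume a b)
    (fun _ _ _ _ _ _ h1 h2 => h1.trans h2) (fun a b hab hb h => ?_) (fun a b u hb h => ?_) hab hb
  · exact intervalIntegrable_pathDrift_of_const hσ hab (fun p hp =>
      walk_const hn hx hp.1 (hp.2.le.trans hb) fun u => hn.const_of_le h le_rfl hp.1 hp.2.le u)
      (walk_mem hn hx h0 (hab.trans hb))
  · exact intervalIntegrable_pathDrift_of_const hσ h.lt.le (walk_eqOn_of_jumpEnd hn hx hb h)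
      (walk_mem hn hx h0 (h.lt.le.trans hb))

include hσe

lemma state_eq_add {a b : ℝ≥0} (hab : a ≤ b) (hb : b ≤ T) :
    σ b = σ a + (∫ r in (a : ℝ)..b, pathDrift W x σ r)
      + (jumpIntegral n (fun u r => W.jumpMap (leftLim x r) u (leftLim σ r) - leftLim σ r) b
        - jumpIntegral n (fun u r => W.jumpMap (leftLim x r) u (leftLim σ r) - leftLim σ r) a) := by
  have h1 := intervalIntegral.integral_add_adjacent_intervals
    (intervalIntegrable_pathDrift hn h0 hx hσ (a := 0) bot_le (hab.trans hb))
    (intervalIntegrable_pathDrift hn h0 hx hσ hab hb)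
  rw [NNReal.coe_zero] at h1
  rw [hσe b, ← h1, hσe a]
  abel

lemma state_const {a b : ℝ≥0} (hab : a ≤ b) (hb : b ≤ T) (h : ∀ u, n u b = n u a) :
    σ b = flow (W.driftL (x a)) (b - a) (σ a) := by
  have hab' : (a : ℝ) ≤ b := NNReal.coe_le_coe.2 hab
  set f : ℝ → TraceClass 𝓗 := fun r => σ r.toNNReal with hf
  have hxc : ∀ p ∈ Ico a b, x p = x a := fun p hp =>
    walk_const hn hx hp.1 (hp.2.le.trans hb) fun u => hn.const_of_le h le_rfl hp.1 hp.2.le u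
  have hint := intervalIntegrable_pathDrift hn h0 hx hσ hab hb
  have heq : ∀ r ∈ Icc (a : ℝ) b, f r = f a + ∫ p in (a : ℝ)..r, pathDrift W x σ p := by
    intro r hr
    have hr0 : 0 ≤ r := a.2.trans hr.1
    lift r to ℝ≥0 using hr0
    have har : a ≤ r := NNReal.coe_le_coe.1 hr.1
    have hrb : r ≤ b := NNReal.coe_le_coe.1 hr.2
    have h1 := state_eq_add hn h0 hx hσ hσe har (hrb.trans hb)
    rw [hn.jumpIntegral_of_const _ har (hrb.trans hb)
      fun u => hn.const_of_le h le_rfl har hrb u, sub_self, add_zero] at h1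
    simpa [hf] using h1
  -- Without counts the state is a constant plus a primitive, hence continuous; so its left limits
  -- in the drift are its values, and ODE uniqueness applies.
  have hcont : ContinuousOn f (Icc a b) := by
    have h1 := intervalIntegral.continuousOn_primitive_interval' hint left_mem_uIcc
    rw [uIcc_of_le hab'] at h1
    exact (continuousOn_const.add h1).congr heq
  have hleft : ∀ r ∈ Ioc (a : ℝ) b, leftLim σ r.toNNReal = f r := by
    intro r hr
    have hr0 : 0 ≤ r := a.2.trans hr.1.le
    lift r to ℝ≥0 using hr0
    have har : a < r := NNReal.coe_lt_coe.1 hr.1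
    have hrb : r ≤ b := NNReal.coe_le_coe.1 hr.2
    rw [Real.toNNReal_coe]
    refine leftLim_eq_of_eqOn har (g := fun p : ℝ≥0 => f p) (fun p _ => by simp [hf]) ?_
    have h2 : Tendsto (fun p : ℝ≥0 => (p : ℝ)) (𝓝[<] r) (𝓝[Icc (a : ℝ) b] (r : ℝ)) := by
      refine tendsto_nhdsWithin_iff.2 ⟨(NNReal.continuous_coe.tendsto r).mono_left
        nhdsWithin_le_nhds, ?_⟩
      filter_upwards [Ico_mem_nhdsLT har] with p hp
      exact ⟨NNReal.coe_le_coe.2 hp.1, NNReal.coe_le_coe.2 (hp.2.le.trans hrb)⟩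
    exact (hcont r ⟨hr.1.le, hr.2⟩).tendsto.comp h2
  have := eq_flow_of_integral_eq hab' hcont (G := W.driftL (x a)) fun r hr => by
    rw [heq r hr]
    congr 1
    refine intervalIntegral.integral_congr_ae (Eventually.of_forall fun p hp => ?_)
    rw [uIoc_of_le hr.1] at hp
    have hp' : p ∈ Ioc (a : ℝ) b := ⟨hp.1, hp.2.trans hr.2⟩
    rw [pathDrift_eq hxc (walk_mem hn hx h0 (hab.trans hb)) hp', hleft p hp']
  simpa [hf] using this

/-- The left limit at b is computed twice: by the flow up to b, and from the integral equation with
the jump omitted. The jump term 𝒥[σ(b-)] - σ(b-) then replaces σ(b-) by 𝒥[σ(b-)]. -/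
lemma state_jump {a b : ℝ≥0} {u : U} (hb : b ≤ T) (h : JumpEnd n a b u) :
    σ b = (W.ν u : ℂ)⁻¹ • W.jumpL (x a) u (flow (W.driftL (x a)) (b - a) (σ a)) := by
  have hab := h.lt.le
  have hab' : (a : ℝ) ≤ b := NNReal.coe_le_coe.2 hab
  have ha := walk_mem hn hx h0 (hab.trans hb)
  have hflow : leftLim σ b = flow (W.driftL (x a)) (b - a) (σ a) := by
    refine leftLim_eq_of_eqOn h.lt (g := fun p : ℝ≥0 => flow (W.driftL (x a)) (p - a) (σ a))
      (fun p hp => state_const hn h0 hx hσ hσe hp.1 (hp.2.le.trans hb) (h.before p hp)) ?_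
    have hc : Continuous fun p : ℝ≥0 => flow (W.driftL (x a)) (p - a) (σ a) :=
      ((continuous_flow _).comp (NNReal.continuous_coe.sub continuous_const)).clm_apply
        continuous_const
    exact (hc.tendsto b).mono_left nhdsWithin_le_nhds
  have hint := intervalIntegrable_pathDrift hn h0 hx hσ hab hb
  have hleft : leftLim σ b = σ a + ∫ p in (a : ℝ)..b, pathDrift W x σ p := by
    refine leftLim_eq_of_eqOn h.lt
      (g := fun r : ℝ≥0 => σ a + ∫ p in (a : ℝ)..r, pathDrift W x σ p) (fun r hr => ?_) ?_
    · have h1 := state_eq_add hn h0 hx hσ hσe hr.1 (hr.2.le.trans hb)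
      rwa [hn.jumpIntegral_of_const _ hr.1 (hr.2.le.trans hb) (h.before r hr), sub_self,
        add_zero] at h1
    · have h1 := intervalIntegral.continuousOn_primitive_interval' hint left_mem_uIcc
      rw [uIcc_of_le hab'] at h1
      have h2 : Tendsto (fun p : ℝ≥0 => (p : ℝ)) (𝓝[<] b) (𝓝[Icc (a : ℝ) b] (b : ℝ)) := by
        refine tendsto_nhdsWithin_iff.2 ⟨(NNReal.continuous_coe.tendsto b).mono_left
          nhdsWithin_le_nhds, ?_⟩
        filter_upwards [Ico_mem_nhdsLT h.lt] with p hp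
        exact ⟨NNReal.coe_le_coe.2 hp.1, NNReal.coe_le_coe.2 hp.2.le⟩
      exact tendsto_const_nhds.add ((h1 b (right_mem_Icc.2 hab')).tendsto.comp h2)
  have h1 := state_eq_add hn h0 hx hσ hσe hab hb
  rw [hn.jumpIntegral_of_jumpEnd _ hb h, add_sub_cancel_left, ← hleft, add_sub_cancel,
    leftLim_eq_of_const h.lt (walk_eqOn_of_jumpEnd hn hx hb h), hflow,
    HybridWalk.jumpMap_eq ha] at h1
  exact h1

theorem isEvolution : IsEvolution W n T x σ where
  counting := hn
  mem _ ht := walk_mem hn hx h0 ht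
  const _ _ hab hb h := ⟨walk_const hn hx hab hb h, state_const hn h0 hx hσ hσe hab hb h⟩
  jump _ _ _ hb h := ⟨walk_jump hn hx hb h, state_jump hn h0 hx hσ hσe hb h⟩

end State

namespace IsEvolution

variable (h : IsEvolution W n T x σ)

include h

lemma isPos {a b : ℝ≥0} (hab : a ≤ b) (hb : b ≤ T) (ha : IsPos (σ a)) : IsPos (σ b) := by
  refine h.counting.chain (P := fun a b => IsPos (σ a) → IsPos (σ b))
    (fun _ _ _ _ _ _ h1 h2 h => h2 (h1 h)) (fun a b hab hb hc ha => ?_) (fun a b u hb hj ha => ?_)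
    hab hb ha
  · rw [(h.const a b hab hb hc).2]
    exact HybridWalk.flow_isPos (sub_nonneg.2 (NNReal.coe_le_coe.2 hab)) ha
  · rw [(h.jump a b u hb hj).2, ← Complex.ofReal_inv]
    exact (HybridWalk.jumpL_isPos u (HybridWalk.flow_isPos
      (sub_nonneg.2 (NNReal.coe_le_coe.2 hj.lt.le)) ha)).smul (by positivity)

lemma eq_move {a b : ℝ≥0} {u : U} (hab : a ≤ b) (hb : b ≤ T) (hu : n u b = n u a + 1)
    (hv : ∀ v ≠ u, n v b = n v a) : x b = W.move u (x a) := by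
  obtain ⟨r, har, hrb, hj, hr⟩ := h.counting.exists_jumpEnd hu hv hab
  rw [(h.const r b hrb hb hr).1, (h.jump a r u (hrb.trans hb) hj).1]

variable {S : Set (EuclideanSpace ℝ (Fin s))} {C : ℝ≥0} (hS : W.BoundedOn S C)
  (hxS : ∀ t ≤ T, x t ∈ S)

include hS hxS

lemma norm_jump_le {a : ℝ≥0} (ha : a ≤ T) (u : U) {κ : ℝ} (hκ : C / W.ν u ≤ κ) (ρ : TraceClass 𝓗) :
    ‖(W.ν u : ℂ)⁻¹ • W.jumpL (x a) u ρ‖ ≤ κ * ‖ρ‖ := by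
  have h1 := HybridWalk.norm_jumpL_le (hS _ (hxS a ha)).1 u
  have h2 := (hS _ (hxS a ha)).2.2
  rw [norm_smul, norm_inv]
  have h3 : ‖((W.ν u : ℝ) : ℂ)‖ = W.ν u := by simp
  rw [h3]
  calc _ ≤ (W.ν u : ℝ)⁻¹ * (C * ‖ρ‖) := by
        gcongr
        exact ContinuousLinearMap.le_of_opNorm_le _ (h1.trans h2) ρ
    _ = C / W.ν u * ‖ρ‖ := by ring
    _ ≤ κ * ‖ρ‖ := by gcongr

/-- The flow contributes the exponential and each count a factor κ ≥ C/ν_u. Such a κ need not exist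
over all types at once, whence the restriction to a finite F. -/
lemma norm_le {F : Finset U} {κ : ℝ} (hκ1 : 1 ≤ κ) (hκ : ∀ u ∈ F, C / W.ν u ≤ κ) {a b : ℝ≥0}
    (hab : a ≤ b) (hb : b ≤ T) (hF : ∀ u ∉ F, n u b = n u a) :
    ‖σ b‖ ≤ Real.exp ((b - a) * C) * κ ^ (∑ u ∈ F, n u b - ∑ u ∈ F, n u a) * ‖σ a‖ := by
  have hmono : ∀ a b, a ≤ b → ∑ u ∈ F, n u a ≤ ∑ u ∈ F, n u b := fun a b hab =>
    Finset.sum_le_sum fun u _ => h.counting.mono u hab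
  refine h.counting.chain (P := fun a b => (∀ u ∉ F, n u b = n u a) →
    ‖σ b‖ ≤ Real.exp ((b - a) * C) * κ ^ (∑ u ∈ F, n u b - ∑ u ∈ F, n u a) * ‖σ a‖)
    (fun a b c hab hbc _ h1 h2 hF => ?_) (fun a b hab hb hc _ => ?_) (fun a b u hb hj hF => ?_)
    hab hb hF
  · have hF1 : ∀ u ∉ F, n u b = n u a := fun u hu =>
      le_antisymm ((h.counting.mono u hbc).trans (hF u hu).le) (h.counting.mono u hab)
    have hF2 : ∀ u ∉ F, n u c = n u b := fun u hu => (hF u hu).trans (hF1 u hu).symm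
    calc ‖σ c‖ ≤ Real.exp ((c - b) * C) * κ ^ (∑ u ∈ F, n u c - ∑ u ∈ F, n u b) *
          (Real.exp ((b - a) * C) * κ ^ (∑ u ∈ F, n u b - ∑ u ∈ F, n u a) * ‖σ a‖) := by
          refine (h2 hF2).trans ?_
          gcongr
          exact h1 hF1
      _ = (Real.exp ((c - b) * C) * Real.exp ((b - a) * C)) *
          (κ ^ (∑ u ∈ F, n u c - ∑ u ∈ F, n u b) * κ ^ (∑ u ∈ F, n u b - ∑ u ∈ F, n u a)) * ‖σ a‖ := by
          ring
      _ = _ := by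
          rw [← Real.exp_add, ← pow_add]
          congr 3
          · ring
          · have := hmono a b hab
            have := hmono b c hbc
            congr 1
            omega
  · rw [(h.const a b hab hb hc).2, Finset.sum_congr rfl fun u _ => hc u, Nat.sub_self, pow_zero,
      mul_one]
    exact norm_flow_apply_le (hS _ (hxS a (hab.trans hb))).2.1
      (sub_nonneg.2 (NNReal.coe_le_coe.2 hab)) _
  · classical
    have huF : u ∈ F := by
      by_contra huF
      have := hF u huF
      have := hj.jump
      omega
    have hab := hj.lt.le
    have hsum : ∑ v ∈ F, n v b - ∑ v ∈ F, n v a = 1 := by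
      have : ∑ v ∈ F, n v b = ∑ v ∈ F, n v a + 1 := by
        rw [← Finset.add_sum_erase _ _ huF, ← Finset.add_sum_erase _ (fun v => n v a) huF, hj.jump,
          Finset.sum_congr rfl fun v hv => hj.other v (Finset.ne_of_mem_erase hv)]
        ring
      omega
    rw [(h.jump a b u hb hj).2, hsum, pow_one]
    refine (h.norm_jump_le hS hxS (hab.trans hb) u (hκ u huF) _).trans ?_
    have h1 := norm_flow_apply_le (G := W.driftL (x a)) (c := C) (hS _ (hxS a (hab.trans hb))).2.1
      (sub_nonneg.2 (NNReal.coe_le_coe.2 hab)) (σ a)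
    calc _ ≤ κ * (Real.exp ((b - a) * C) * ‖σ a‖) := by gcongr
      _ = _ := by ring

/-- The jump time inside the interval is unknown, but the flows before and after it differ from the
identity by O(b - a). -/
lemma norm_sub_jump_le {a b : ℝ≥0} {u : U} {κ : ℝ} (hκ : C / W.ν u ≤ κ) (hab : a ≤ b)
    (hb : b ≤ T) (hab1 : (b - a : ℝ) ≤ 1) (hu : n u b = n u a + 1) (hv : ∀ v ≠ u, n v b = n v a) :
    ‖σ b - (W.ν u : ℂ)⁻¹ • W.jumpL (x a) u (σ a)‖
      ≤ (b - a) * (2 * κ * C * Real.exp (2 * C)) * ‖σ a‖ := by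
  obtain ⟨r, har, hrb, hj, hr⟩ := h.counting.exists_jumpEnd hu hv hab
  have ha := hab.trans hb
  have hκ0 : 0 ≤ κ := le_trans (by positivity) hκ
  have har' : 0 ≤ (r - a : ℝ) := sub_nonneg.2 (NNReal.coe_le_coe.2 har.le)
  have hrb' : 0 ≤ (b - r : ℝ) := sub_nonneg.2 (NNReal.coe_le_coe.2 hrb)
  set Jm := (W.ν u : ℂ)⁻¹ • W.jumpL (x a) u with hJm
  have hJ : ∀ ρ, ‖Jm ρ‖ ≤ κ * ‖ρ‖ := h.norm_jump_le hS hxS ha u hκ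
  have hσr : σ r = Jm (flow (W.driftL (x a)) (r - a) (σ a)) := (h.jump a r u (hrb.trans hb) hj).2
  have hexp : ∀ t : ℝ, t ≤ 1 → Real.exp (t * C) ≤ Real.exp C := fun t ht =>
    Real.exp_le_exp.2 (mul_le_of_le_one_left C.2 ht)
  have e1 : Real.exp ((b - r) * C) ≤ Real.exp C := hexp _ (by linarith)
  have e2 : Real.exp ((r - a) * C) ≤ Real.exp C := hexp _ (by linarith)
  have h1 : ‖σ b - σ r‖ ≤ (b - r) * C * Real.exp C * ‖σ r‖ := by
    rw [(h.const r b hrb hb hr).2]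
    refine (norm_flow_apply_sub_le (hS _ (hxS r (hrb.trans hb))).2.1 hrb' _).trans ?_
    gcongr
  have h2 : ‖σ r‖ ≤ κ * (Real.exp C * ‖σ a‖) := by
    rw [hσr]
    refine (hJ _).trans ?_
    gcongr
    refine (norm_flow_apply_le (hS _ (hxS a ha)).2.1 har' _).trans ?_
    gcongr
  have h3 : ‖σ r - Jm (σ a)‖ ≤ κ * ((r - a) * C * Real.exp C * ‖σ a‖) := by
    rw [hσr, ← map_sub]
    refine (hJ _).trans ?_
    gcongr
    refine (norm_flow_apply_sub_le (hS _ (hxS a ha)).2.1 har' _).trans ?_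
    gcongr
  have hE : 1 ≤ Real.exp C := Real.one_le_exp C.2
  have hEE : Real.exp (2 * C) = Real.exp C * Real.exp C := by rw [← Real.exp_add]; ring_nf
  have hl1 : (b - r : ℝ) ≤ b - a := by linarith
  have hl2 : (r - a : ℝ) ≤ b - a := by linarith
  have hl3 : ‖σ a‖ ≤ Real.exp C * ‖σ a‖ := le_mul_of_one_le_left (norm_nonneg _) hE
  have hab' : 0 ≤ (b - a : ℝ) := by linarith
  calc ‖σ b - Jm (σ a)‖ = ‖(σ b - σ r) + (σ r - Jm (σ a))‖ := by rw [sub_add_sub_cancel]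
    _ ≤ (b - r) * C * Real.exp C * (κ * (Real.exp C * ‖σ a‖))
        + κ * ((r - a) * C * Real.exp C * ‖σ a‖) := by
      refine (norm_add_le _ _).trans (add_le_add (h1.trans ?_) h3)
      gcongr
    _ ≤ (b - a) * C * Real.exp C * (κ * (Real.exp C * ‖σ a‖))
        + κ * ((b - a) * C * Real.exp C * (Real.exp C * ‖σ a‖)) := by
      gcongr
    _ = _ := by rw [hEE]; ring

end IsEvolution

end Paths
end

noncomputable section

open TraceClass Function

/-! ## Almost sure properties of the paths -/

section AlmostSure

lemma IsCountingPath.exists_const_right {U : Type*} {n : U → ℝ≥0 → ℕ} {T : ℝ≥0}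
    (hn : IsCountingPath n T) {a b : ℝ≥0} (hab : a < b) (hb : b ≤ T) :
    ∃ c, a < c ∧ c ≤ b ∧ ∀ u, n u c = n u a := by
  refine hn.chain (P := fun a b => a < b → ∃ c, a < c ∧ c ≤ b ∧ ∀ u, n u c = n u a)
    (fun a b c hab hbc _ h1 h2 hac => ?_) (fun a b _ _ h hab => ⟨b, hab, le_rfl, h⟩)
    (fun a b u _ h hab => ?_) hab.le hb hab
  · rcases eq_or_lt_of_le hab with rfl | hab
    · exact h2 hac
    · obtain ⟨r, h1, h2, h3⟩ := h1 hab
      exact ⟨r, h1, h2.trans hbc, h3⟩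
  · obtain ⟨c, hac, hcb⟩ := exists_between hab
    exact ⟨c, hac, hcb.le, h.before c ⟨hac.le, hcb⟩⟩

variable {s : ℕ} {U D₁ D₂ : Type*} {𝓗 : Type v} [NormedAddCommGroup 𝓗] [InnerProductSpace ℂ 𝓗]
  [CompleteSpace 𝓗] {Ω : Type*} {mΩ : MeasurableSpace Ω}

/-- The vertices visited with positive probability at some time in `[0, T]`. -/
def HybridWalk.reachable (W : HybridWalk s U D₁ D₂ 𝓗) (Q : Measure Ω)
    (X : ℝ≥0 → Ω → EuclideanSpace ℝ (Fin s)) (T : ℝ≥0) : Set (EuclideanSpace ℝ (Fin s)) :=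
  {x | x ∈ W.V ∧ ∃ t ≤ T, Q {ω | X t ω = x} ≠ 0}

/-- The properties that hold for almost every path. -/
structure IsRegularPath (W : HybridWalk s U D₁ D₂ 𝓗) (S : Set (EuclideanSpace ℝ (Fin s)))
    (n : U → ℝ≥0 → ℕ) (T : ℝ≥0) (x : ℝ≥0 → EuclideanSpace ℝ (Fin s)) (σ : ℝ≥0 → TraceClass 𝓗) :
    Prop where
  evolution : IsEvolution W n T x σ
  zero : ∀ u, n u 0 = 0
  mem : ∀ t ≤ T, x t ∈ S
  pos : IsPos (σ 0)
  norm : ‖σ 0‖ = 1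

variable {Q : Measure Ω} {ℱ : Filtration ℝ≥0 mΩ}
  {W : HybridWalk s U D₁ D₂ 𝓗} {N : U → ℝ≥0 → Ω → ℕ} {X : ℝ≥0 → Ω → EuclideanSpace ℝ (Fin s)}
  {ρ₀ : EuclideanSpace ℝ (Fin s) → TraceClass 𝓗} {σ : ℝ≥0 → Ω → TraceClass 𝓗}

lemma IsClassicalWalk.measurableSet_eq (hX : IsClassicalWalk W ℱ Q N X) (t : ℝ≥0)
    (x : EuclideanSpace ℝ (Fin s)) : MeasurableSet[ℱ t] {ω | X t ω = x} :=
  (hX.adapted t).measurable (measurableSet_singleton x)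

variable [Countable U] [IsProbabilityMeasure Q]

lemma IsPoissonFamily.ae_isCountingPath {ν : U → ℝ≥0} (hN : IsPoissonFamily ℱ Q ν N)
    (hν : Summable ν) (T : ℝ≥0) : ∀ᵐ ω ∂Q, IsCountingPath (fun u t => N u t ω) T := by
  filter_upwards [hN.monotone, hN.cadlag, hN.ae_exists_grid hν T] with ω h1 h2 h3
  refine ⟨h1, h2, ?_⟩
  obtain ⟨M, hM, hg⟩ := h3
  refine ⟨M, hM, fun i hi => ?_⟩
  have hle : ∀ u, N u (i * T / M) ω ≤ N u ((i + 1) * T / M) ω := fun u =>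
    h1 u (by gcongr; simp)
  have h := hg i hi
  simp only [manyJumps, mem_compl_iff, not_not, mem_union, mem_iUnion] at h
  rcases h with h | ⟨u, h⟩
  · refine Or.inl fun u => ?_
    have h4 := h u
    have h5 := hle u
    simp only [Pi.zero_apply] at h4
    show N u ((i + 1) * T / M) ω = N u (i * T / M) ω
    omega
  · classical
    refine Or.inr ⟨u, ?_, fun v hv => ?_⟩
    · have h4 := h u
      have h5 := hle u
      simp only [Pi.single_eq_same] at h4
      show N u ((i + 1) * T / M) ω = N u (i * T / M) ω + 1
      omega
    · have h4 := h v
      have h5 := hle v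
      simp only [Pi.single_eq_of_ne hv] at h4
      show N v ((i + 1) * T / M) ω = N v (i * T / M) ω
      omega

variable (hN : IsPoissonFamily ℱ Q W.ν N) (hX : IsClassicalWalk W ℱ Q N X)

include hN hX

lemma ae_isEvolution (hσ : IsLinearSMESolution W ℱ Q N X ρ₀ σ) (T : ℝ≥0) :
    ∀ᵐ ω ∂Q, IsEvolution W (fun u t => N u t ω) T (fun t => X t ω) (fun t => σ t ω) := by
  filter_upwards [hN.ae_isCountingPath W.ν_summable T, hX.init, hX.equation, hσ.cadlag, hσ.equation]
    with ω h1 h2 h3 h4 h5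
  exact isEvolution h1 h2 h3 h4 h5

lemma ae_walk_const (T : ℝ≥0) : ∀ᵐ ω ∂Q, ∀ a b, a ≤ b → b ≤ T → (∀ u, N u b ω = N u a ω) →
    ∀ p ∈ Icc a b, X p ω = X a ω := by
  filter_upwards [hN.ae_isCountingPath W.ν_summable T, hX.equation] with ω h1 h3
  intro a b _ hb hc p hp
  exact walk_const (x := fun t => X t ω) h1 h3 hp.1 (hp.2.trans hb) fun u =>
    h1.const_of_le hc le_rfl hp.1 hp.2 u

lemma ae_walk_mem_V (T : ℝ≥0) : ∀ᵐ ω ∂Q, ∀ t ≤ T, X t ω ∈ W.V := by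
  filter_upwards [hN.ae_isCountingPath W.ν_summable T, hX.init, hX.equation] with ω h1 h2 h3
  intro t ht
  exact walk_mem (x := fun t => X t ω) h1 h3 h2 ht

lemma ae_walk_mem_reachable_of_le {T t : ℝ≥0} (ht : t ≤ T) :
    ∀ᵐ ω ∂Q, X t ω ∈ W.reachable Q X T := by
  have h1 : ∀ᵐ ω ∂Q, ∀ x ∈ W.V, X t ω = x → x ∈ W.reachable Q X T := by
    refine (ae_ball_iff W.V_countable).2 fun x hx => ?_
    by_cases h : Q {ω | X t ω = x} = 0
    · have : ∀ᵐ ω ∂Q, X t ω ≠ x := by simpa [ae_iff] using h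
      filter_upwards [this] with ω hω h' using absurd h' hω
    · exact Eventually.of_forall fun ω _ => ⟨hx, t, ht, h⟩
  filter_upwards [h1, ae_walk_mem_V hN hX T] with ω h1 h2
  exact h1 _ (h2 t ht) rfl

/-- For a single time this is a countable union of null sets. It extends to all times at once
through a countable dense set, since each time t < T is followed by an interval of constancy; T
itself is treated separately. -/
lemma ae_walk_mem_reachable (T : ℝ≥0) : ∀ᵐ ω ∂Q, ∀ t ≤ T, X t ω ∈ W.reachable Q X T := by
  obtain ⟨D, hDc, hD⟩ := TopologicalSpace.exists_countable_dense ℝ≥0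
  have h1 : ∀ᵐ ω ∂Q, ∀ q ∈ D, q ≤ T → X q ω ∈ W.reachable Q X T := by
    refine (ae_ball_iff hDc).2 fun q _ => ?_
    by_cases hq : q ≤ T
    · filter_upwards [ae_walk_mem_reachable_of_le hN hX hq] with ω hω _ using hω
    · exact Eventually.of_forall fun ω h => absurd h hq
  filter_upwards [h1, ae_walk_mem_reachable_of_le hN hX (le_refl T),
    hN.ae_isCountingPath W.ν_summable T, ae_walk_const hN hX T] with ω h1 h2 h3 h4 t ht
  rcases eq_or_lt_of_le ht with rfl | ht
  · exact h2
  · obtain ⟨c, hc1, hc2, hc3⟩ := h3.exists_const_right ht le_rfl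
    obtain ⟨q, hqD, hq1, hq2⟩ := hD.exists_between hc1
    rw [← h4 t c hc1.le hc2 hc3 q ⟨hq1.le, hq2.le⟩]
    exact h1 q hqD (hq2.le.trans hc2)

/-- A walker at x at time t makes no count in (t, t+1] with positive probability, by independence of
the past. On that event the time integral up to T + 1 contains ‖A x‖ over an interval of length one,
so a positive-probability event forces the bound. -/
lemma enorm_le_essSup_of_reachable {G : Type*} [NormedAddCommGroup G]
    (A : EuclideanSpace ℝ (Fin s) → G) {T : ℝ≥0} {x : EuclideanSpace ℝ (Fin s)}
    (hx : x ∈ W.reachable Q X T) :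
    ‖A x‖ₑ ≤ essSup (fun ω => ∫⁻ r in Ioc (0 : ℝ) (T + 1 : ℝ≥0),
      ‖A (leftLim (fun r' => X r' ω) r.toNNReal)‖ₑ) Q := by
  obtain ⟨-, t, htT, hQ⟩ := hx
  have ht1 : t ≤ t + 1 := le_self_add
  have hpos : Q ({ω | X t ω = x} ∩ noJump N t (t + 1)) ≠ 0 := by
    rw [inter_comm, noJump, (Indep_iff _ _ _).1 (hN.indep_past t (t + 1) ht1) _ _
      (measurableSet_comap_incEvent 0) (hX.measurableSet_eq t x)]
    refine mul_ne_zero (fun h0 => ?_) hQ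
    have h2 := hN.measureReal_noJump W.ν_summable ht1
    rw [measureReal_def, noJump, h0, ENNReal.toReal_zero] at h2
    exact (Real.exp_pos _).ne h2
  have hae : ∀ᵐ ω ∂Q, ω ∈ {ω | X t ω = x} ∩ noJump N t (t + 1) → ‖A x‖ₑ ≤
      essSup (fun ω => ∫⁻ r in Ioc (0 : ℝ) (T + 1 : ℝ≥0),
      ‖A (leftLim (fun r' => X r' ω) r.toNNReal)‖ₑ) Q := by
    filter_upwards [ENNReal.ae_le_essSup (μ := Q) fun ω => ∫⁻ r in Ioc (0 : ℝ) (T + 1 : ℝ≥0),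
      ‖A (leftLim (fun r' => X r' ω) r.toNNReal)‖ₑ, hN.monotone, ae_walk_const hN hX (T + 1)]
      with ω h1 h2 h3 hω
    refine le_trans ?_ h1
    have hc : ∀ p ∈ Icc t (t + 1), X p ω = X t ω := by
      refine h3 t (t + 1) ht1 (by gcongr) fun u => ?_
      have h4 := hω.2 u
      have h5 := h2 u ht1
      simp only [Pi.zero_apply] at h4
      simp only at h5
      omega
    have hxt : X t ω = x := hω.1
    calc ‖A x‖ₑ = ∫⁻ _ in Ioc (t : ℝ) (t + 1 : ℝ≥0), ‖A x‖ₑ := by simp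
      _ = ∫⁻ r in Ioc (t : ℝ) (t + 1 : ℝ≥0),
          ‖A (leftLim (fun r' => X r' ω) r.toNNReal)‖ₑ := by
        refine setLIntegral_congr_fun measurableSet_Ioc fun r hr => ?_
        have hr1 : t < r.toNNReal := Real.lt_toNNReal_iff_coe_lt.2 hr.1
        have hr2 : r.toNNReal ≤ t + 1 := Real.toNNReal_le_iff_le_coe.2 hr.2
        rw [leftLim_eq_of_const hr1 fun q hq => hc q ⟨hq.1, hq.2.le.trans hr2⟩, hxt]
      _ ≤ _ := by
        refine lintegral_mono_set (Ioc_subset_Ioc t.2 ?_)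
        exact NNReal.coe_le_coe.2 (by gcongr)
  by_contra hcon
  exact hpos (measure_mono_null (fun ω hω (h : _ → _) => hcon (h hω)) (ae_iff.1 hae))

lemma exists_boundedOn_reachable (hB : HasBoundedCoefficients W Q X) (T : ℝ≥0) :
    ∃ C, W.BoundedOn (W.reachable Q X T) C := by
  have key : ∀ A : EuclideanSpace ℝ (Fin s) → 𝓗 →L[ℂ] 𝓗,
      essSup (fun ω => ∫⁻ r in Ioc (0 : ℝ) (T + 1 : ℝ≥0),
        ‖A (leftLim (fun r' => X r' ω) r.toNNReal)‖ₑ) Q < ⊤ →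
      ∃ c : ℝ≥0, ∀ x ∈ W.reachable Q X T, ‖A x‖ ≤ c := by
    intro A hA
    refine ⟨(essSup (fun ω => ∫⁻ r in Ioc (0 : ℝ) (T + 1 : ℝ≥0),
        ‖A (leftLim (fun r' => X r' ω) r.toNNReal)‖ₑ) Q).toNNReal, fun x hx => ?_⟩
    have h1 := ENNReal.toNNReal_mono hA.ne (enorm_le_essSup_of_reachable hN hX A hx)
    rw [← coe_nnnorm]
    exact NNReal.coe_le_coe.2 (by simpa using h1)
  obtain ⟨c₁, h₁⟩ := key W.H (hB.H _)
  obtain ⟨c₂, h₂⟩ := key W.R (hB.R _)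
  obtain ⟨c₃, h₃⟩ := key W.R₀ (hB.R₀ _)
  set c := c₁ + c₂ + c₃ with hc
  have l1 : (c₁ : ℝ) ≤ c := by rw [hc]; push_cast; linarith [c₂.2, c₃.2]
  have l2 : (c₂ : ℝ) ≤ c := by rw [hc]; push_cast; linarith [c₁.2, c₃.2]
  have l3 : (c₃ : ℝ) ≤ c := by rw [hc]; push_cast; linarith [c₁.2, c₂.2]
  -- The 8 comes from `norm_gen_le`, the total rate from the compensator.
  refine ⟨8 * c + W.totalRate, fun x hx => ⟨hx.1, ?_, ?_⟩⟩
  · have h4 := HybridWalk.norm_gen_le hx.1 ((h₁ x hx).trans l1) ((h₂ x hx).trans l2)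
      ((h₃ x hx).trans l3)
    have h5 : ‖(W.totalRate : ℂ) • (1 : TraceClass 𝓗 →L[ℂ] TraceClass 𝓗)‖ ≤ W.totalRate := by
      rw [norm_smul]
      have : ‖((W.totalRate : ℝ) : ℂ)‖ = W.totalRate := by simp
      rw [this]
      exact mul_le_of_le_one_right W.totalRate.2 ContinuousLinearMap.norm_id_le
    refine (norm_add_le _ _).trans ?_
    push_cast
    exact add_le_add h4 h5
  · have := (h₂ x hx).trans l2
    push_cast
    linarith [W.totalRate.2, c.2]

theorem ae_isRegularPath (hρ₀ : ∀ x ∈ W.V, IsStatisticalOperator (ρ₀ x))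
    (hσ : IsLinearSMESolution W ℱ Q N X ρ₀ σ) (T : ℝ≥0) :
    ∀ᵐ ω ∂Q, IsRegularPath W (W.reachable Q X T) (fun u t => N u t ω) T (fun t => X t ω)
      (fun t => σ t ω) := by
  filter_upwards [ae_isEvolution hN hX hσ T, hN.zero, ae_walk_mem_reachable hN hX T, hσ.init]
    with ω h1 h2 h3 h4
  have h5 := hρ₀ _ (h1.mem 0 bot_le)
  have h6 : IsPos (σ 0 ω) := by rw [h4]; exact h5.1
  refine ⟨h1, h2, h3, h6, ?_⟩
  have h7 := h6.trace_eq_norm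
  rw [h4, h5.2] at h7
  rw [h4]
  exact_mod_cast h7.symm

end AlmostSure
end

noncomputable section

open TraceClass Function

/-! ## Short-time expansion of expectations -/

section Expansion

variable {Ω U G : Type*} {mΩ : MeasurableSpace Ω} [Countable U] {ℱ : Filtration ℝ≥0 mΩ}
  {Q : Measure Ω} [IsProbabilityMeasure Q] {ν : U → ℝ≥0} {N : U → ℝ≥0 → Ω → ℕ}
  [NormedAddCommGroup G] [NormedSpace ℝ G] [CompleteSpace G]

lemma abs_exp_neg_mul_one_add_sub_one_le {x : ℝ} (hx : 0 ≤ x) :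
    |Real.exp (-x) * (1 + x) - 1| ≤ x ^ 2 := by
  have h1 := Real.add_one_le_exp (-x)
  have h2 : Real.exp (-x) * (1 + x) ≤ 1 := by
    rw [Real.exp_neg, inv_mul_le_iff₀ (Real.exp_pos x), mul_one]
    linarith [Real.add_one_le_exp x]
  rw [abs_le]
  constructor <;> nlinarith

lemma abs_exp_neg_sub_one_le {x : ℝ} (hx : 0 ≤ x) : |Real.exp (-x) - 1| ≤ x := by
  have h1 := Real.add_one_le_exp (-x)
  have h2 : Real.exp (-x) ≤ 1 := Real.exp_le_one_iff.2 (by linarith)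
  rw [abs_le]
  constructor <;> linarith

/-- Comparison of an expectation at time `t` with its short-time expansion at time `s`. -/
theorem IsPoissonFamily.norm_integral_sub_le (hN : IsPoissonFamily ℱ Q ν N) (hν : Summable ν)
    (hνpos : ∀ u, 0 < ν u) {s t : ℝ≥0} (hst : s ≤ t) {φ f g : Ω → G} {j : U → Ω → G} {F : Finset U}
    (hφ : Integrable φ Q) (hf : StronglyMeasurable[ℱ s] f) (hfi : Integrable f Q)
    (hg : StronglyMeasurable[ℱ s] g) (hgi : Integrable g Q)
    (hj : ∀ u, StronglyMeasurable[ℱ s] (j u)) (hji : ∀ u, Integrable (j u) Q)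
    {k₁ k₂ k₃ d₁ d₂ : ℝ} (hk₁ : 0 ≤ k₁) (hk₂ : 0 ≤ k₂)
    (hZ : ∀ᵐ ω ∂Q, ω ∈ noJump N s t →
      ‖φ ω - (f ω + (t - s : ℝ) • (g ω + ((∑' u, ν u : ℝ≥0) : ℝ) • f ω))‖ ≤ k₁ * (t - s) ^ 2)
    (hO : ∀ᵐ ω ∂Q, ∀ u ∈ F, ω ∈ oneJump N s t u → ‖φ ω - (ν u : ℝ)⁻¹ • j u ω‖ ≤ k₂ * (t - s))
    (hO' : ∀ᵐ ω ∂Q, ∀ u ∉ F, ω ∈ oneJump N s t u → φ ω = 0)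
    (hM : ∀ᵐ ω ∂Q, ‖φ ω‖ ≤ k₃) (hd₁ : ‖∫ ω, f ω ∂Q‖ ≤ d₁)
    (hd₂ : ‖∫ ω, g ω ∂Q + ∑ u ∈ F, ∫ ω, j u ω ∂Q‖ ≤ d₂) :
    ‖∫ ω, φ ω ∂Q - ∫ ω, f ω ∂Q - (t - s : ℝ) • (∫ ω, g ω ∂Q + ∑ u ∈ F, ∫ ω, j u ω ∂Q)‖
      ≤ (k₁ + (∑' u, ν u : ℝ≥0) * k₂ + (∑' u, ν u : ℝ≥0) ^ 2 * k₃ + (∑' u, ν u : ℝ≥0) ^ 2 * d₁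
          + (∑' u, ν u : ℝ≥0) * d₂) * (t - s) ^ 2 := by
  set lam : ℝ := ((∑' u, ν u : ℝ≥0) : ℝ) with hlam
  set h : ℝ := (t - s : ℝ) with hh
  have hlam0 : 0 ≤ lam := NNReal.coe_nonneg _
  have hh0 : 0 ≤ h := sub_nonneg.2 (NNReal.coe_le_coe.2 hst)
  have hk₃ : 0 ≤ k₃ := by
    obtain ⟨ω, hω⟩ := hM.exists
    exact (norm_nonneg _).trans hω
  have hZm : MeasurableSet (noJump N s t) := hN.measurableSet_incEvent s t _
  have hOm : ∀ u, MeasurableSet (oneJump N s t u) := fun u => hN.measurableSet_incEvent s t _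
  have hUm : MeasurableSet (⋃ u, oneJump N s t u) := MeasurableSet.iUnion hOm
  have hMm : MeasurableSet (manyJumps N s t) := hN.measurableSet_manyJumps s t
  set a : Ω → G := fun ω => f ω + h • (g ω + lam • f ω) with ha
  have ham : StronglyMeasurable[ℱ s] a := hf.add ((hg.add (hf.const_smul _)).const_smul _)
  have hai : Integrable a Q := hfi.add ((hgi.add (hfi.smul _)).smul _)
  have hjm : ∀ u, StronglyMeasurable[ℱ s] fun ω => (ν u : ℝ)⁻¹ • j u ω :=
    fun u => (hj u).const_smul _
  have hji' : ∀ u, Integrable (fun ω => (ν u : ℝ)⁻¹ • j u ω) Q := fun u => (hji u).smul _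
  -- The leading-order model of φ: first-order drift without jumps, one jump map after a single
  -- count of a type in F, and zero otherwise.
  set V : Ω → G := fun ω => (noJump N s t).indicator a ω
    + ∑ u ∈ F, (oneJump N s t u).indicator (fun ω => (ν u : ℝ)⁻¹ • j u ω) ω with hV
  have hVi : Integrable V Q := (hai.indicator hZm).add
    (integrable_finsetSum _ fun u _ => (hji' u).indicator (hOm u))
  have hVint : ∫ ω, V ω ∂Q = Real.exp (-(lam * h)) • (∫ ω, f ω ∂Q + h • (∫ ω, g ω ∂Q
      + lam • ∫ ω, f ω ∂Q)) + ∑ u ∈ F, (h * Real.exp (-(lam * h))) • ∫ ω, j u ω ∂Q := by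
    rw [integral_add (hai.indicator hZm)
      (integrable_finsetSum _ fun u _ => (hji' u).indicator (hOm u)),
      integral_finsetSum _ fun u _ => (hji' u).indicator (hOm u), integral_indicator hZm, noJump,
      hN.setIntegral_incEvent hst ham hai]
    congr 1
    · rw [← noJump, hN.measureReal_noJump hν hst]
      congr 1
      have e1 : Integrable (fun ω => lam • f ω) Q := hfi.smul _
      have e2 : Integrable (fun ω => g ω + lam • f ω) Q := hgi.add e1
      have e3 : Integrable (fun ω => h • (g ω + lam • f ω)) Q := e2.smul _
      rw [ha, integral_add hfi e3, integral_smul, integral_add hgi e1, integral_smul]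
    · refine Finset.sum_congr rfl fun u _ => ?_
      have hνu : (ν u : ℝ) ≠ 0 := NNReal.coe_ne_zero.2 (hνpos u).ne'
      rw [integral_indicator (hOm u), oneJump, hN.setIntegral_incEvent hst (hjm u) (hji' u),
        ← oneJump, hN.measureReal_oneJump hν hst, integral_smul, smul_smul]
      congr 1
      rw [mul_comm, ← mul_assoc, ← mul_assoc, inv_mul_cancel₀ hνu, one_mul]
  -- Three errors, all O(h²) in the mean: k₁h² outright, k₂h on an event of probability at most νh,
  -- and k₃ on one of probability at most (νh)².
  have herr : ∀ᵐ ω ∂Q, ‖φ ω - V ω‖ ≤ k₁ * h ^ 2 + (⋃ u, oneJump N s t u).indicator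
      (fun _ => k₂ * h) ω + (manyJumps N s t).indicator (fun _ => k₃) ω := by
    filter_upwards [hZ, hO, hO', hM] with ω hZ hO hO' hM
    have p1 : 0 ≤ k₁ * h ^ 2 := by positivity
    have p2 : 0 ≤ (⋃ u, oneJump N s t u).indicator (fun _ => k₂ * h) ω :=
      indicator_nonneg (fun _ _ => by positivity) _
    have p3 : 0 ≤ (manyJumps N s t).indicator (fun _ => k₃) ω :=
      indicator_nonneg (fun _ _ => hk₃) _
    by_cases hz : ω ∈ noJump N s t
    · have : V ω = a ω := by
        rw [hV]
        simp only
        rw [indicator_of_mem hz, Finset.sum_eq_zero, add_zero]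
        exact fun u _ => indicator_of_notMem
          (fun hu => disjoint_left.1 (disjoint_noJump_oneJump u) hz hu) _
      rw [this]
      linarith [hZ hz]
    by_cases ho : ω ∈ ⋃ u, oneJump N s t u
    · obtain ⟨u, hu⟩ := mem_iUnion.1 ho
      have hne : ∀ v ≠ u, ω ∉ oneJump N s t v := fun v hv hωv =>
        disjoint_left.1 (pairwise_disjoint_oneJump hv) hωv hu
      rw [indicator_of_mem ho] at p2 ⊢
      by_cases huF : u ∈ F
      · have : V ω = (ν u : ℝ)⁻¹ • j u ω := by
          rw [hV]
          simp only
          rw [indicator_of_notMem hz, zero_add, Finset.sum_eq_single u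
            (fun v _ hv => indicator_of_notMem (hne v hv) _) (fun h => absurd huF h),
            indicator_of_mem hu]
        rw [this]
        linarith [hO u huF hu]
      · have : V ω = 0 := by
          rw [hV]
          simp only
          rw [indicator_of_notMem hz, zero_add]
          refine Finset.sum_eq_zero fun v hv => indicator_of_notMem (hne v ?_) _
          rintro rfl
          exact huF hv
        rw [this, hO' u huF hu, sub_zero, norm_zero]
        linarith
    · have hm : ω ∈ manyJumps N s t := fun h => h.elim hz ho
      have : V ω = 0 := by
        rw [hV]
        simp only
        rw [indicator_of_notMem hz, zero_add]
        exact Finset.sum_eq_zero fun v _ => indicator_of_notMem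
          (fun hv => ho (mem_iUnion.2 ⟨v, hv⟩)) _
      rw [this, sub_zero, indicator_of_mem hm]
      linarith
  have hE1 : ‖∫ ω, φ ω ∂Q - ∫ ω, V ω ∂Q‖ ≤ k₁ * h ^ 2 + lam * h * (k₂ * h) + (lam * h) ^ 2 * k₃ := by
    rw [← integral_sub hφ hVi]
    have i2 : Integrable ((⋃ u, oneJump N s t u).indicator fun _ => k₂ * h) Q :=
      (integrable_const _).indicator hUm
    have i3 : Integrable ((manyJumps N s t).indicator fun _ => k₃) Q :=
      (integrable_const _).indicator hMm
    refine (norm_integral_le_of_norm_le (((integrable_const _).add i2).add i3) herr).trans ?_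
    rw [integral_add' ((integrable_const _).add i2) i3, integral_add' (integrable_const _) i2,
      integral_indicator hUm, integral_indicator hMm, setIntegral_const, setIntegral_const,
      integral_const, probReal_univ, smul_eq_mul, smul_eq_mul, smul_eq_mul, one_mul]
    have e2 : Q.real (⋃ u, oneJump N s t u) ≤ lam * h := by
      rw [hN.measureReal_iUnion_oneJump hν hst]
      refine mul_le_of_le_one_right (by positivity) (Real.exp_le_one_iff.2 ?_)
      have : 0 ≤ lam * h := by positivity
      linarith
    have e3 : Q.real (manyJumps N s t) ≤ (lam * h) ^ 2 := hN.measureReal_manyJumps_le hν hst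
    gcongr
  have hlh : 0 ≤ lam * h := by positivity
  set I := ∫ ω, f ω ∂Q
  set J := ∫ ω, g ω ∂Q + ∑ u ∈ F, ∫ ω, j u ω ∂Q with hJ
  -- The compensator ν makes the coefficient of I equal to (1 + νh)e^{-νh} - 1, which is O(h²): the
  -- first-order loss of the no-jump probability has cancelled.
  have hVJ : ∫ ω, V ω ∂Q - I - h • J = (Real.exp (-(lam * h)) * (1 + lam * h) - 1) • I
      + (h * (Real.exp (-(lam * h)) - 1)) • J := by
    rw [hVint, hJ, ← Finset.smul_sum]
    module
  calc ‖∫ ω, φ ω ∂Q - I - h • J‖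
      = ‖(∫ ω, φ ω ∂Q - ∫ ω, V ω ∂Q) + ((Real.exp (-(lam * h)) * (1 + lam * h) - 1) • I
      + (h * (Real.exp (-(lam * h)) - 1)) • J)‖ := by
        rw [← hVJ]; congr 1; abel
    _ ≤ (k₁ * h ^ 2 + lam * h * (k₂ * h) + (lam * h) ^ 2 * k₃)
        + ((lam * h) ^ 2 * d₁ + h * (lam * h) * d₂) := by
        refine (norm_add_le _ _).trans (add_le_add hE1 ((norm_add_le _ _).trans ?_))
        rw [norm_smul, norm_smul, norm_mul, Real.norm_eq_abs, Real.norm_eq_abs, Real.norm_eq_abs,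
          abs_of_nonneg hh0]
        have := abs_exp_neg_mul_one_add_sub_one_le hlh
        have := abs_exp_neg_sub_one_le hlh
        gcongr
    _ = _ := by ring

end Expansion
end

noncomputable section

open TraceClass Function

/-! ## Truncated expectations along the walk -/

/-- The spaces of bounded maps in which test families take values need not be separable; the
countable range supplies separability. -/
lemma stronglyMeasurable_of_countable_support {E B : Type*} [MeasurableSpace E]
    [MeasurableSingletonClass E] [TopologicalSpace B] [TopologicalSpace.PseudoMetrizableSpace B]
    [Zero B] {f : E → B} {V : Set E} (hV : V.Countable) (hf : ∀ x ∉ V, f x = 0) :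
    StronglyMeasurable f := by
  borelize B
  refine stronglyMeasurable_iff_measurable_separable.2 ⟨fun A _ => ?_, ?_⟩
  · by_cases h0 : (0 : B) ∈ A
    · have : f ⁻¹' A = (V ∩ f ⁻¹' Aᶜ)ᶜ := by
        ext x
        by_cases hx : x ∈ V <;> simp [hx, hf, h0]
      rw [this]
      exact (hV.mono inter_subset_left).measurableSet.compl
    · have : f ⁻¹' A = V ∩ f ⁻¹' A := by
        ext x
        by_cases hx : x ∈ V <;> simp [hx, hf, h0]
      rw [this]
      exact (hV.mono inter_subset_left).measurableSet
  · refine (((hV.image f).insert 0).mono ?_).isSeparable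
    rintro _ ⟨x, rfl⟩
    by_cases hx : x ∈ V
    · exact Or.inr ⟨x, hx, rfl⟩
    · exact Or.inl (hf x hx)

section TruncatedExpectation

variable {s : ℕ} {U D₁ D₂ : Type*} {𝓗 : Type v} [NormedAddCommGroup 𝓗] [InnerProductSpace ℂ 𝓗]
  [CompleteSpace 𝓗] {Ω : Type*} {mΩ : MeasurableSpace Ω} {G : Type*} [NormedAddCommGroup G]
  [NormedSpace ℂ G]

/-- A walk with state, almost all of whose paths are regular up to time `T`. -/
structure IsRegularProcess (W : HybridWalk s U D₁ D₂ 𝓗) (ℱ : Filtration ℝ≥0 mΩ) (Q : Measure Ω)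
    (N : U → ℝ≥0 → Ω → ℕ) (X : ℝ≥0 → Ω → EuclideanSpace ℝ (Fin s)) (σ : ℝ≥0 → Ω → TraceClass 𝓗)
    (S : Set (EuclideanSpace ℝ (Fin s))) (C T : ℝ≥0) : Prop where
  poisson : IsPoissonFamily ℱ Q W.ν N
  adapted_walk : StronglyAdapted ℱ X
  adapted_state : StronglyAdapted ℱ σ
  bounded : W.BoundedOn S C
  regular : ∀ᵐ ω ∂Q, IsRegularPath W S (fun u t => N u t ω) T (fun t => X t ω) (fun t => σ t ω)

/-- Bounded families of linear functionals, supported by the vertices. -/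
structure IsTest (W : HybridWalk s U D₁ D₂ 𝓗)
    (Ψ : EuclideanSpace ℝ (Fin s) → TraceClass 𝓗 →L[ℂ] G) (D : ℝ≥0) : Prop where
  norm_le : ∀ x, ‖Ψ x‖ ≤ D
  support : ∀ x ∉ W.V, Ψ x = 0

/-- The action of the generator without jumps on a test family. -/
def driftTest (W : HybridWalk s U D₁ D₂ 𝓗) (S : Set (EuclideanSpace ℝ (Fin s)))
    (Ψ : EuclideanSpace ℝ (Fin s) → TraceClass 𝓗 →L[ℂ] G) :
    EuclideanSpace ℝ (Fin s) → TraceClass 𝓗 →L[ℂ] G :=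
  S.indicator fun x => (Ψ x).comp (W.gen x)

/-- The action of the jumps of type `u` on a test family. -/
def jumpTest (W : HybridWalk s U D₁ D₂ 𝓗) (S : Set (EuclideanSpace ℝ (Fin s))) (u : U)
    (Ψ : EuclideanSpace ℝ (Fin s) → TraceClass 𝓗 →L[ℂ] G) :
    EuclideanSpace ℝ (Fin s) → TraceClass 𝓗 →L[ℂ] G :=
  S.indicator fun x => (Ψ (W.move u x)).comp (W.jumpL x u)

/-- Up to time `t` there are fewer than `m` counts, all of types in `F`. -/
def truncEvent (N : U → ℝ≥0 → Ω → ℕ) (F : Finset U) (m : ℕ) (t : ℝ≥0) : Set Ω :=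
  {ω | (∀ u ∉ F, N u t ω = 0) ∧ ∑ u ∈ F, N u t ω < m}

variable {W : HybridWalk s U D₁ D₂ 𝓗} {S : Set (EuclideanSpace ℝ (Fin s))} {C T D : ℝ≥0}
  {Ψ : EuclideanSpace ℝ (Fin s) → TraceClass 𝓗 →L[ℂ] G}

lemma HybridWalk.BoundedOn.norm_gen_le (hS : W.BoundedOn S C) {x : EuclideanSpace ℝ (Fin s)}
    (hx : x ∈ S) : ‖W.gen x‖ ≤ (C + W.totalRate : ℝ≥0) := by
  have h1 := (hS x hx).2.1
  have h5 : ‖(W.totalRate : ℂ) • (1 : TraceClass 𝓗 →L[ℂ] TraceClass 𝓗)‖ ≤ W.totalRate := by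
    rw [norm_smul]
    have : ‖((W.totalRate : ℝ) : ℂ)‖ = W.totalRate := by simp
    rw [this]
    exact mul_le_of_le_one_right W.totalRate.2 ContinuousLinearMap.norm_id_le
  calc ‖W.gen x‖ = ‖W.gen x + (W.totalRate : ℂ) • 1 - (W.totalRate : ℂ) • 1‖ := by
        rw [add_sub_cancel_right]
    _ ≤ C + W.totalRate := (norm_sub_le _ _).trans (add_le_add h1 h5)

lemma HybridWalk.BoundedOn.norm_jumpL_le (hS : W.BoundedOn S C) {x : EuclideanSpace ℝ (Fin s)}
    (hx : x ∈ S) (u : U) : ‖W.jumpL x u‖ ≤ C :=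
  (HybridWalk.norm_jumpL_le (hS x hx).1 u).trans (hS x hx).2.2

lemma IsTest.driftTest (hΨ : IsTest W Ψ D) (hS : W.BoundedOn S C) :
    IsTest W (driftTest W S Ψ) (D * (C + W.totalRate)) where
  norm_le x := by
    by_cases hx : x ∈ S
    · rw [_root_.driftTest, indicator_of_mem hx]
      refine (ContinuousLinearMap.opNorm_comp_le _ _).trans ?_
      push_cast
      have h1 := hΨ.norm_le x
      have h2 := hS.norm_gen_le hx
      push_cast at h2
      gcongr
    · rw [_root_.driftTest, indicator_of_notMem hx, norm_zero]
      exact NNReal.coe_nonneg _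
  support x hx := indicator_of_notMem (fun h => hx (hS x h).1) _

lemma IsTest.jumpTest (hΨ : IsTest W Ψ D) (hS : W.BoundedOn S C) (u : U) :
    IsTest W (jumpTest W S u Ψ) (D * C) where
  norm_le x := by
    by_cases hx : x ∈ S
    · rw [_root_.jumpTest, indicator_of_mem hx]
      refine (ContinuousLinearMap.opNorm_comp_le _ _).trans ?_
      push_cast
      have h1 := hΨ.norm_le (W.move u x)
      have h2 := hS.norm_jumpL_le hx u
      gcongr
    · rw [_root_.jumpTest, indicator_of_notMem hx, norm_zero]
      exact NNReal.coe_nonneg _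
  support x hx := indicator_of_notMem (fun h => hx (hS x h).1) _

/-- A bound for the effect of one jump with type in `F`. -/
def jumpConst (W : HybridWalk s U D₁ D₂ 𝓗) (C : ℝ≥0) (F : Finset U) : ℝ :=
  1 + ∑ u ∈ F, (C : ℝ) / W.ν u

lemma one_le_jumpConst (F : Finset U) : 1 ≤ jumpConst W C F :=
  le_add_of_nonneg_right (Finset.sum_nonneg fun _ _ => by positivity)

lemma div_le_jumpConst {F : Finset U} {u : U} (hu : u ∈ F) : (C : ℝ) / W.ν u ≤ jumpConst W C F := by
  have := Finset.single_le_sum (f := fun u => (C : ℝ) / W.ν u) (fun _ _ => by positivity) hu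
  rw [jumpConst]
  linarith

/-- A bound for the state when there are fewer than `m` counts, all of types in `F`. -/
def stateBound (W : HybridWalk s U D₁ D₂ 𝓗) (C T : ℝ≥0) (F : Finset U) (m : ℕ) : ℝ≥0 :=
  ⟨Real.exp (T * C) * jumpConst W C F ^ m, by
    have := one_le_jumpConst (W := W) (C := C) F
    positivity⟩

namespace IsRegularPath

variable {n : U → ℝ≥0 → ℕ} {x : ℝ≥0 → EuclideanSpace ℝ (Fin s)} {σ : ℝ≥0 → TraceClass 𝓗}

lemma norm_state_le (h : IsRegularPath W S n T x σ) (hS : W.BoundedOn S C) {F : Finset U} {m : ℕ}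
    {t : ℝ≥0} (ht : t ≤ T) (hF : ∀ u ∉ F, n u t = 0) (hm : ∑ u ∈ F, n u t < m) :
    ‖σ t‖ ≤ stateBound W C T F m := by
  have h1 := h.evolution.norm_le hS h.mem (one_le_jumpConst (W := W) (C := C) F)
    (fun u hu => div_le_jumpConst hu) (a := 0) bot_le ht fun u hu => by rw [hF u hu, h.zero]
  rw [h.norm, mul_one] at h1
  refine h1.trans ?_
  have h2 := one_le_jumpConst (W := W) (C := C) F
  have e1 : Real.exp ((t - (0 : ℝ≥0)) * C) ≤ Real.exp (T * C) := by
    refine Real.exp_le_exp.2 ?_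
    rw [NNReal.coe_zero, sub_zero]
    gcongr
  have e2 : jumpConst W C F ^ (∑ u ∈ F, n u t - ∑ u ∈ F, n u 0) ≤ jumpConst W C F ^ m :=
    pow_le_pow_right₀ h2 (by omega)
  show _ ≤ Real.exp (T * C) * jumpConst W C F ^ m
  gcongr

end IsRegularPath

variable {ℱ : Filtration ℝ≥0 mΩ} {Q : Measure Ω}
  {N : U → ℝ≥0 → Ω → ℕ} {X : ℝ≥0 → Ω → EuclideanSpace ℝ (Fin s)} {σ : ℝ≥0 → Ω → TraceClass 𝓗}

namespace IsRegularProcess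

variable (h : IsRegularProcess W ℱ Q N X σ S C T)

include h

lemma stronglyMeasurable_test (hΨ : IsTest W Ψ D) (t : ℝ≥0) :
    StronglyMeasurable[ℱ t] fun ω => Ψ (X t ω) (σ t ω) := by
  have h1 : StronglyMeasurable[ℱ t] fun ω => Ψ (X t ω) :=
    (stronglyMeasurable_of_countable_support W.V_countable hΨ.support).comp_measurable
      (h.adapted_walk t).measurable
  exact isBoundedBilinearMap_apply.continuous.comp_stronglyMeasurable
    (h1.prodMk (h.adapted_state t))

lemma measurableSet_truncEvent [Countable U] (F : Finset U) (m : ℕ) (t : ℝ≥0) :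
    MeasurableSet[ℱ t] (truncEvent N F m t) := by
  have h1 : truncEvent N F m t
      = (⋂ u, ⋂ (_ : u ∉ F), N u t ⁻¹' {0}) ∩ (fun ω => ∑ u ∈ F, N u t ω) ⁻¹' (Iio m) := by
    ext ω
    simp [truncEvent]
  rw [h1]
  refine MeasurableSet.inter (MeasurableSet.iInter fun u => MeasurableSet.iInter fun _ =>
    h.poisson.adapted u t (measurableSet_singleton 0)) ?_
  exact Finset.measurable_fun_sum F (fun u _ => h.poisson.adapted u t) measurableSet_Iio

lemma ae_norm_test_le (hΨ : IsTest W Ψ D) (F : Finset U) (m : ℕ) {t : ℝ≥0} (ht : t ≤ T) :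
    ∀ᵐ ω ∂Q, ‖(truncEvent N F m t).indicator (fun ω => Ψ (X t ω) (σ t ω)) ω‖
      ≤ (D * stateBound W C T F m : ℝ≥0) := by
  filter_upwards [h.regular] with ω hω
  by_cases hB : ω ∈ truncEvent N F m t
  · rw [indicator_of_mem hB, NNReal.coe_mul]
    refine (ContinuousLinearMap.le_of_opNorm_le _ (hΨ.norm_le _) _).trans ?_
    have := hω.norm_state_le h.bounded ht hB.1 hB.2
    gcongr
  · rw [indicator_of_notMem hB, norm_zero]
    exact NNReal.coe_nonneg _

lemma stronglyMeasurable_trunc [Countable U] (hΨ : IsTest W Ψ D) (F : Finset U) (m : ℕ) (t : ℝ≥0) :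
    StronglyMeasurable[ℱ t] ((truncEvent N F m t).indicator fun ω => Ψ (X t ω) (σ t ω)) :=
  (h.stronglyMeasurable_test hΨ t).indicator (h.measurableSet_truncEvent F m t)

lemma integrable_trunc [Countable U] [IsFiniteMeasure Q] (hΨ : IsTest W Ψ D) (F : Finset U) (m : ℕ) {t : ℝ≥0} (ht : t ≤ T) :
    Integrable ((truncEvent N F m t).indicator fun ω => Ψ (X t ω) (σ t ω)) Q :=
  Integrable.of_bound ((h.stronglyMeasurable_trunc hΨ F m t).mono (ℱ.le t)).aestronglyMeasurable _
    (h.ae_norm_test_le hΨ F m ht)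

end IsRegularProcess

/-- The expectation of a test family on a truncation event. -/
def truncExp (Q : Measure Ω) (N : U → ℝ≥0 → Ω → ℕ) (X : ℝ≥0 → Ω → EuclideanSpace ℝ (Fin s))
    (σ : ℝ≥0 → Ω → TraceClass 𝓗) (F : Finset U) (m : ℕ)
    (Ψ : EuclideanSpace ℝ (Fin s) → TraceClass 𝓗 →L[ℂ] G) (t : ℝ≥0) : G :=
  ∫ ω, (truncEvent N F m t).indicator (fun ω => Ψ (X t ω) (σ t ω)) ω ∂Q

namespace IsRegularProcess

variable (h : IsRegularProcess W ℱ Q N X σ S C T)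

include h

lemma norm_truncExp_le [IsProbabilityMeasure Q] (hΨ : IsTest W Ψ D) (F : Finset U) (m : ℕ) {t : ℝ≥0} (ht : t ≤ T) :
    ‖truncExp Q N X σ F m Ψ t‖ ≤ (D * stateBound W C T F m : ℝ≥0) := by
  have := norm_integral_le_of_norm_le_const (h.ae_norm_test_le hΨ F m ht)
  simpa [truncExp] using this

end IsRegularProcess

end TruncatedExpectation
end

noncomputable section

open TraceClass Function

/-! ## The differential equation of the truncated expectations -/

section TruncatedEquation

variable {s : ℕ} {U D₁ D₂ : Type*} {𝓗 : Type v} [NormedAddCommGroup 𝓗] [InnerProductSpace ℂ 𝓗]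
  [CompleteSpace 𝓗] {Ω : Type*} {mΩ : MeasurableSpace Ω} {G : Type*} [NormedAddCommGroup G]
  [NormedSpace ℂ G]
  {W : HybridWalk s U D₁ D₂ 𝓗} {S : Set (EuclideanSpace ℝ (Fin s))} {C T D : ℝ≥0}
  {Ψ : EuclideanSpace ℝ (Fin s) → TraceClass 𝓗 →L[ℂ] G}

namespace IsRegularPath

variable {n : U → ℝ≥0 → ℕ} {x : ℝ≥0 → EuclideanSpace ℝ (Fin s)} {σ : ℝ≥0 → TraceClass 𝓗}
  (h : IsRegularPath W S n T x σ) (hS : W.BoundedOn S C) (hΨ : IsTest W Ψ D) {a b : ℝ≥0}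
  (hab : a ≤ b) (hb : b ≤ T) (hab1 : (b - a : ℝ) ≤ 1) {A : ℝ} (hA : ‖σ a‖ ≤ A)

include h hS hΨ hab hb hab1 hA

lemma norm_test_sub_le_of_const (hc : ∀ u, n u b = n u a) :
    ‖Ψ (x b) (σ b) - (Ψ (x a) (σ a) + (b - a : ℝ) • (driftTest W S Ψ (x a) (σ a)
      + (W.totalRate : ℝ) • Ψ (x a) (σ a)))‖ ≤ D * C ^ 2 * Real.exp C * A * (b - a) ^ 2 := by
  obtain ⟨hx, hσ⟩ := h.evolution.const a b hab hb hc
  have hxa := h.mem a (hab.trans hb)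
  have hh : 0 ≤ (b - a : ℝ) := sub_nonneg.2 (NNReal.coe_le_coe.2 hab)
  have h1 := norm_flow_apply_sub_sub_le (G := W.driftL (x a)) (c := C) (hS _ hxa).2.1 hh (σ a)
  have h2 : Ψ (x b) (σ b) - (Ψ (x a) (σ a) + (b - a : ℝ) • (driftTest W S Ψ (x a) (σ a)
      + (W.totalRate : ℝ) • Ψ (x a) (σ a)))
      = Ψ (x a) (flow (W.driftL (x a)) (b - a) (σ a) - σ a
        - ((b - a : ℝ) : ℂ) • W.driftL (x a) (σ a)) := by
    have e1 : W.driftL (x a) (σ a) = W.gen (x a) (σ a) + (W.totalRate : ℂ) • σ a := rfl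
    have e2 : (W.totalRate : ℂ) • Ψ (x a) (σ a) = (W.totalRate : ℝ) • Ψ (x a) (σ a) :=
      Complex.coe_smul (W.totalRate : ℝ) _
    rw [hx, hσ, driftTest, indicator_of_mem hxa, map_sub, map_sub, map_smul, e1, map_add, map_smul,
      e2, Complex.coe_smul, sub_sub, ContinuousLinearMap.comp_apply]
  rw [h2]
  refine (ContinuousLinearMap.le_of_opNorm_le _ (hΨ.norm_le _) _).trans ?_
  have e1 : Real.exp ((b - a) * C) ≤ Real.exp C :=
    Real.exp_le_exp.2 (mul_le_of_le_one_left C.2 hab1)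
  calc _ ≤ (D : ℝ) * (((b - a) * C) ^ 2 * Real.exp ((b - a) * C) * ‖σ a‖) := by gcongr; exact h1
    _ ≤ (D : ℝ) * (((b - a) * C) ^ 2 * Real.exp C * A) := by gcongr
    _ = _ := by ring

lemma norm_test_sub_le_of_jump {u : U} {κ : ℝ} (hκ : C / W.ν u ≤ κ) (hu : n u b = n u a + 1)
    (hv : ∀ v ≠ u, n v b = n v a) :
    ‖Ψ (x b) (σ b) - (W.ν u : ℝ)⁻¹ • jumpTest W S u Ψ (x a) (σ a)‖
      ≤ D * (2 * κ * C * Real.exp (2 * C)) * A * (b - a) := by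
  have hxa := h.mem a (hab.trans hb)
  have hh : 0 ≤ (b - a : ℝ) := sub_nonneg.2 (NNReal.coe_le_coe.2 hab)
  have hκ0 : 0 ≤ κ := le_trans (by positivity) hκ
  have h1 := h.evolution.norm_sub_jump_le hS h.mem hκ hab hb hab1 hu hv
  have h2 : Ψ (x b) (σ b) - (W.ν u : ℝ)⁻¹ • jumpTest W S u Ψ (x a) (σ a)
      = Ψ (W.move u (x a)) (σ b - (W.ν u : ℂ)⁻¹ • W.jumpL (x a) u (σ a)) := by
    rw [h.evolution.eq_move hab hb hu hv, jumpTest, indicator_of_mem hxa, map_sub, map_smul,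
      ContinuousLinearMap.comp_apply, ← Complex.coe_smul, Complex.ofReal_inv]
  rw [h2]
  refine (ContinuousLinearMap.le_of_opNorm_le _ (hΨ.norm_le _) _).trans ?_
  calc _ ≤ (D : ℝ) * ((b - a) * (2 * κ * C * Real.exp (2 * C)) * ‖σ a‖) := by gcongr
    _ ≤ (D : ℝ) * ((b - a) * (2 * κ * C * Real.exp (2 * C)) * A) := by gcongr
    _ = _ := by ring

end IsRegularPath

variable {ℱ : Filtration ℝ≥0 mΩ} {Q : Measure Ω}
  {N : U → ℝ≥0 → Ω → ℕ} {X : ℝ≥0 → Ω → EuclideanSpace ℝ (Fin s)} {σ : ℝ≥0 → Ω → TraceClass 𝓗}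

lemma mem_truncEvent_of_noJump {F : Finset U} {m : ℕ} {a b : ℝ≥0} {ω : Ω}
    (hω : ∀ u, N u b ω = N u a ω) : ω ∈ truncEvent N F m b ↔ ω ∈ truncEvent N F m a := by
  simp only [truncEvent, Set.mem_ofPred_eq, hω]

/-- A count raises the total by one, so level m + 1 afterwards corresponds to level m before. This
shift is why the jump terms of `truncExpDeriv` live one level lower than the drift. -/
lemma mem_truncEvent_of_oneJump {F : Finset U} {m : ℕ} {a b : ℝ≥0} {ω : Ω} {u : U} (huF : u ∈ F)
    (hu : N u b ω = N u a ω + 1) (hv : ∀ v ≠ u, N v b ω = N v a ω) :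
    ω ∈ truncEvent N F (m + 1) b ↔ ω ∈ truncEvent N F m a := by
  classical
  have h1 : ∑ v ∈ F, N v b ω = ∑ v ∈ F, N v a ω + 1 := by
    rw [← Finset.add_sum_erase _ _ huF, ← Finset.add_sum_erase _ (fun v => N v a ω) huF, hu,
      Finset.sum_congr rfl fun v hv' => hv v (Finset.ne_of_mem_erase hv')]
    ring
  have h2 : ∀ v ∉ F, N v b ω = N v a ω := fun v hvF => hv v fun h => hvF (h ▸ huF)
  simp only [truncEvent, Set.mem_ofPred_eq, h1, add_lt_add_iff_right]
  exact and_congr_left fun _ => forall₂_congr fun v hv' => by rw [h2 v hv']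

lemma notMem_truncEvent_of_oneJump {F : Finset U} {m : ℕ} {a b : ℝ≥0} {ω : Ω} {u : U}
    (huF : u ∉ F) (hu : N u b ω = N u a ω + 1) : ω ∉ truncEvent N F m b := fun h => by
  have := h.1 u huF
  omega

/-- The increments are truncated differences of natural numbers; monotonicity turns them into
genuine ones. -/
lemma inc_of_oneJump {a b : ℝ≥0} {ω : Ω} (hmono : ∀ v, N v a ω ≤ N v b ω) {u : U}
    (hω : ω ∈ oneJump N a b u) : N u b ω = N u a ω + 1 ∧ ∀ v ≠ u, N v b ω = N v a ω := by
  classical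
  refine ⟨?_, fun v hv => ?_⟩
  · have h1 := hω u
    have h2 := hmono u
    simp only [Pi.single_eq_same] at h1
    omega
  · have h1 := hω v
    have h2 := hmono v
    simp only [Pi.single_eq_of_ne hv] at h1
    omega

lemma truncEvent_mono_right {F : Finset U} {m m' : ℕ} (hm : m ≤ m') (t : ℝ≥0) :
    truncEvent N F m t ⊆ truncEvent N F m' t := fun _ hω => ⟨hω.1, hω.2.trans_le hm⟩

/-- The right derivative of `truncExp Q N X σ F m Ψ`. -/
def truncExpDeriv (W : HybridWalk s U D₁ D₂ 𝓗) (S : Set (EuclideanSpace ℝ (Fin s))) (Q : Measure Ω)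
    (N : U → ℝ≥0 → Ω → ℕ) (X : ℝ≥0 → Ω → EuclideanSpace ℝ (Fin s))
    (σ : ℝ≥0 → Ω → TraceClass 𝓗) (F : Finset U) (m : ℕ)
    (Ψ : EuclideanSpace ℝ (Fin s) → TraceClass 𝓗 →L[ℂ] G) (t : ℝ≥0) : G :=
  truncExp Q N X σ F (m + 1) (driftTest W S Ψ) t
    + ∑ u ∈ F, truncExp Q N X σ F m (jumpTest W S u Ψ) t

variable [Countable U] [IsProbabilityMeasure Q]

namespace IsRegularProcess

variable (h : IsRegularProcess W ℱ Q N X σ S C T)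

include h

lemma norm_truncExpDeriv_le (hΨ : IsTest W Ψ D) (F : Finset U) (m : ℕ) :
    ∃ d, ∀ t ≤ T, ‖truncExpDeriv W S Q N X σ F m Ψ t‖ ≤ d := by
  refine ⟨_, fun t ht => (norm_add_le _ _).trans (add_le_add
    (h.norm_truncExp_le (hΨ.driftTest h.bounded) F (m + 1) ht)
    ((norm_sum_le _ _).trans (Finset.sum_le_sum fun u _ =>
      h.norm_truncExp_le (hΨ.jumpTest h.bounded u) F m ht)))⟩

/-- On the truncation event the state is bounded by `stateBound`, so the constants of the short-time
expansion can be taken uniform in a and b. -/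
theorem exists_norm_truncExp_sub_le [CompleteSpace G] (hΨ : IsTest W Ψ D) (F : Finset U) (m : ℕ) :
    ∃ K, ∀ a b : ℝ≥0, a ≤ b → b ≤ T → (b - a : ℝ) ≤ 1 →
      ‖truncExp Q N X σ F (m + 1) Ψ b - truncExp Q N X σ F (m + 1) Ψ a
        - (b - a : ℝ) • truncExpDeriv W S Q N X σ F m Ψ a‖ ≤ K * (b - a) ^ 2 := by
  obtain ⟨d, hd⟩ := h.norm_truncExpDeriv_le hΨ F m
  set A : ℝ := ((stateBound W C T F (m + 1) : ℝ≥0) : ℝ) with hA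
  set κ := jumpConst W C F with hκ
  have hκ1 : 1 ≤ κ := one_le_jumpConst F
  refine ⟨D * C ^ 2 * Real.exp C * A
    + ((∑' u, W.ν u : ℝ≥0) : ℝ) * (D * (2 * κ * C * Real.exp (2 * C)) * A)
    + ((∑' u, W.ν u : ℝ≥0) : ℝ) ^ 2 * (D * stateBound W C T F (m + 1) : ℝ≥0)
    + ((∑' u, W.ν u : ℝ≥0) : ℝ) ^ 2 * (D * stateBound W C T F (m + 1) : ℝ≥0)
    + ((∑' u, W.ν u : ℝ≥0) : ℝ) * d, fun a b hab hb hab1 => ?_⟩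
  have ha := hab.trans hb
  have hh : 0 ≤ (b - a : ℝ) := sub_nonneg.2 (NNReal.coe_le_coe.2 hab)
  have hA0 : 0 ≤ A := NNReal.coe_nonneg _
  refine h.poisson.norm_integral_sub_le W.ν_summable W.ν_pos hab
    (φ := (truncEvent N F (m + 1) b).indicator fun ω => Ψ (X b ω) (σ b ω))
    (f := (truncEvent N F (m + 1) a).indicator fun ω => Ψ (X a ω) (σ a ω))
    (g := (truncEvent N F (m + 1) a).indicator fun ω => driftTest W S Ψ (X a ω) (σ a ω))
    (j := fun u => (truncEvent N F m a).indicator fun ω => jumpTest W S u Ψ (X a ω) (σ a ω))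
    (h.integrable_trunc hΨ F (m + 1) hb) (h.stronglyMeasurable_trunc hΨ F (m + 1) a)
    (h.integrable_trunc hΨ F (m + 1) ha)
    (h.stronglyMeasurable_trunc (hΨ.driftTest h.bounded) F (m + 1) a)
    (h.integrable_trunc (hΨ.driftTest h.bounded) F (m + 1) ha)
    (fun u => h.stronglyMeasurable_trunc (hΨ.jumpTest h.bounded u) F m a)
    (fun u => h.integrable_trunc (hΨ.jumpTest h.bounded u) F m ha)
    (k₁ := D * C ^ 2 * Real.exp C * A) (k₂ := D * (2 * κ * C * Real.exp (2 * C)) * A)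
    (by positivity) (by positivity) ?_ ?_ ?_ (h.ae_norm_test_le hΨ F (m + 1) hb)
    (h.norm_truncExp_le hΨ F (m + 1) ha) (hd a ha)
  · filter_upwards [h.regular] with ω hω hZ
    have hc : ∀ u, N u b ω = N u a ω := fun u => by
      have h1 := hZ u
      have h2 := hω.evolution.counting.mono u hab
      simp only [Pi.zero_apply] at h1
      simp only at h2
      omega
    by_cases hB : ω ∈ truncEvent N F (m + 1) a
    · rw [indicator_of_mem ((mem_truncEvent_of_noJump hc).2 hB), indicator_of_mem hB,
        indicator_of_mem hB]
      exact hω.norm_test_sub_le_of_const h.bounded hΨ hab hb hab1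
        (hω.norm_state_le h.bounded ha hB.1 hB.2) hc
    · rw [indicator_of_notMem fun hB' => hB ((mem_truncEvent_of_noJump hc).1 hB'),
        indicator_of_notMem hB, indicator_of_notMem hB]
      simp only [smul_zero, add_zero, sub_zero, norm_zero]
      positivity
  · filter_upwards [h.regular] with ω hω u huF hO
    obtain ⟨hu, hv⟩ := inc_of_oneJump (fun v => hω.evolution.counting.mono v hab) hO
    by_cases hB : ω ∈ truncEvent N F m a
    · rw [indicator_of_mem ((mem_truncEvent_of_oneJump huF hu hv).2 hB), indicator_of_mem hB]
      have hB' := truncEvent_mono_right m.le_succ a hB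
      exact hω.norm_test_sub_le_of_jump h.bounded hΨ hab hb hab1
        (hω.norm_state_le h.bounded ha hB'.1 hB'.2) (div_le_jumpConst huF) hu hv
    · rw [indicator_of_notMem fun hB' => hB ((mem_truncEvent_of_oneJump huF hu hv).1 hB'),
        indicator_of_notMem hB]
      simp only [smul_zero, sub_zero, norm_zero]
      positivity
  · filter_upwards [h.regular] with ω hω u huF hO
    obtain ⟨hu, -⟩ := inc_of_oneJump (fun v => hω.evolution.counting.mono v hab) hO
    exact indicator_of_notMem (notMem_truncEvent_of_oneJump huF hu) _

end IsRegularProcess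

end TruncatedEquation
end

noncomputable section

open TraceClass Function

/-! ## Integral equations on `[0, T]` -/

section IntegralEquation

variable {G : Type*} [NormedAddCommGroup G]

/-- `f` is Lipschitz on `[0, T]`, at distances at most one. -/
def IsStepLipschitz (f : ℝ≥0 → G) (T : ℝ≥0) : Prop :=
  ∃ L : ℝ, ∀ a b : ℝ≥0, a ≤ b → b ≤ T → (b - a : ℝ) ≤ 1 → ‖f b - f a‖ ≤ L * (b - a)

variable {f f' : ℝ≥0 → G} {T : ℝ≥0}

lemma coe_min_toNNReal_sub_le {r r' : ℝ} (h : r ≤ r') :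
    ((min r'.toNNReal T : ℝ≥0) : ℝ) - (min r.toNNReal T : ℝ≥0) ≤ r' - r := by
  rw [NNReal.coe_min, NNReal.coe_min, Real.coe_toNNReal', Real.coe_toNNReal']
  simp only [min_def, max_def]
  have := T.2
  split_ifs <;> linarith

/-- Clamping to [0, T] does not increase distances, and extends the function to the whole line,
where calculus is convenient. -/
lemma IsStepLipschitz.continuous (hf : IsStepLipschitz f T) :
    Continuous fun r : ℝ => f (min r.toNNReal T) := by
  obtain ⟨L, hL⟩ := hf
  have key : ∀ r r' : ℝ, r ≤ r' → r' - r ≤ 1 →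
      ‖f (min r'.toNNReal T) - f (min r.toNNReal T)‖ ≤ |L| * |r' - r| := by
    intro r r' hr h1
    have h2 := coe_min_toNNReal_sub_le (T := T) hr
    have h3 : min r.toNNReal T ≤ min r'.toNNReal T :=
      min_le_min_right _ (Real.toNNReal_le_toNNReal hr)
    refine (hL _ _ h3 (min_le_right _ _) (h2.trans h1)).trans ?_
    rw [abs_of_nonneg (sub_nonneg.2 hr)]
    have h4 : 0 ≤ ((min r'.toNNReal T : ℝ≥0) : ℝ) - (min r.toNNReal T : ℝ≥0) :=
      sub_nonneg.2 (NNReal.coe_le_coe.2 h3)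
    have h5 := le_abs_self L
    gcongr
  refine continuous_iff_continuousAt.2 fun r => tendsto_iff_norm_sub_tendsto_zero.2 ?_
  have h0 : Tendsto (fun r' : ℝ => |L| * |r' - r|) (𝓝 r) (𝓝 0) := by
    have : Continuous fun r' : ℝ => |L| * |r' - r| := by fun_prop
    simpa using this.tendsto r
  refine squeeze_zero' (Eventually.of_forall fun _ => norm_nonneg _) ?_ h0
  filter_upwards [Metric.ball_mem_nhds r one_pos] with r' hr'
  rw [Metric.mem_ball, Real.dist_eq] at hr'
  rcases le_total r r' with h | h
  · exact key r r' h ((le_abs_self _).trans hr'.le)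
  · rw [norm_sub_rev, abs_sub_comm]
    rw [abs_sub_comm] at hr'
    exact key r' r h ((le_abs_self _).trans hr'.le)

variable [NormedSpace ℝ G]

lemma isStepLipschitz_of_expansion {K d : ℝ} (hd : ∀ t ≤ T, ‖f' t‖ ≤ d)
    (h : ∀ a b : ℝ≥0, a ≤ b → b ≤ T → (b - a : ℝ) ≤ 1 →
      ‖f b - f a - (b - a : ℝ) • f' a‖ ≤ K * (b - a) ^ 2) : IsStepLipschitz f T := by
  refine ⟨|K| + d, fun a b hab hb hab1 => ?_⟩
  have hh : 0 ≤ (b - a : ℝ) := sub_nonneg.2 (NNReal.coe_le_coe.2 hab)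
  have h1 := h a b hab hb hab1
  have h2 := hd a (hab.trans hb)
  calc ‖f b - f a‖ = ‖(f b - f a - (b - a : ℝ) • f' a) + (b - a : ℝ) • f' a‖ := by
        rw [sub_add_cancel]
    _ ≤ K * (b - a) ^ 2 + (b - a) * d := by
        refine (norm_add_le _ _).trans (add_le_add h1 ?_)
        rw [norm_smul, Real.norm_of_nonneg hh]
        gcongr
    _ ≤ |K| * (b - a) + (b - a) * d := by
        have h3 : K * (b - a : ℝ) ^ 2 ≤ |K| * (b - a : ℝ) ^ 2 := by
          have := le_abs_self K
          gcongr
        have h4 : (b - a : ℝ) ^ 2 ≤ b - a := by nlinarith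
        have h5 : |K| * (b - a : ℝ) ^ 2 ≤ |K| * (b - a) := by gcongr
        linarith
    _ = _ := by ring

variable [CompleteSpace G]

/-- A quadratic remainder makes f' the right derivative of f, and a continuous function with an
integrable right derivative is recovered by integration. -/
theorem eq_add_integral_of_expansion {K : ℝ} (hf : IsStepLipschitz f T)
    (hf' : IsStepLipschitz f' T)
    (h : ∀ a b : ℝ≥0, a ≤ b → b ≤ T → (b - a : ℝ) ≤ 1 →
      ‖f b - f a - (b - a : ℝ) • f' a‖ ≤ K * (b - a) ^ 2) {t : ℝ≥0} (ht : t ≤ T) :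
    f t = f 0 + ∫ r in (0 : ℝ)..t, f' (min r.toNNReal T) := by
  have h1 := intervalIntegral.integral_eq_sub_of_hasDeriv_right_of_le (a := 0) (b := t) t.2
    (f := fun r : ℝ => f (min r.toNNReal T)) (f' := fun r : ℝ => f' (min r.toNNReal T))
    hf.continuous.continuousOn (fun r hr => ?_) (hf'.continuous.intervalIntegrable _ _)
  · rw [h1]
    simp [ht]
  · rw [hasDerivWithinAt_iff_isLittleO]
    refine Asymptotics.IsBigO.trans_isLittleO (g := fun x => ‖x - r‖ ^ 2) ?_
      ((Asymptotics.isLittleO_pow_sub_sub r one_lt_two).mono nhdsWithin_le_nhds)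
    have hrT : r < T := hr.2.trans_le (NNReal.coe_le_coe.2 ht)
    refine Asymptotics.IsBigO.of_bound K ?_
    filter_upwards [Ioc_mem_nhdsGT (lt_min hrT (lt_add_one r))] with r' hr'
    have hr'T : r' ≤ T := hr'.2.trans (min_le_left _ _)
    have hr'1 : r' ≤ r + 1 := hr'.2.trans (min_le_right _ _)
    have h0 : 0 ≤ r := hr.1.le
    have h0' : 0 ≤ r' := h0.trans hr'.1.le
    have hrr := hr'.1
    lift r to ℝ≥0 using h0
    lift r' to ℝ≥0 using h0'
    simp only [Real.toNNReal_coe, min_eq_left (NNReal.coe_le_coe.1 hr'T),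
      min_eq_left (NNReal.coe_le_coe.1 hrT.le)]
    have h2 := h r r' (NNReal.coe_le_coe.1 hrr.le) (NNReal.coe_le_coe.1 hr'T) (by linarith)
    simpa using h2

/-- The clamped integrand is continuous, so its primitive is differentiable; t < T leaves room to
the right, where the integral equation still holds. -/
theorem hasDerivWithinAt_of_eq_add_integral (hf' : IsStepLipschitz f' T)
    (h : ∀ t ≤ T, f t = f 0 + ∫ r in (0 : ℝ)..t, f' (min r.toNNReal T)) {t : ℝ≥0} (ht : t < T) :
    HasDerivWithinAt (fun r : ℝ => f r.toNNReal) (f' t) (Ici 0) t := by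
  have hc := hf'.continuous
  have h1 : HasDerivAt (fun r : ℝ => f 0 + ∫ p in (0 : ℝ)..r, f' (min p.toNNReal T))
      (f' (min (t : ℝ).toNNReal T)) t :=
    (intervalIntegral.integral_hasDerivAt_right (hc.intervalIntegrable _ _)
      hc.stronglyMeasurable.stronglyMeasurableAtFilter hc.continuousAt).const_add _
  rw [Real.toNNReal_coe, min_eq_left ht.le] at h1
  have key : ∀ r : ℝ, 0 ≤ r → r ≤ T →
      f r.toNNReal = f 0 + ∫ p in (0 : ℝ)..r, f' (min p.toNNReal T) := by
    intro r hr hrT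
    lift r to ℝ≥0 using hr
    rw [Real.toNNReal_coe]
    exact h r (NNReal.coe_le_coe.1 hrT)
  refine h1.hasDerivWithinAt.congr_of_eventuallyEq ?_ (key t t.2 (NNReal.coe_le_coe.2 ht.le))
  filter_upwards [self_mem_nhdsWithin, mem_nhdsWithin_of_mem_nhds
    (Iio_mem_nhds (NNReal.coe_lt_coe.2 ht))] with r hr1 hr2
  exact key r hr1 (le_of_lt hr2)

lemma isStepLipschitz_of_eq_add_integral {d : ℝ} (hd : ∀ t ≤ T, ‖f' t‖ ≤ d)
    (hint : ∀ t ≤ T, f t = f 0 + ∫ r in (0 : ℝ)..t, f' (min r.toNNReal T))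
    (hii : ∀ a b : ℝ, IntervalIntegrable (fun r : ℝ => f' (min r.toNNReal T)) volume a b) :
    IsStepLipschitz f T := by
  refine ⟨d, fun a b hab hb _ => ?_⟩
  have h1 : f b - f a = ∫ r in (a : ℝ)..b, f' (min r.toNNReal T) := by
    rw [hint b hb, hint a (hab.trans hb), add_sub_add_left_eq_sub,
      intervalIntegral.integral_interval_sub_left (hii _ _) (hii _ _)]
  rw [h1]
  refine (intervalIntegral.norm_integral_le_of_norm_le_const fun r _ =>
    hd _ (min_le_right _ _)).trans ?_
  rw [abs_of_nonneg (sub_nonneg.2 (NNReal.coe_le_coe.2 hab))]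

end IntegralEquation

/-! ## The integral equation of the truncated expectations -/

section TruncatedEquation

variable {s : ℕ} {U D₁ D₂ : Type*} {𝓗 : Type v} [NormedAddCommGroup 𝓗] [InnerProductSpace ℂ 𝓗]
  [CompleteSpace 𝓗] {Ω : Type*} {mΩ : MeasurableSpace Ω} {G : Type*} [NormedAddCommGroup G]
  [NormedSpace ℂ G]
  {W : HybridWalk s U D₁ D₂ 𝓗} {S : Set (EuclideanSpace ℝ (Fin s))} {C T D : ℝ≥0}
  {Ψ : EuclideanSpace ℝ (Fin s) → TraceClass 𝓗 →L[ℂ] G}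
  {ℱ : Filtration ℝ≥0 mΩ} {Q : Measure Ω}
  {N : U → ℝ≥0 → Ω → ℕ} {X : ℝ≥0 → Ω → EuclideanSpace ℝ (Fin s)} {σ : ℝ≥0 → Ω → TraceClass 𝓗}

lemma truncExp_zero (F : Finset U) (t : ℝ≥0) : truncExp Q N X σ F 0 Ψ t = 0 := by
  have : truncEvent N F 0 t = ∅ := by ext; simp [truncEvent]
  simp [truncExp, this]

variable [CompleteSpace G] [Countable U] [IsProbabilityMeasure Q]

namespace IsRegularProcess

variable (h : IsRegularProcess W ℱ Q N X σ S C T)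

include h

lemma isStepLipschitz_truncExp (hΨ : IsTest W Ψ D) (F : Finset U) (m : ℕ) :
    IsStepLipschitz (truncExp Q N X σ F m Ψ) T := by
  rcases m with _ | m
  · exact ⟨0, fun a b _ _ _ => by simp [truncExp_zero]⟩
  · obtain ⟨d, hd⟩ := h.norm_truncExpDeriv_le hΨ F m
    obtain ⟨K, hK⟩ := h.exists_norm_truncExp_sub_le hΨ F m
    exact isStepLipschitz_of_expansion hd hK

/-- The derivative is a finite sum of truncated expectations of other test families, to which the
Lipschitz bound applies again. -/
lemma isStepLipschitz_truncExpDeriv (hΨ : IsTest W Ψ D) (F : Finset U) (m : ℕ) :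
    IsStepLipschitz (truncExpDeriv W S Q N X σ F m Ψ) T := by
  obtain ⟨L, hL⟩ := h.isStepLipschitz_truncExp (hΨ.driftTest h.bounded) F (m + 1)
  choose L' hL' using fun u => h.isStepLipschitz_truncExp (hΨ.jumpTest h.bounded u) F m
  refine ⟨L + ∑ u ∈ F, L' u, fun a b hab hb hab1 => ?_⟩
  rw [truncExpDeriv, truncExpDeriv, add_sub_add_comm, ← Finset.sum_sub_distrib, add_mul,
    Finset.sum_mul]
  exact (norm_add_le _ _).trans (add_le_add (hL a b hab hb hab1)
    ((norm_sum_le _ _).trans (Finset.sum_le_sum fun u _ => hL' u a b hab hb hab1)))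

theorem truncExp_eq_add_integral (hΨ : IsTest W Ψ D) (F : Finset U) (m : ℕ) {t : ℝ≥0}
    (ht : t ≤ T) :
    truncExp Q N X σ F (m + 1) Ψ t = truncExp Q N X σ F (m + 1) Ψ 0
      + ∫ r in (0 : ℝ)..t, truncExpDeriv W S Q N X σ F m Ψ (min r.toNNReal T) := by
  obtain ⟨K, hK⟩ := h.exists_norm_truncExp_sub_le hΨ F m
  exact eq_add_integral_of_expansion (h.isStepLipschitz_truncExp hΨ F (m + 1))
    (h.isStepLipschitz_truncExpDeriv hΨ F m) hK ht

end IsRegularProcess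

end TruncatedEquation
end

noncomputable section

open TraceClass Function

/-! ## The trace is conserved by the full generator -/

section TraceBalance

variable {s : ℕ} {U D₁ D₂ : Type*} {𝓗 : Type v} [NormedAddCommGroup 𝓗] [InnerProductSpace ℂ 𝓗]
  [CompleteSpace 𝓗] {W : HybridWalk s U D₁ D₂ 𝓗} {x : EuclideanSpace ℝ (Fin s)}

namespace HybridWalk

lemma rateOn_univ (hx : x ∈ W.V) : W.rateOn x univ = W.R x := by
  ext a
  have h1 := hasSum_rateOn hx univ a
  rw [indicator_univ] at h1
  exact h1.unique (hasSum_rateOp hx a)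

lemma hasSum_trace_jumpL (hx : x ∈ W.V) (ρ : TraceClass 𝓗) :
    HasSum (fun u => trace (W.jumpL x u ρ)) (-trace (W.gen x ρ)) := by
  have h1 := ((sumBound_indicator_jumpL hx univ).hasSum ρ).mapL traceL
  have h2 := trace_sumMap_jumpL hx univ ρ
  rw [indicator_univ, rateOn_univ hx] at h2
  simp only [traceL_apply, indicator_univ, h2] at h1
  rwa [trace_gen hx, neg_neg]

lemma sum_re_trace_jumpL_le (hx : x ∈ W.V) {ρ : TraceClass 𝓗} (hρ : IsPos ρ) (F : Finset U) :
    ∑ u ∈ F, (trace (W.jumpL x u ρ)).re ≤ -(trace (W.gen x ρ)).re := by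
  have h1 := (hasSum_trace_jumpL hx ρ).mapL Complex.reCLM
  simp only [Complex.reCLM_apply, Complex.neg_re] at h1
  refine sum_le_hasSum F (fun u _ => ?_) h1
  rw [(jumpL_isPos u hρ).trace_eq_norm, Complex.ofReal_re]
  exact norm_nonneg _

end HybridWalk

end TraceBalance

/-! ## First moments -/

section Moments

variable {s : ℕ} {U D₁ D₂ : Type*} {𝓗 : Type v} [NormedAddCommGroup 𝓗] [InnerProductSpace ℂ 𝓗]
  [CompleteSpace 𝓗] {Ω : Type*} {mΩ : MeasurableSpace Ω}
  {W : HybridWalk s U D₁ D₂ 𝓗} {S : Set (EuclideanSpace ℝ (Fin s))} {C T : ℝ≥0}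

/-- The trace, as a test family. -/
def traceTest (W : HybridWalk s U D₁ D₂ 𝓗) : EuclideanSpace ℝ (Fin s) → TraceClass 𝓗 →L[ℂ] ℂ :=
  W.V.indicator fun _ => traceL

lemma isTest_traceTest : IsTest W (traceTest W) 1 where
  norm_le x := by
    by_cases hx : x ∈ W.V
    · rw [traceTest, indicator_of_mem hx]
      exact norm_traceL_le
    · rw [traceTest, indicator_of_notMem hx, norm_zero]
      exact NNReal.coe_nonneg _
  support x hx := indicator_of_notMem hx _

lemma traceTest_apply {x : EuclideanSpace ℝ (Fin s)} (hx : x ∈ W.V) (ρ : TraceClass 𝓗) :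
    traceTest W x ρ = trace ρ := by
  rw [traceTest, indicator_of_mem hx, traceL_apply]

lemma truncEvent_mono {N : U → ℝ≥0 → Ω → ℕ} (t : ℝ≥0) :
    Monotone fun p : Finset U × ℕ => truncEvent N p.1 p.2 t := by
  rintro ⟨F, m⟩ ⟨F', m'⟩ ⟨hF, hm⟩ ω ⟨h1, h2⟩
  refine ⟨fun u hu => h1 u fun h => hu (hF h), ?_⟩
  have h3 : ∑ u ∈ F', N u t ω = ∑ u ∈ F, N u t ω :=
    (Finset.sum_subset hF fun u _ hu => h1 u hu).symm
  show ∑ u ∈ F', N u t ω < m'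
  rw [h3]
  exact h2.trans_le hm

variable {ℱ : Filtration ℝ≥0 mΩ} {Q : Measure Ω}
  {N : U → ℝ≥0 → Ω → ℕ} {X : ℝ≥0 → Ω → EuclideanSpace ℝ (Fin s)} {σ : ℝ≥0 → Ω → TraceClass 𝓗}

lemma IsRegularPath.exists_mem_truncEvent {ω : Ω}
    (h : IsRegularPath W S (fun u t => N u t ω) T (fun t => X t ω) (fun t => σ t ω)) {t : ℝ≥0}
    (ht : t ≤ T) : ∃ p : Finset U × ℕ, ω ∈ truncEvent N p.1 p.2 t := by
  have hfin := h.evolution.counting.finite_ne (a := 0) bot_le ht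
  refine ⟨(hfin.toFinset, ∑ u ∈ hfin.toFinset, N u t ω + 1), fun u hu => ?_, lt_add_one _⟩
  by_contra hne
  refine hu (hfin.mem_toFinset.2 ?_)
  show N u t ω ≠ N u 0 ω
  have h0 : N u 0 ω = 0 := h.zero u
  rw [h0]
  exact hne

lemma IsRegularPath.isPos {n : U → ℝ≥0 → ℕ} {x : ℝ≥0 → EuclideanSpace ℝ (Fin s)}
    {σ : ℝ≥0 → TraceClass 𝓗} (h : IsRegularPath W S n T x σ) {t : ℝ≥0} (ht : t ≤ T) :
    IsPos (σ t) := h.evolution.isPos bot_le ht h.pos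

variable [Countable U] [IsProbabilityMeasure Q]

namespace IsRegularProcess

variable (h : IsRegularProcess W ℱ Q N X σ S C T)

include h

lemma truncExpDeriv_eq_integral {G : Type*} [NormedAddCommGroup G] [NormedSpace ℂ G]
    {D : ℝ≥0} {Ψ : EuclideanSpace ℝ (Fin s) → TraceClass 𝓗 →L[ℂ] G} (hΨ : IsTest W Ψ D)
    (F : Finset U) (m : ℕ) {t : ℝ≥0} (ht : t ≤ T) :
    Integrable (fun ω =>
      (truncEvent N F (m + 1) t).indicator (fun ω => driftTest W S Ψ (X t ω) (σ t ω)) ω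
      + ∑ u ∈ F, (truncEvent N F m t).indicator (fun ω => jumpTest W S u Ψ (X t ω) (σ t ω)) ω) Q ∧
    truncExpDeriv W S Q N X σ F m Ψ t = ∫ ω,
      ((truncEvent N F (m + 1) t).indicator (fun ω => driftTest W S Ψ (X t ω) (σ t ω)) ω
      + ∑ u ∈ F, (truncEvent N F m t).indicator (fun ω => jumpTest W S u Ψ (X t ω) (σ t ω)) ω)
        ∂Q := by
  have i1 := h.integrable_trunc (hΨ.driftTest h.bounded) F (m + 1) ht
  have i2 := fun u => h.integrable_trunc (hΨ.jumpTest h.bounded u) F m ht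
  have i3 := integrable_finsetSum F fun u _ => i2 u
  refine ⟨i1.add i3, ?_⟩
  rw [integral_add i1 i3, integral_finsetSum F fun u _ => i2 u]
  rfl

/-- Pathwise, the jumps of all types restore exactly the trace lost by the drift. Restricting to F
and to level m discards nonnegative terms only. -/
lemma re_truncExpDeriv_traceTest_nonpos (F : Finset U) (m : ℕ) {t : ℝ≥0} (ht : t ≤ T) :
    (truncExpDeriv W S Q N X σ F m (traceTest W) t).re ≤ 0 := by
  obtain ⟨hi, he⟩ := h.truncExpDeriv_eq_integral isTest_traceTest F m ht
  rw [he]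
  have h1 := integral_re hi
  simp only [RCLike.re_eq_complex_re] at h1
  rw [← h1]
  refine integral_nonpos_of_ae ?_
  filter_upwards [h.regular] with ω hω
  have hxS := hω.mem t ht
  have hxV := (h.bounded _ hxS).1
  have hpos := hω.isPos ht
  have e1 : driftTest W S (traceTest W) (X t ω) (σ t ω) = trace (W.gen (X t ω) (σ t ω)) := by
    rw [driftTest, indicator_of_mem hxS, ContinuousLinearMap.comp_apply, traceTest_apply hxV]
  have e2 : ∀ u, jumpTest W S u (traceTest W) (X t ω) (σ t ω)
      = trace (W.jumpL (X t ω) u (σ t ω)) := fun u => by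
    rw [jumpTest, indicator_of_mem hxS, ContinuousLinearMap.comp_apply,
      traceTest_apply (HybridWalk.move_mem u hxV)]
  have hnn : ∀ u, 0 ≤ (trace (W.jumpL (X t ω) u (σ t ω))).re := fun u => by
    rw [(HybridWalk.jumpL_isPos u hpos).trace_eq_norm, Complex.ofReal_re]
    exact norm_nonneg _
  have h2 := HybridWalk.sum_re_trace_jumpL_le hxV hpos F
  by_cases hB : ω ∈ truncEvent N F (m + 1) t
  · rw [indicator_of_mem hB, e1, Complex.add_re, Complex.re_sum]
    have h3 : ∑ u ∈ F, ((truncEvent N F m t).indicator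
        (fun ω => jumpTest W S u (traceTest W) (X t ω) (σ t ω)) ω).re
        ≤ ∑ u ∈ F, (trace (W.jumpL (X t ω) u (σ t ω))).re := by
      refine Finset.sum_le_sum fun u _ => ?_
      by_cases hB' : ω ∈ truncEvent N F m t
      · rw [indicator_of_mem hB', e2]
      · rw [indicator_of_notMem hB', Complex.zero_re]
        exact hnn u
    simp only [Pi.zero_apply]
    linarith
  · rw [indicator_of_notMem hB, Finset.sum_eq_zero fun u _ =>
      indicator_of_notMem (fun hB' => hB (truncEvent_mono_right m.le_succ t hB')) _]
    simp

lemma re_truncExp_traceTest_le_one (F : Finset U) (m : ℕ) {t : ℝ≥0} (ht : t ≤ T) :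
    (truncExp Q N X σ F (m + 1) (traceTest W) t).re ≤ 1 := by
  have hc := (h.isStepLipschitz_truncExpDeriv isTest_traceTest F m).continuous
  have h1 := h.truncExp_eq_add_integral isTest_traceTest F m ht
  have h2 : (∫ r in (0 : ℝ)..t, truncExpDeriv W S Q N X σ F m (traceTest W)
      (min r.toNNReal T)).re ≤ 0 := by
    have h3 := Complex.reCLM.intervalIntegral_comp_comm (hc.intervalIntegrable (μ := volume) 0 t)
    simp only [Complex.reCLM_apply] at h3
    rw [← h3]
    rw [intervalIntegral.integral_of_le t.coe_nonneg]
    exact integral_nonpos fun r => h.re_truncExpDeriv_traceTest_nonpos F m (min_le_right _ _)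
  have h4 : ‖truncExp Q N X σ F (m + 1) (traceTest W) 0‖ ≤ 1 := by
    have : ∀ᵐ ω ∂Q, ‖(truncEvent N F (m + 1) 0).indicator
        (fun ω => traceTest W (X 0 ω) (σ 0 ω)) ω‖ ≤ 1 := by
      filter_upwards [h.regular] with ω hω
      refine (norm_indicator_le_norm_self _ _).trans ?_
      refine (ContinuousLinearMap.le_of_opNorm_le _ (isTest_traceTest.norm_le _) _).trans ?_
      rw [hω.norm]
      simp
    simpa [truncExp] using norm_integral_le_of_norm_le_const this
  rw [h1, Complex.add_re]
  linarith [Complex.re_le_norm (truncExp Q N X σ F (m + 1) (traceTest W) 0)]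

/-- On positive states the norm is the trace, whose truncated expectations never exceed their
initial bound 1; the truncation events increase to almost all of Ω. -/
theorem lintegral_enorm_state_le {t : ℝ≥0} (ht : t ≤ T) : ∫⁻ ω, ‖σ t ω‖ₑ ∂Q ≤ 1 := by
  classical
  have hB : ∀ p : Finset U × ℕ, ∫⁻ ω in truncEvent N p.1 p.2 t, ‖σ t ω‖ₑ ∂Q ≤ 1 := by
    rintro ⟨F, m⟩
    refine (lintegral_mono_set (truncEvent_mono_right m.le_succ t)).trans ?_
    have hm := (ℱ.le t) _ (h.measurableSet_truncEvent F (m + 1) t)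
    have hi := h.integrable_trunc isTest_traceTest F (m + 1) ht
    have heq : (truncEvent N F (m + 1) t).indicator (fun ω => traceTest W (X t ω) (σ t ω))
        =ᵐ[Q] fun ω => (((truncEvent N F (m + 1) t).indicator (fun ω => ‖σ t ω‖) ω : ℝ) : ℂ) := by
      filter_upwards [h.regular] with ω hω
      by_cases hB : ω ∈ truncEvent N F (m + 1) t
      · rw [indicator_of_mem hB, indicator_of_mem hB,
          traceTest_apply (h.bounded _ (hω.mem t ht)).1, (hω.isPos ht).trace_eq_norm]
      · rw [indicator_of_notMem hB, indicator_of_notMem hB, Complex.ofReal_zero]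
    have hi2 : Integrable ((truncEvent N F (m + 1) t).indicator (fun ω => ‖σ t ω‖)) Q := by
      have := (hi.congr heq).re
      simpa using this
    have h1 := h.re_truncExp_traceTest_le_one F m ht
    rw [truncExp, integral_congr_ae heq, integral_complex_ofReal, Complex.ofReal_re] at h1
    have h2 := ofReal_integral_eq_lintegral_ofReal hi2
      (Eventually.of_forall fun ω => indicator_nonneg (fun _ _ => norm_nonneg _) _)
    calc ∫⁻ ω in truncEvent N F (m + 1) t, ‖σ t ω‖ₑ ∂Q
        = ∫⁻ ω, ENNReal.ofReal ((truncEvent N F (m + 1) t).indicator (fun ω => ‖σ t ω‖) ω) ∂Q := by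
          rw [← lintegral_indicator hm]
          refine lintegral_congr fun ω => ?_
          by_cases hB : ω ∈ truncEvent N F (m + 1) t <;> simp [hB]
      _ = ENNReal.ofReal (∫ ω, (truncEvent N F (m + 1) t).indicator (fun ω => ‖σ t ω‖) ω ∂Q) :=
          h2.symm
      _ ≤ 1 := ENNReal.ofReal_le_one.2 h1
  have h1 := setLIntegral_iUnion_of_directed (μ := Q) (fun ω => ‖σ t ω‖ₑ)
    (truncEvent_mono (N := N) t).directed_le
  have h2 : (⋃ p : Finset U × ℕ, truncEvent N p.1 p.2 t) =ᵐ[Q] univ := by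
    refine eventuallyEq_univ.2 ?_
    filter_upwards [h.regular] with ω hω
    exact mem_iUnion.2 (hω.exists_mem_truncEvent ht)
  rw [setLIntegral_congr h2, setLIntegral_univ] at h1
  rw [h1]
  exact iSup_le hB

lemma integrable_state {t : ℝ≥0} (ht : t ≤ T) : Integrable (σ t) Q :=
  ⟨((h.adapted_state t).mono (ℱ.le t)).aestronglyMeasurable,
    (h.lintegral_enorm_state_le ht).trans_lt ENNReal.one_lt_top⟩

lemma integral_norm_state_le {t : ℝ≥0} (ht : t ≤ T) : ∫ ω, ‖σ t ω‖ ∂Q ≤ 1 := by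
  rw [integral_norm_eq_lintegral_enorm (h.integrable_state ht).1]
  exact ENNReal.toReal_le_of_le_ofReal zero_le_one (by
    rw [ENNReal.ofReal_one]; exact h.lintegral_enorm_state_le ht)

end IsRegularProcess

end Moments
end

noncomputable section

open TraceClass Function

/-! ## Differentiation of expectations along the walk -/

section Limit

variable {s : ℕ} {U D₁ D₂ : Type*} {𝓗 : Type v} [NormedAddCommGroup 𝓗] [InnerProductSpace ℂ 𝓗]
  [CompleteSpace 𝓗] {Ω : Type*} {mΩ : MeasurableSpace Ω} {G : Type*} [NormedAddCommGroup G]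
  [NormedSpace ℂ G]
  {W : HybridWalk s U D₁ D₂ 𝓗} {S : Set (EuclideanSpace ℝ (Fin s))} {C T D : ℝ≥0}
  {Ψ : EuclideanSpace ℝ (Fin s) → TraceClass 𝓗 →L[ℂ] G}

/-- The expectation of a test family. -/
def testExp (Q : Measure Ω) (X : ℝ≥0 → Ω → EuclideanSpace ℝ (Fin s))
    (σ : ℝ≥0 → Ω → TraceClass 𝓗) (Ψ : EuclideanSpace ℝ (Fin s) → TraceClass 𝓗 →L[ℂ] G)
    (t : ℝ≥0) : G :=
  ∫ ω, Ψ (X t ω) (σ t ω) ∂Q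

variable [CompleteSpace G]

/-- The action of the full generator on a test family. -/
def genTest (W : HybridWalk s U D₁ D₂ 𝓗) (S : Set (EuclideanSpace ℝ (Fin s)))
    (Ψ : EuclideanSpace ℝ (Fin s) → TraceClass 𝓗 →L[ℂ] G) :
    EuclideanSpace ℝ (Fin s) → TraceClass 𝓗 →L[ℂ] G :=
  S.indicator fun x => (Ψ x).comp (W.gen x)
    + sumMap fun u => (Ψ (W.move u x)).comp (W.jumpL x u)

lemma IsTest.sumBound (hΨ : IsTest W Ψ D) (hS : W.BoundedOn S C) {x : EuclideanSpace ℝ (Fin s)}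
    (hx : x ∈ S) : SumBound (fun u => (Ψ (W.move u x)).comp (W.jumpL x u)) (D * C) := fun ρ F => by
  have h1 := HybridWalk.sumBound_jumpL (hS x hx).1 ρ F
  have h2 := (hS x hx).2.2
  push_cast at h1 ⊢
  calc ∑ u ∈ F, ‖(Ψ (W.move u x)).comp (W.jumpL x u) ρ‖ ≤ ∑ u ∈ F, D * ‖W.jumpL x u ρ‖ :=
        Finset.sum_le_sum fun u _ => ContinuousLinearMap.le_of_opNorm_le _ (hΨ.norm_le _) _
    _ = D * ∑ u ∈ F, ‖W.jumpL x u ρ‖ := (Finset.mul_sum _ _ _).symm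
    _ ≤ D * (C * ‖ρ‖) := by
        gcongr
        exact h1.trans (by gcongr)
    _ = D * C * ‖ρ‖ := (mul_assoc _ _ _).symm

lemma IsTest.sum_norm_jumpTest_le (hΨ : IsTest W Ψ D) (hS : W.BoundedOn S C)
    {x : EuclideanSpace ℝ (Fin s)} (hx : x ∈ S) (ρ : TraceClass 𝓗) (F : Finset U) :
    ∑ u ∈ F, ‖_root_.jumpTest W S u Ψ x ρ‖ ≤ (D * C : ℝ≥0) * ‖ρ‖ := by
  refine le_trans (Finset.sum_le_sum fun u _ => ?_) (hΨ.sumBound hS hx ρ F)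
  rw [_root_.jumpTest, indicator_of_mem hx]

lemma IsTest.hasSum_genTest (hΨ : IsTest W Ψ D) (hS : W.BoundedOn S C)
    {x : EuclideanSpace ℝ (Fin s)} (hx : x ∈ S) (ρ : TraceClass 𝓗) :
    HasSum (fun u => _root_.jumpTest W S u Ψ x ρ)
      (genTest W S Ψ x ρ - _root_.driftTest W S Ψ x ρ) := by
  have h1 := (hΨ.sumBound hS hx).hasSum ρ
  rw [genTest, _root_.driftTest, indicator_of_mem hx, indicator_of_mem hx,
    ContinuousLinearMap.add_apply, add_sub_cancel_left]
  simpa [_root_.jumpTest, hx] using h1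

lemma IsTest.genTest (hΨ : IsTest W Ψ D) (hS : W.BoundedOn S C) :
    IsTest W (genTest W S Ψ) (D * (C + W.totalRate) + D * C) where
  norm_le x := by
    by_cases hx : x ∈ S
    · have h1 := (hΨ.driftTest hS).norm_le x
      rw [_root_.driftTest, indicator_of_mem hx] at h1
      rw [_root_.genTest, indicator_of_mem hx, NNReal.coe_add]
      exact (norm_add_le _ _).trans (add_le_add h1 (hΨ.sumBound hS hx).norm_sumMap_le)
    · rw [_root_.genTest, indicator_of_notMem hx, norm_zero]
      exact NNReal.coe_nonneg _
  support x hx := indicator_of_notMem (fun h => hx (hS x h).1) _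

variable {ℱ : Filtration ℝ≥0 mΩ} {Q : Measure Ω}
  {N : U → ℝ≥0 → Ω → ℕ} {X : ℝ≥0 → Ω → EuclideanSpace ℝ (Fin s)} {σ : ℝ≥0 → Ω → TraceClass 𝓗}

lemma IsRegularPath.eventually_mem_truncEvent {ω : Ω}
    (h : IsRegularPath W S (fun u t => N u t ω) T (fun t => X t ω) (fun t => σ t ω)) {t : ℝ≥0}
    (ht : t ≤ T) : ∀ᶠ p : Finset U × ℕ in atTop, ω ∈ truncEvent N p.1 p.2 t := by
  obtain ⟨p, hp⟩ := h.exists_mem_truncEvent ht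
  filter_upwards [eventually_ge_atTop p] with q hq using truncEvent_mono t hq hp

variable [Countable U] [IsProbabilityMeasure Q]

namespace IsRegularProcess

variable (h : IsRegularProcess W ℱ Q N X σ S C T)

include h

lemma integrable_test (hΨ : IsTest W Ψ D) {t : ℝ≥0} (ht : t ≤ T) :
    Integrable (fun ω => Ψ (X t ω) (σ t ω)) Q :=
  ((h.integrable_state ht).norm.const_mul (D : ℝ)).mono'
    ((h.stronglyMeasurable_test hΨ t).mono (ℱ.le t)).aestronglyMeasurable
    (Eventually.of_forall fun ω => ContinuousLinearMap.le_of_opNorm_le _ (hΨ.norm_le _) _)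

lemma norm_testExp_le (hΨ : IsTest W Ψ D) {t : ℝ≥0} (ht : t ≤ T) :
    ‖testExp Q X σ Ψ t‖ ≤ D := by
  refine (norm_integral_le_of_norm_le ((h.integrable_state ht).norm.const_mul (D : ℝ))
    (Eventually.of_forall fun ω =>
      ContinuousLinearMap.le_of_opNorm_le _ (hΨ.norm_le _) _)).trans ?_
  rw [integral_const_mul]
  exact mul_le_of_le_one_right D.coe_nonneg (h.integral_norm_state_le ht)

lemma tendsto_truncExp (hΨ : IsTest W Ψ D) {t : ℝ≥0} (ht : t ≤ T) :
    Tendsto (fun p : Finset U × ℕ => truncExp Q N X σ p.1 (p.2 + 1) Ψ t) atTop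
      (𝓝 (testExp Q X σ Ψ t)) := by
  refine tendsto_integral_filter_of_dominated_convergence (fun ω => ‖Ψ (X t ω) (σ t ω)‖)
    (Eventually.of_forall fun p => (h.integrable_trunc hΨ p.1 (p.2 + 1) ht).1)
    (Eventually.of_forall fun p => Eventually.of_forall fun ω => norm_indicator_le_norm_self _ _)
    (h.integrable_test hΨ ht).norm ?_
  filter_upwards [h.regular] with ω hω
  refine tendsto_const_nhds.congr' ?_
  filter_upwards [hω.eventually_mem_truncEvent ht] with p hp
  rw [indicator_of_mem (truncEvent_mono_right p.2.le_succ t hp)]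

/-- The constant is independent of F and m, because the weighted jump maps are summable over all
types with a bound by R. This gives an integrable majorant where the truncated state bounds blow up.
-/
lemma ae_norm_trunc_deriv_le (hΨ : IsTest W Ψ D) (F : Finset U) (m : ℕ) {t : ℝ≥0} (ht : t ≤ T) :
    ∀ᵐ ω ∂Q, ‖(truncEvent N F (m + 1) t).indicator (fun ω => driftTest W S Ψ (X t ω) (σ t ω)) ω
      + ∑ u ∈ F, (truncEvent N F m t).indicator (fun ω => jumpTest W S u Ψ (X t ω) (σ t ω)) ω‖
      ≤ (D * (C + W.totalRate) + D * C : ℝ≥0) * ‖σ t ω‖ := by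
  filter_upwards [h.regular] with ω hω
  rw [NNReal.coe_add, add_mul]
  refine (norm_add_le _ _).trans (add_le_add ((norm_indicator_le_norm_self _ _).trans
    (ContinuousLinearMap.le_of_opNorm_le _ ((hΨ.driftTest h.bounded).norm_le _) _)) ?_)
  refine (norm_sum_le _ _).trans (le_trans (Finset.sum_le_sum fun u _ =>
    norm_indicator_le_norm_self _ _) ?_)
  exact hΨ.sum_norm_jumpTest_le h.bounded (hω.mem t ht) _ F

lemma norm_truncExpDeriv_le_const (hΨ : IsTest W Ψ D) (F : Finset U) (m : ℕ) {t : ℝ≥0}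
    (ht : t ≤ T) :
    ‖truncExpDeriv W S Q N X σ F m Ψ t‖ ≤ (D * (C + W.totalRate) + D * C : ℝ≥0) := by
  rw [(h.truncExpDeriv_eq_integral hΨ F m ht).2]
  refine (norm_integral_le_of_norm_le ((h.integrable_state ht).norm.const_mul _)
    (h.ae_norm_trunc_deriv_le hΨ F m ht)).trans ?_
  rw [integral_const_mul]
  exact mul_le_of_le_one_right (NNReal.coe_nonneg _) (h.integral_norm_state_le ht)

lemma tendsto_truncExpDeriv (hΨ : IsTest W Ψ D) {t : ℝ≥0} (ht : t ≤ T) :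
    Tendsto (fun p : Finset U × ℕ => truncExpDeriv W S Q N X σ p.1 p.2 Ψ t) atTop
      (𝓝 (testExp Q X σ (genTest W S Ψ) t)) := by
  simp only [fun p : Finset U × ℕ => (h.truncExpDeriv_eq_integral hΨ p.1 p.2 ht).2]
  refine tendsto_integral_filter_of_dominated_convergence _
    (Eventually.of_forall fun p => (h.truncExpDeriv_eq_integral hΨ p.1 p.2 ht).1.1)
    (Eventually.of_forall fun p => h.ae_norm_trunc_deriv_le hΨ p.1 p.2 ht)
    ((h.integrable_state ht).norm.const_mul _) ?_
  filter_upwards [h.regular] with ω hω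
  have h1 : Tendsto (fun p : Finset U × ℕ => ∑ u ∈ p.1, jumpTest W S u Ψ (X t ω) (σ t ω)) atTop
      (𝓝 (genTest W S Ψ (X t ω) (σ t ω) - driftTest W S Ψ (X t ω) (σ t ω))) := by
    have h2 : Tendsto (fun F : Finset U => ∑ u ∈ F, jumpTest W S u Ψ (X t ω) (σ t ω)) atTop
      (𝓝 (genTest W S Ψ (X t ω) (σ t ω) - driftTest W S Ψ (X t ω) (σ t ω))) :=
      hΨ.hasSum_genTest h.bounded (hω.mem t ht) (σ t ω)
    rw [← prod_atTop_atTop_eq]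
    exact h2.comp tendsto_fst
  have h3 := h1.const_add (driftTest W S Ψ (X t ω) (σ t ω))
  rw [add_sub_cancel] at h3
  refine h3.congr' ?_
  filter_upwards [hω.eventually_mem_truncEvent ht] with p hp
  rw [indicator_of_mem (truncEvent_mono_right p.2.le_succ t hp)]
  congr 1
  exact Finset.sum_congr rfl fun u _ => by rw [indicator_of_mem hp]

/-- Measurability in time comes from continuity of the truncated derivatives, whose limit this is;
continuity of the limit is not yet known. -/
lemma intervalIntegrable_testExp_genTest (hΨ : IsTest W Ψ D) (a b : ℝ) :
    IntervalIntegrable (fun r : ℝ => testExp Q X σ (genTest W S Ψ) (min r.toNNReal T)) volume a b := by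
  classical
  have hm : AEStronglyMeasurable
      (fun r : ℝ => testExp Q X σ (genTest W S Ψ) (min r.toNNReal T)) volume :=
    aestronglyMeasurable_of_tendsto_ae atTop (f := fun (p : Finset U × ℕ) (r : ℝ) =>
      truncExpDeriv W S Q N X σ p.1 p.2 Ψ (min r.toNNReal T))
      (fun p => (h.isStepLipschitz_truncExpDeriv hΨ p.1 p.2).continuous.aestronglyMeasurable)
      (Eventually.of_forall fun r => h.tendsto_truncExpDeriv hΨ (min_le_right _ _))
  exact (intervalIntegrable_const (c := ((D * (C + W.totalRate) + D * C : ℝ≥0) : ℝ))).mono_fun'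
    hm.restrict (Eventually.of_forall fun r =>
      h.norm_testExp_le (hΨ.genTest h.bounded) (min_le_right _ _))

theorem testExp_eq_add_integral (hΨ : IsTest W Ψ D) {t : ℝ≥0} (ht : t ≤ T) :
    testExp Q X σ Ψ t = testExp Q X σ Ψ 0
      + ∫ r in (0 : ℝ)..t, testExp Q X σ (genTest W S Ψ) (min r.toNNReal T) := by
  classical
  refine tendsto_nhds_unique (h.tendsto_truncExp hΨ ht) ?_
  simp only [fun p : Finset U × ℕ => h.truncExp_eq_add_integral hΨ p.1 p.2 ht]
  refine (h.tendsto_truncExp hΨ bot_le).add ?_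
  exact intervalIntegral.tendsto_integral_filter_of_dominated_convergence
    (fun _ => (D * (C + W.totalRate) + D * C : ℝ≥0))
    (Eventually.of_forall fun p =>
      (h.isStepLipschitz_truncExpDeriv hΨ p.1 p.2).continuous.aestronglyMeasurable)
    (Eventually.of_forall fun p => Eventually.of_forall fun r _ =>
      h.norm_truncExpDeriv_le_const hΨ p.1 p.2 (min_le_right _ _))
    intervalIntegrable_const
    (Eventually.of_forall fun r _ => h.tendsto_truncExpDeriv hΨ (min_le_right _ _))

/-- The bounded integrand gives Lipschitz continuity for every test family. Applied to the image
under the generator, this makes the integrand continuous and the integral equation differentiable.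
-/
lemma isStepLipschitz_testExp (hΨ : IsTest W Ψ D) : IsStepLipschitz (testExp Q X σ Ψ) T :=
  isStepLipschitz_of_eq_add_integral
    (fun _ ht => h.norm_testExp_le (hΨ.genTest h.bounded) ht)
    (fun _ ht => h.testExp_eq_add_integral hΨ ht) (h.intervalIntegrable_testExp_genTest hΨ)

theorem hasDerivWithinAt_testExp (hΨ : IsTest W Ψ D) {t : ℝ≥0} (ht : t < T) :
    HasDerivWithinAt (fun r : ℝ => testExp Q X σ Ψ r.toNNReal)
      (testExp Q X σ (genTest W S Ψ) t) (Ici 0) t :=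
  hasDerivWithinAt_of_eq_add_integral (h.isStepLipschitz_testExp (hΨ.genTest h.bounded))
    (fun _ ht => h.testExp_eq_add_integral hΨ ht) ht

end IsRegularProcess

end Limit
end

noncomputable section

open TraceClass Function

/-! ## Series of anticommutators -/

namespace TraceClass

open ContinuousLinearMap InnerProductSpace

variable {𝓗 : Type v} [NormedAddCommGroup 𝓗] [InnerProductSpace ℂ 𝓗] [CompleteSpace 𝓗]

/-- Right multiplication acts on the bras through the adjoints, so it is their strong convergence
that counts. -/
lemma tendsto_sandwich_right {ι : Type*} {l : Filter ι} {A : ι → 𝓗 →L[ℂ] 𝓗} {B : 𝓗 →L[ℂ] 𝓗} {c : ℝ}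
    (hA : ∀ i, ‖A i‖ ≤ c) (h : ∀ a, Tendsto (fun i => adjoint (A i) a) l (𝓝 (adjoint B a)))
    (ρ : TraceClass 𝓗) : Tendsto (fun i => sandwich 1 ρ (A i)) l (𝓝 (sandwich 1 ρ B)) := by
  obtain ⟨ι, a, b, h1, h2, h3⟩ := isNuclear ρ
  have h4 : ∀ T : 𝓗 →L[ℂ] 𝓗, sandwich 1 ρ T = ∑' i, ketbra (a i) (adjoint T (b i)) := fun T => by
    have := (h3.mapL (sandwichL 1 T)).tsum_eq
    simpa [sandwich_ketbra] using this.symm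
  simp only [h4]
  refine tendsto_tsum_of_dominated_convergence (h1.mul_left c) (fun k => ?_)
    (Eventually.of_forall fun i k => ?_)
  · rw [tendsto_iff_norm_sub_tendsto_zero]
    have h5 := (tendsto_iff_norm_sub_tendsto_zero.1 (h (b k))).const_mul ‖a k‖
    rw [mul_zero] at h5
    refine squeeze_zero (fun _ => norm_nonneg _) (fun i => ?_) h5
    have : ketbra (a k) (adjoint (A i) (b k)) - ketbra (a k) (adjoint B (b k))
        = ketbra (a k) (adjoint (A i) (b k) - adjoint B (b k)) :=
      toOp_injective (by simp)
    rw [this]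
    exact norm_ketbra_le _ _
  · calc _ ≤ ‖a k‖ * ‖adjoint (A i) (b k)‖ := norm_ketbra_le _ _
      _ ≤ ‖a k‖ * (c * ‖b k‖) := by
        gcongr
        refine le_of_opNorm_le _ ?_ _
        rw [LinearIsometryEquiv.norm_map]
        exact hA i
      _ = _ := by ring

/-- Partial sums are self-adjoint, bounded by ‖B‖ and strongly convergent, so both products with ρ
converge in trace norm along the net of finite sets, that is, unconditionally. -/
lemma hasSum_anticommutator {κ : Type*} {f : κ → 𝓗 →L[ℂ] 𝓗} (hf : ∀ u, (f u).IsPositive)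
    {B : 𝓗 →L[ℂ] 𝓗} (hB : ∀ a, HasSum (fun u => f u a) (B a)) (ρ : TraceClass 𝓗) :
    HasSum (fun u => anticommutator (f u) ρ) (anticommutator B ρ) := by
  have hs : ∀ s : Finset κ, ∑ u ∈ s, anticommutator (f u) ρ
      = sandwich (∑ u ∈ s, f u) ρ 1 + sandwich 1 ρ (∑ u ∈ s, f u) := fun s => toOp_injective (by
    simp [anticommutator, map_sum, Finset.sum_add_distrib, Finset.sum_mul, Finset.mul_sum])
  have hlim : ∀ a, Tendsto (fun s : Finset κ => (∑ u ∈ s, f u) a) atTop (𝓝 (B a)) := fun a => by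
    simp only [ContinuousLinearMap.sum_apply]
    exact hB a
  have hadj : ∀ s : Finset κ, adjoint (∑ u ∈ s, f u) = ∑ u ∈ s, f u := fun s => by
    rw [map_sum]
    exact Finset.sum_congr rfl fun u _ => (hf u).isSelfAdjoint.adjoint_eq
  have hadjB : adjoint B = B := (isPositive_of_hasSum hf hB).isSelfAdjoint.adjoint_eq
  have h1 := tendsto_sandwich_left (norm_sum_le_of_hasSum hf hB) hlim ρ
  have h2 := tendsto_sandwich_right (l := atTop) (B := B) (norm_sum_le_of_hasSum hf hB)
    (by simpa only [hadj, hadjB] using hlim) ρ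
  have h3 := h1.add h2
  simp only [← hs] at h3
  exact h3

lemma convex_isPos : Convex ℝ {ρ : TraceClass 𝓗 | IsPos ρ} := fun ρ hρ τ hτ a b ha hb _ => by
  have h1 := (IsPos.smul hρ ha).add (IsPos.smul hτ hb)
  rwa [Complex.coe_smul, Complex.coe_smul] at h1

end TraceClass

/-! ### Splitting the total jump rate by target vertex. -/

section Rates

variable {s : ℕ} {U D₁ D₂ : Type*} {𝓗 : Type v} [NormedAddCommGroup 𝓗] [InnerProductSpace ℂ 𝓗]
  [CompleteSpace 𝓗] {W : HybridWalk s U D₁ D₂ 𝓗}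

namespace HybridWalk

lemma rateOp_of_notMem {u : U} {x : EuclideanSpace ℝ (Fin s)} (h : x ∉ W.F u) :
    W.rateOp x u = 0 := indicator_of_notMem h _

lemma jumpL_of_notMem {u : U} {x : EuclideanSpace ℝ (Fin s)} (hx : x ∈ W.V) (h : x ∉ W.F u) :
    W.jumpL x u = 0 := by
  ext1 ρ
  rw [jumpL_apply hx, jumpMap, indicator_of_notMem h, smul_zero, _root_.zero_apply]

lemma rateOn_isPositive {x : EuclideanSpace ℝ (Fin s)} (hx : x ∈ W.V) (A : Set U) :
    (W.rateOn x A).IsPositive :=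
  isPositive_of_hasSum (fun u => by
    by_cases hu : u ∈ A
    · rw [indicator_of_mem hu]
      exact rateOp_isPositive u
    · rw [indicator_of_notMem hu]
      exact ContinuousLinearMap.isPositive_zero) (hasSum_rateOn hx A)

/-- The types are partitioned by their target. Targets outside V contribute nothing: the rate
vanishes off F_u, and on F_u the target is a vertex. -/
lemma hasSum_rateOn_target {x : EuclideanSpace ℝ (Fin s)} (hx : x ∈ W.V) (a : 𝓗) :
    HasSum (fun l : W.V => W.rateOn x {u | W.y u x = (l : EuclideanSpace ℝ (Fin s))} a)
      (W.R x a) := by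
  have h1 : HasSum (fun l : EuclideanSpace ℝ (Fin s) => W.rateOn x {u | W.y u x = l} a)
      (W.R x a) := by
    refine HasSum.sigma (γ := fun l => {u // W.y u x = l})
      ((Equiv.sigmaFiberEquiv fun u => W.y u x).hasSum_iff.2 (hasSum_rateOp hx a)) fun l => ?_
    have h2 := hasSum_rateOn hx {u | W.y u x = l} a
    have h3 : (fun u => ({u | W.y u x = l}.indicator (W.rateOp x) u) a)
        = {u | W.y u x = l}.indicator fun u => W.rateOp x u a := by
      ext u
      by_cases hu : W.y u x = l <;> simp [hu]
    rw [h3] at h2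
    exact hasSum_subtype_iff_indicator.2 h2
  refine (hasSum_subtype_iff_of_support_subset fun l hl => ?_).2 h1
  by_contra hlV
  refine hl ?_
  have h2 := hasSum_rateOn hx {u | W.y u x = l} a
  have h3 : ∀ u, ({u | W.y u x = l}.indicator (W.rateOp x) u) a = 0 := fun u => by
    by_cases hu : W.y u x = l
    · rw [indicator_of_mem (show u ∈ {u | W.y u x = l} from hu), rateOp_of_notMem,
        _root_.zero_apply]
      exact fun hF => hlV (hu ▸ W.y_mem u x hF)
    · rw [indicator_of_notMem (show u ∉ {u | W.y u x = l} from hu),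
        _root_.zero_apply]
  simp only [h3] at h2
  exact h2.unique hasSum_zero

lemma hasSum_anticommutator_dualMap (k : W.V) (ρ : TraceClass 𝓗) :
    HasSum (fun l : W.V => (1 / 2 : ℂ) • anticommutator (dualMap (W.transfer l k) 1) ρ)
      ((1 / 2 : ℂ) • anticommutator (W.R k) ρ) := by
  simp only [dualMap_transfer]
  exact (hasSum_anticommutator (fun _ => rateOn_isPositive k.2 _) (hasSum_rateOn_target k.2)
    ρ).const_smul _

end HybridWalk

end Rates
end

noncomputable section

open TraceClass Function

/-! ## The reduced operators -/

section Reduced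

variable {s : ℕ} {U D₁ D₂ : Type*} {𝓗 : Type v} [NormedAddCommGroup 𝓗] [InnerProductSpace ℂ 𝓗]
  [CompleteSpace 𝓗] {Ω : Type*} {mΩ : MeasurableSpace Ω} {G : Type*} [NormedAddCommGroup G]
  [NormedSpace ℂ G] [CompleteSpace G]
  {W : HybridWalk s U D₁ D₂ 𝓗} {S : Set (EuclideanSpace ℝ (Fin s))} {C T D : ℝ≥0}
  {Ψ : EuclideanSpace ℝ (Fin s) → TraceClass 𝓗 →L[ℂ] G}

/-- The identity at `k` and zero elsewhere, as a test family. -/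
def vertexTest (k : EuclideanSpace ℝ (Fin s)) :
    EuclideanSpace ℝ (Fin s) → TraceClass 𝓗 →L[ℂ] TraceClass 𝓗 :=
  ({k} : Set (EuclideanSpace ℝ (Fin s))).indicator fun _ => ContinuousLinearMap.id ℂ _

lemma isTest_vertexTest (k : W.V) : IsTest W (vertexTest k) 1 where
  norm_le x := (norm_indicator_le_norm_self _ _).trans ContinuousLinearMap.norm_id_le
  support x hx := indicator_of_notMem (fun h => hx (by rw [mem_singleton_iff.1 h]; exact k.2)) _

lemma vertexTest_self (k : EuclideanSpace ℝ (Fin s)) (ρ : TraceClass 𝓗) : vertexTest k k ρ = ρ := by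
  rw [vertexTest, indicator_of_mem (mem_singleton k)]
  rfl

lemma vertexTest_of_ne {k x : EuclideanSpace ℝ (Fin s)} (h : x ≠ k) :
    vertexTest (𝓗 := 𝓗) k x = 0 :=
  indicator_of_notMem (fun h' => h (mem_singleton_iff.1 h')) _

variable {ℱ : Filtration ℝ≥0 mΩ} {Q : Measure Ω}
  {N : U → ℝ≥0 → Ω → ℕ} {X : ℝ≥0 → Ω → EuclideanSpace ℝ (Fin s)} {σ : ℝ≥0 → Ω → TraceClass 𝓗}

lemma indicator_eq_vertexTest (k : EuclideanSpace ℝ (Fin s)) (t : ℝ≥0) :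
    {ω | X t ω = k}.indicator (σ t) = fun ω => vertexTest k (X t ω) (σ t ω) := by
  ext1 ω
  by_cases h : X t ω = k
  · rw [indicator_of_mem (show ω ∈ {ω | X t ω = k} from h), h, vertexTest_self]
  · rw [indicator_of_notMem (show ω ∉ {ω | X t ω = k} from h), vertexTest_of_ne h,
      _root_.zero_apply]

lemma reducedState_eq_testExp (k : EuclideanSpace ℝ (Fin s)) (t : ℝ≥0) :
    reducedState Q X σ k t = testExp Q X σ (vertexTest k) t := by
  rw [reducedState, indicator_eq_vertexTest]
  rfl

/-- The balance between drift and jumps is exact once all types are included. -/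
lemma genTest_traceTest_apply (hS : W.BoundedOn S C) {x : EuclideanSpace ℝ (Fin s)} (hx : x ∈ S)
    (ρ : TraceClass 𝓗) : genTest W S (traceTest W) x ρ = 0 := by
  have hxV := (hS x hx).1
  have h1 := isTest_traceTest.hasSum_genTest hS hx ρ
  have h2 := HybridWalk.hasSum_trace_jumpL hxV ρ
  have h3 : (fun u => jumpTest W S u (traceTest W) x ρ) = fun u => trace (W.jumpL x u ρ) := by
    ext u
    rw [jumpTest, indicator_of_mem hx, ContinuousLinearMap.comp_apply,
      traceTest_apply (HybridWalk.move_mem u hxV)]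
  have h4 : driftTest W S (traceTest W) x ρ = trace (W.gen x ρ) := by
    rw [driftTest, indicator_of_mem hx, ContinuousLinearMap.comp_apply, traceTest_apply hxV]
  rw [h3, h4] at h1
  have h5 := h1.unique h2
  rwa [sub_eq_neg_self] at h5

/-- Only jumps landing at k survive. Types with l outside F_u do not move the walker, but their jump
map is zero, so the value of y there is harmless. -/
lemma genTest_vertexTest_apply (k l : W.V) (hl : (l : EuclideanSpace ℝ (Fin s)) ∈ S)
    (ρ : TraceClass 𝓗) :
    genTest W S (vertexTest (k : EuclideanSpace ℝ (Fin s))) l ρ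
      = vertexTest (k : EuclideanSpace ℝ (Fin s)) l (W.gen l ρ) + W.transfer k l ρ := by
  suffices hu : (fun u => (vertexTest (k : EuclideanSpace ℝ (Fin s)) (W.move u l)).comp
      (W.jumpL l u)) = {u | W.y u l = (k : EuclideanSpace ℝ (Fin s))}.indicator (W.jumpL l) by
    rw [genTest, indicator_of_mem hl, HybridWalk.transfer_eq, ← hu]
    rfl
  ext1 u
  by_cases hF : (l : EuclideanSpace ℝ (Fin s)) ∈ W.F u
  · rw [HybridWalk.move, if_pos hF]
    by_cases h : W.y u l = (k : EuclideanSpace ℝ (Fin s))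
    · rw [indicator_of_mem (show u ∈ {u | W.y u l = (k : EuclideanSpace ℝ (Fin s))} from h), h]
      ext1 ρ
      rw [ContinuousLinearMap.comp_apply, vertexTest_self]
    · rw [indicator_of_notMem (show u ∉ {u | W.y u l = (k : EuclideanSpace ℝ (Fin s))} from h),
        vertexTest_of_ne h, ContinuousLinearMap.zero_comp]
  · rw [HybridWalk.jumpL_of_notMem l.2 hF, ContinuousLinearMap.comp_zero]
    by_cases h : W.y u l = (k : EuclideanSpace ℝ (Fin s))
    · rw [indicator_of_mem (show u ∈ {u | W.y u l = (k : EuclideanSpace ℝ (Fin s))} from h),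
        HybridWalk.jumpL_of_notMem l.2 hF]
    · rw [indicator_of_notMem (show u ∉ {u | W.y u l = (k : EuclideanSpace ℝ (Fin s))} from h)]

variable [Countable U] [IsProbabilityMeasure Q]

namespace IsRegularProcess

variable (h : IsRegularProcess W ℱ Q N X σ S C T)

include h

lemma integrable_indicator (k : W.V) {t : ℝ≥0} (ht : t ≤ T) :
    Integrable ({ω | X t ω = k}.indicator (σ t)) Q := by
  rw [indicator_eq_vertexTest]
  exact h.integrable_test (isTest_vertexTest k) ht

lemma reducedState_isPos (k : W.V) {t : ℝ≥0} (ht : t ≤ T) : IsPos (reducedState Q X σ k t) := by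
  refine convex_isPos.integral_mem isClosed_isPos ?_ (h.integrable_indicator k ht)
  filter_upwards [h.regular] with ω hω
  by_cases hk : ω ∈ {ω | X t ω = k}
  · rw [indicator_of_mem hk]
    exact hω.isPos ht
  · rw [indicator_of_notMem hk]
    exact isPos_zero

/-- Decomposition of an expectation according to the position. -/
lemma hasSum_test_reducedState (hΨ : IsTest W Ψ D) {t : ℝ≥0} (ht : t ≤ T) :
    HasSum (fun k : W.V => Ψ k (reducedState Q X σ k t)) (testExp Q X σ Ψ t) := by
  have hm : ∀ x : EuclideanSpace ℝ (Fin s), MeasurableSet {ω | X t ω = x} := fun x =>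
    ((h.adapted_walk t).mono (ℱ.le t)).measurable (measurableSet_singleton x)
  have := W.V_countable.to_subtype
  have h1 := hasSum_integral_iUnion (μ := Q) (s := fun k : W.V => {ω | X t ω = k})
    (f := fun ω => Ψ (X t ω) (σ t ω)) (fun k => hm k) (fun k l hkl =>
      disjoint_left.2 fun ω h1 h2 => hkl (Subtype.ext (h1.symm.trans h2)))
    (h.integrable_test hΨ ht).integrableOn
  have h2 : (⋃ k : W.V, {ω | X t ω = k}) =ᵐ[Q] univ := by
    refine eventuallyEq_univ.2 ?_
    filter_upwards [h.regular] with ω hω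
    exact mem_iUnion.2 ⟨⟨X t ω, hω.evolution.mem t ht⟩, rfl⟩
  rw [setIntegral_congr_set h2, setIntegral_univ] at h1
  rw [show testExp Q X σ Ψ t = ∫ ω, Ψ (X t ω) (σ t ω) ∂Q from rfl]
  convert h1 using 1
  funext k
  rw [reducedState, ← (Ψ k).integral_comp_comm (h.integrable_indicator k ht),
    ← integral_indicator (hm k)]
  refine integral_congr_ae (Eventually.of_forall fun ω => ?_)
  by_cases hk : ω ∈ {ω | X t ω = k}
  · have hk' : X t ω = k := hk
    simp only [indicator_of_mem hk, hk']
  · simp only [indicator_of_notMem hk, map_zero]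

lemma testExp_traceTest {t : ℝ≥0} (ht : t ≤ T) : testExp Q X σ (traceTest W) t = 1 := by
  have h0 : ∀ t ≤ T, testExp Q X σ (genTest W S (traceTest W)) t = 0 := fun t ht => by
    refine integral_eq_zero_of_ae ?_
    filter_upwards [h.regular] with ω hω
    exact genTest_traceTest_apply h.bounded (hω.mem t ht) _
  have h1 : testExp Q X σ (traceTest W) 0 = 1 := by
    have : (fun ω => traceTest W (X 0 ω) (σ 0 ω)) =ᵐ[Q] fun _ => 1 := by
      filter_upwards [h.regular] with ω hω
      rw [traceTest_apply (hω.evolution.mem 0 bot_le), hω.pos.trace_eq_norm, hω.norm,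
        Complex.ofReal_one]
    rw [testExp, integral_congr_ae this]
    simp
  rw [h.testExp_eq_add_integral isTest_traceTest ht, h1]
  simp only [h0 _ (min_le_right _ T), intervalIntegral.integral_zero, add_zero]

theorem hasSum_trace_reducedState {t : ℝ≥0} (ht : t ≤ T) :
    HasSum (fun k : W.V => trace (reducedState Q X σ k t)) 1 := by
  have h1 := h.hasSum_test_reducedState isTest_traceTest ht
  rw [h.testExp_traceTest ht] at h1
  simpa only [fun k : W.V => traceTest_apply k.2] using h1

lemma reducedState_eq_zero {k : EuclideanSpace ℝ (Fin s)} (hk : k ∉ S) {t : ℝ≥0} (ht : t ≤ T) :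
    reducedState Q X σ k t = 0 := by
  refine integral_eq_zero_of_ae ?_
  filter_upwards [h.regular] with ω hω
  have hne : ω ∉ {ω | X t ω = k} := fun h' => hk (by
    rw [← show X t ω = k from h']
    exact hω.mem t ht)
  rw [indicator_of_notMem hne]
  rfl

/-- Splitting the expected action of the generator by position l leaves the between-jump term only
at l = k and one transfer term for each l. -/
lemma hasSum_transfer_reducedState (k : W.V) {t : ℝ≥0} (ht : t ≤ T) :
    HasSum (fun l : W.V => W.transfer k l (reducedState Q X σ l t))
      (testExp Q X σ (genTest W S (vertexTest k)) t - W.gen k (reducedState Q X σ k t)) := by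
  classical
  have h1 := h.hasSum_test_reducedState ((isTest_vertexTest k).genTest h.bounded) ht
  have h2 : HasSum (fun l : W.V => vertexTest (k : EuclideanSpace ℝ (Fin s)) l
      (W.gen l (reducedState Q X σ l t))) (W.gen k (reducedState Q X σ k t)) := by
    have := hasSum_single (f := fun l : W.V => vertexTest (k : EuclideanSpace ℝ (Fin s)) l
      (W.gen l (reducedState Q X σ l t))) k fun l hl => by
        rw [vertexTest_of_ne fun h' => hl (Subtype.ext h')]
        rfl
    rwa [vertexTest_self] at this
  convert h1.sub h2 using 1
  funext l
  -- Off S the test family is cut to zero while the transfer map need not vanish; the reduced state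
  -- there is zero.
  by_cases hl : (l : EuclideanSpace ℝ (Fin s)) ∈ S
  · rw [genTest_vertexTest_apply k l hl, add_sub_cancel_left]
  · rw [h.reducedState_eq_zero hl ht, HybridWalk.transfer_eq]
    simp only [map_zero, sub_zero]

/-- The total loss ½{R(k), η_k} is what separates `gen` from ℒ₀, and it equals the sum of the loss
terms over all targets. -/
theorem hasSum_rate (k : W.V) {t : ℝ≥0} (ht : t ≤ T) :
    HasSum (fun l : W.V => W.transfer k l (reducedState Q X σ l t)
        - (1 / 2 : ℂ) • anticommutator (dualMap (W.transfer l k) 1) (reducedState Q X σ k t))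
      (testExp Q X σ (genTest W S (vertexTest k)) t - W.L₀ k (reducedState Q X σ k t)) := by
  have h1 := (h.hasSum_transfer_reducedState k ht).sub
    (HybridWalk.hasSum_anticommutator_dualMap k (reducedState Q X σ k t))
  rwa [HybridWalk.gen_apply k.2, sub_sub, sub_add_cancel] at h1

theorem hasDerivWithinAt_reducedState (k : W.V) {t : ℝ≥0} (ht : t < T) :
    HasDerivWithinAt (fun r : ℝ => reducedState Q X σ k r.toNNReal)
      (W.L₀ k (reducedState Q X σ k t)
        + ∑' l : W.V, (W.transfer k l (reducedState Q X σ l t)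
          - (1 / 2 : ℂ) • anticommutator (dualMap (W.transfer l k) 1)
              (reducedState Q X σ k t))) (Ici 0) (t : ℝ) := by
  rw [(h.hasSum_rate k ht.le).tsum_eq, add_sub_cancel]
  simp only [fun r : ℝ => reducedState_eq_testExp (Q := Q) (X := X) (σ := σ)
    (k : EuclideanSpace ℝ (Fin s)) r.toNNReal]
  exact h.hasDerivWithinAt_testExp (isTest_vertexTest k) ht

end IsRegularProcess

end Reduced
end

theorem mainTheorem1 {s : ℕ} {U D₁ D₂ 𝓗 Ω : Type*} [Countable U] [Countable D₁] [Countable D₂]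
    [NormedAddCommGroup 𝓗] [InnerProductSpace ℂ 𝓗] [CompleteSpace 𝓗]
    [TopologicalSpace.SeparableSpace 𝓗]
    {mΩ : MeasurableSpace Ω} (Q : Measure Ω) [IsProbabilityMeasure Q] (ℱ : Filtration ℝ≥0 mΩ)
    (W : HybridWalk s U D₁ D₂ 𝓗)
    (N : U → ℝ≥0 → Ω → ℕ) (hN : IsPoissonFamily ℱ Q W.ν N)
    (X : ℝ≥0 → Ω → EuclideanSpace ℝ (Fin s)) (hX : IsClassicalWalk W ℱ Q N X)
    (hB : HasBoundedCoefficients W Q X)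
    (ρ₀ : EuclideanSpace ℝ (Fin s) → TraceClass 𝓗)
    (hρ₀ : ∀ x ∈ W.V, TraceClass.IsStatisticalOperator (ρ₀ x))
    (σ : ℝ≥0 → Ω → TraceClass 𝓗) (hσ : IsLinearSMESolution W ℱ Q N X ρ₀ σ) :
    (∀ (k : W.V) (t : ℝ≥0),
      Integrable ({ω | X t ω = k}.indicator (σ t)) Q ∧
      (TraceClass.toOp (reducedState Q X σ k t)).IsPositive) ∧
    (∀ t : ℝ≥0, HasSum (fun k : W.V => TraceClass.trace (reducedState Q X σ k t)) 1) ∧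
    (∀ (k : W.V) (t : ℝ≥0),
      Summable (fun l : W.V => W.transfer k l (reducedState Q X σ l t)
        - (1 / 2 : ℂ) • TraceClass.anticommutator (TraceClass.dualMap (W.transfer l k) 1)
            (reducedState Q X σ k t)) ∧
      HasDerivWithinAt (fun r : ℝ => reducedState Q X σ k r.toNNReal)
        (W.L₀ k (reducedState Q X σ k t)
          + ∑' l : W.V, (W.transfer k l (reducedState Q X σ l t)
            - (1 / 2 : ℂ) • TraceClass.anticommutator (TraceClass.dualMap (W.transfer l k) 1)
                (reducedState Q X σ k t)))
        (Ici 0) (t : ℝ)) := by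
  -- The vertex set and the bound depend on the horizon; they only need to be fixed on one interval
  -- [0, T] at a time.
  have hreg : ∀ T : ℝ≥0, ∃ S C, IsRegularProcess W ℱ Q N X σ S C T := fun T => by
    obtain ⟨C, hC⟩ := exists_boundedOn_reachable hN hX hB T
    exact ⟨_, C, hN, hX.adapted, hσ.adapted, hC, ae_isRegularPath hN hX hρ₀ hσ T⟩
  refine ⟨fun k t => ?_, fun t => ?_, fun k t => ?_⟩
  · obtain ⟨S, C, h⟩ := hreg t
    exact ⟨h.integrable_indicator k le_rfl, h.reducedState_isPos k le_rfl⟩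
  · obtain ⟨S, C, h⟩ := hreg t
    exact h.hasSum_trace_reducedState le_rfl
  -- A derivative at t requires a horizon strictly beyond t.
  · obtain ⟨S, C, h⟩ := hreg (t + 1)
    exact ⟨(h.hasSum_rate k le_self_add).summable,
      h.hasDerivWithinAt_reducedState k (lt_add_one t)⟩
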